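/- Let $n\ge 3$ and $T>T_1=2\pi/\sqrt{n-2}$. Let $S^1(T)=\mathbb R/T\mathbb Z$ be the circle of length $T$, $(S^{n-1},d\xi^2)$ the standard unit sphere, and $g_0=dt^2+d\xi^2$ the product metric on $S^1(T)\times S^{n-1}$. A *pseudo-cylindric metric* is a metric $g_c=u_c^{4/(n-2)}g_0$ of constant scalar curvature, where $u_c$ is a smooth positive non-constant function on $S^1(T)\times S^{n-1}$. A *Derdzinski metric* is a warped product metric $ds^2+h(s)^{4/n}g_N$ on $S^1(L)\times N$ (with $L>0$), where $(N,g_N)$ is an $(n-1)$-dimensional Einstein manifold of scalar curvature $R>0$ and $h$ is a smooth, positive, non-constant, $L$-periodic solution of $$h''-\frac{nR}{4(n-1)}\,h^{1-4/n}=-\frac n4\,C\,h\qquad\text{for some constant } C>0 .$$ Then every pseudo-cylindric metric $g_c$ on $S^1(T)\times S^{n-1}$ has harmonic curvature (its Riemann curvature tensor is divergence free), and its Ricci tensor is not parallel. Moreover, there are $L>0$, a Derdzinski metric $g_D=ds^2+h(s)^{4/n}d\xi^2$ on $S^1(L)\times S^{n-1}$ with fibre the standard unit sphere, and a diffeomorphism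 $F:S^1(L)\times S^{n-1}\to S^1(T)\times S^{n-1}$ with $F^*g_c=g_D$; this $F$ is a conformal transformation from $g_D$ to $g_0$, that is, $F^*g_0=\psi\,g_D$ for a smooth positive function $\psi$. -/

import Mathlib

set_option maxSynthPendingDepth 3

open scoped Manifold ContDiff
open Set Metric

noncomputable section

/-! ### Riemannian geometry in one coordinate domain

`E` is a finite-dimensional real vector space and `G : E → E →L[ℝ] E →L[ℝ] ℝ` a field of symmetric
nondegenerate bilinear forms, defined near the point under consideration. The formulas are the usual
coordinate formulas, written without a choice of a basis of `E`. -/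
namespace Coord

variable {E : Type*} [NormedAddCommGroup E] [NormedSpace ℝ E]

/-- Exchanging the two arguments of a bilinear map. -/
def flipL (F : Type*) [NormedAddCommGroup F] [NormedSpace ℝ F] :
    (E →L[ℝ] E →L[ℝ] F) →L[ℝ] (E →L[ℝ] E →L[ℝ] F) :=
  (ContinuousLinearMap.flipₗᵢ ℝ E E F).toContinuousLinearEquiv.toContinuousLinearMap

theorem flipL_apply {F : Type*} [NormedAddCommGroup F] [NormedSpace ℝ F]
    (B : E →L[ℝ] E →L[ℝ] F) (v w : E) : flipL F B v w = B w v := rfl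

/-- The Koszul expression `½ (D_v G(w,z) + D_w G(v,z) - D_z G(v,w))`, as a trilinear form in
`v, w, z`. -/
def koszul (G : E → E →L[ℝ] E →L[ℝ] ℝ) (x : E) : E →L[ℝ] E →L[ℝ] E →L[ℝ] ℝ :=
  (2⁻¹ : ℝ) • (fderiv ℝ G x + (fderiv ℝ G x).flip - flipL ℝ ∘L (fderiv ℝ G x).flip)

theorem koszul_apply (G : E → E →L[ℝ] E →L[ℝ] ℝ) (x v w z : E) :
    koszul G x v w z =
      2⁻¹ * (fderiv ℝ G x v w z + fderiv ℝ G x w v z - fderiv ℝ G x z v w) := rfl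

/-- The Christoffel symbols `Γ(v,w)` of the Levi-Civita connection of `G`:
`G(Γ(v,w), z) = ½ (D_v G(w,z) + D_w G(v,z) - D_z G(v,w))`. -/
def christoffel (G : E → E →L[ℝ] E →L[ℝ] ℝ) (x : E) : E →L[ℝ] E →L[ℝ] E :=
  (ContinuousLinearMap.compL ℝ E (E →L[ℝ] ℝ) E (G x).inverse) ∘L (koszul G x)

theorem christoffel_apply (G : E → E →L[ℝ] E →L[ℝ] ℝ) (x v w : E) :
    christoffel G x v w = (G x).inverse (koszul G x v w) := rfl

/-- The curvature tensor `R(v,w)z` of the Levi-Civita connection of `G`. -/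
def riemann (G : E → E →L[ℝ] E →L[ℝ] ℝ) (x : E) : E →L[ℝ] E →L[ℝ] E →L[ℝ] E :=
  fderiv ℝ (christoffel G) x - (fderiv ℝ (christoffel G) x).flip +
    (ContinuousLinearMap.compL ℝ E E E).bilinearComp (christoffel G x) (christoffel G x) -
    ((ContinuousLinearMap.compL ℝ E E E).bilinearComp (christoffel G x) (christoffel G x)).flip

theorem riemann_apply (G : E → E →L[ℝ] E →L[ℝ] ℝ) (x v w z : E) :
    riemann G x v w z =
      fderiv ℝ (christoffel G) x v w z - fderiv ℝ (christoffel G) x w v z +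
        christoffel G x v (christoffel G x w z) - christoffel G x w (christoffel G x v z) := rfl

/-- `(∇_a R)(v,w)z`, the covariant derivative of the curvature tensor, as a linear map in `a`. -/
def covRiemann (G : E → E →L[ℝ] E →L[ℝ] ℝ) (x v w z : E) : E →ₗ[ℝ] E where
  toFun a := fderiv ℝ (riemann G) x a v w z + christoffel G x a (riemann G x v w z)
    - riemann G x (christoffel G x a v) w z - riemann G x v (christoffel G x a w) z
    - riemann G x v w (christoffel G x a z)
  map_add' a b := by
    simp only [map_add, _root_.add_apply]; abel
  map_smul' c a := by
    simp only [map_smul, _root_.smul_apply, smul_sub, smul_add, RingHom.id_apply]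

/-- The divergence of the curvature tensor: the trace of `a ↦ (∇_a R)(v,w)z`. -/
def divRiemann (G : E → E →L[ℝ] E →L[ℝ] ℝ) (x v w z : E) : ℝ :=
  LinearMap.trace ℝ E (covRiemann G x v w z)

variable [FiniteDimensional ℝ E]

variable (E) in
/-- The trace of an endomorphism, as a continuous linear map. -/
def traceL : (E →L[ℝ] E) →L[ℝ] ℝ :=
  LinearMap.toContinuousLinearMap (LinearMap.trace ℝ E ∘ₗ ContinuousLinearMap.coeLM ℝ)

/-- The Ricci tensor: `Ric(w,z)` is the trace of `v ↦ R(v,w)z`. -/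
def ricci (G : E → E →L[ℝ] E →L[ℝ] ℝ) (x : E) : E →L[ℝ] E →L[ℝ] ℝ :=
  (ContinuousLinearMap.compL ℝ E (E →L[ℝ] E) ℝ (traceL E)) ∘L (flipL E ∘L (riemann G x).flip)

theorem ricci_apply (G : E → E →L[ℝ] E →L[ℝ] ℝ) (x w z : E) :
    ricci G x w z = LinearMap.trace ℝ E (((riemann G x).flip w).flip z : E →L[ℝ] E) := rfl

/-- The covariant derivative of the Ricci tensor, `(∇_a Ric)(v,w)`. -/
def covRicci (G : E → E →L[ℝ] E →L[ℝ] ℝ) (x a v w : E) : ℝ :=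
  fderiv ℝ (ricci G) x a v w - ricci G x (christoffel G x a v) w -
    ricci G x v (christoffel G x a w)

/-- The scalar curvature: the trace of the Ricci tensor with respect to `G`. -/
def scalar (G : E → E →L[ℝ] E →L[ℝ] ℝ) (x : E) : ℝ :=
  traceL E ((G x).inverse ∘L ricci G x)

end Coord

/-! ### Metrics on manifolds, and their curvature -/

section Manifolds

/-- A field of bilinear forms on the tangent spaces of `M`. -/
abbrev MetricTensor {E : Type*} [NormedAddCommGroup E] [NormedSpace ℝ E]
    {H : Type*} [TopologicalSpace H] (I : ModelWithCorners ℝ E H)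
    (M : Type*) [TopologicalSpace M] [ChartedSpace H M] :=
  ∀ x : M, TangentSpace I x →L[ℝ] TangentSpace I x →L[ℝ] ℝ

variable {E : Type*} [NormedAddCommGroup E] [NormedSpace ℝ E]
  {H : Type*} [TopologicalSpace H] {I : ModelWithCorners ℝ E H}
  {M : Type*} [TopologicalSpace M] [ChartedSpace H M]
  {E' : Type*} [NormedAddCommGroup E'] [NormedSpace ℝ E']
  {H' : Type*} [TopologicalSpace H'] {J : ModelWithCorners ℝ E' H'}
  {N : Type*} [TopologicalSpace N] [ChartedSpace H' N]

/-- The pull-back `f^* g`: `(f^* g)_x(v,w) = g_{f x}(df_x v, df_x w)`. -/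
def MetricTensor.pullback (I : ModelWithCorners ℝ E H) (f : M → N) (g : MetricTensor J N) :
    MetricTensor I M := fun x =>
  ContinuousLinearMap.bilinearComp (E := E') (F := E') (E' := E) (F' := E) (g (f x))
    (mfderiv I J f x) (mfderiv I J f x)

theorem MetricTensor.pullback_apply (f : M → N) (g : MetricTensor J N) (x : M)
    (v w : TangentSpace I x) :
    MetricTensor.pullback I f g x v w = g (f x) (mfderiv I J f x v) (mfderiv I J f x w) := rfl

/-- The expression of `g` in the preferred chart at `p`, a field of bilinear forms on the model
space (meaningful on the target of the chart). -/
def MetricTensor.inChart (g : MetricTensor I M) (p : M) : E → E →L[ℝ] E →L[ℝ] ℝ :=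
  MetricTensor.pullback 𝓘(ℝ, E) (extChartAt I p).symm g

/-- The curvature of `g` is harmonic: the curvature tensor is divergence free. -/
def HasHarmonicCurvature (g : MetricTensor I M) : Prop :=
  ∀ (p : M) (v w z : E), Coord.divRiemann (g.inChart p) (extChartAt I p p) v w z = 0

variable [FiniteDimensional ℝ E]

/-- The scalar curvature of `g` at `p`. -/
def scalarCurvature (g : MetricTensor I M) (p : M) : ℝ :=
  Coord.scalar (g.inChart p) (extChartAt I p p)

/-- The Ricci tensor of `g` is parallel: `∇ Ric = 0`. -/
def HasParallelRicci (g : MetricTensor I M) : Prop :=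
  ∀ (p : M) (a v w : E), Coord.covRicci (g.inChart p) (extChartAt I p p) a v w = 0

/-- `g` is an Einstein metric with (constant) scalar curvature `R`: `Ric = (R / dim M) g`. -/
def IsEinstein (g : MetricTensor I M) (R : ℝ) : Prop :=
  ∀ (p : M) (v w : E), Coord.ricci (g.inChart p) (extChartAt I p p) v w =
    R / (Module.finrank ℝ E : ℝ) * g.inChart p (extChartAt I p p) v w

end Manifolds

/-! ### The circle of length `T`, as a manifold -/

section Circle

variable (T : ℝ) [hT : Fact (0 < T)]

/-- The charts of `ℝ / Tℤ` are the inverses of the restrictions of the projection `ℝ → ℝ / Tℤ` to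
the open intervals of length `T`. -/
instance AddCircle.chartedSpaceReal : ChartedSpace ℝ (AddCircle T) where
  atlas := Set.range fun a : ℝ => (AddCircle.openPartialHomeomorphCoe T a).symm
  chartAt x := (AddCircle.openPartialHomeomorphCoe T
    ((AddCircle.equivIco T 0 x : ℝ) - T / 2)).symm
  mem_chart_source x := by
    intro h
    have h : x = (((AddCircle.equivIco T 0 x : ℝ) - T / 2 : ℝ) : AddCircle T) := h
    have hx : x = ((AddCircle.equivIco T 0 x : ℝ) : AddCircle T) :=
      ((AddCircle.equivIco T 0).symm_apply_apply x).symm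
    have h' := hx.symm.trans h
    generalize (AddCircle.equivIco T 0 x : ℝ) = y at h'
    have hpos := hT.out
    have h2 : ((T / 2 : ℝ) : AddCircle T) = 0 := by
      have : (T / 2 : ℝ) = y - (y - T / 2) := by ring
      rw [this, AddCircle.coe_sub, h', sub_self]
    obtain ⟨m, hm⟩ := (AddCircle.coe_eq_zero_iff T).1 h2
    rw [zsmul_eq_mul] at hm
    have hm' : (m : ℝ) = 1 / 2 := by
      field_simp
      nlinarith
    have h3 : (0 : ℝ) < m ∧ (m : ℝ) < 1 := by constructor <;> linarith
    have h4 : 0 < m ∧ m < 1 := by exact_mod_cast h3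
    omega
  chart_mem_atlas x := ⟨_, rfl⟩

/-- Away from the left end point of the interval, the chart is locally a translation. -/
theorem AddCircle.equivIco_coe_eventuallyEq (a t : ℝ) (h : (t : AddCircle T) ≠ a) :
    ∃ b : ℝ, ∀ᶠ s : ℝ in nhds t, (AddCircle.equivIco T a (s : AddCircle T) : ℝ) = s + b := by
  have hpos := hT.out
  have hcoe : ∀ s : ℝ, (AddCircle.equivIco T a (s : AddCircle T) : ℝ) = toIcoMod hpos a s :=
    fun s => rfl
  have hmem := toIcoMod_mem_Ico hpos a t
  have hne : a ≠ toIcoMod hpos a t := by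
    intro e
    apply h
    rw [e, ← hcoe]
    exact ((AddCircle.equivIco T a).symm_apply_apply (t : AddCircle T)).symm
  have hlt : a < toIcoMod hpos a t := lt_of_le_of_ne hmem.1 hne
  refine ⟨-(toIcoDiv hpos a t • T), ?_⟩
  have e1 : toIcoMod hpos a t = t - toIcoDiv hpos a t • T := rfl
  have hopen : ∀ᶠ s : ℝ in nhds t, s - toIcoDiv hpos a t • T ∈ Ioo a (a + T) := by
    have hc : Continuous fun s : ℝ => s - toIcoDiv hpos a t • T := by fun_prop
    exact hc.continuousAt.eventually (isOpen_Ioo.mem_nhds (by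
      change t - toIcoDiv hpos a t • T ∈ Ioo a (a + T)
      exact e1 ▸ ⟨hlt, hmem.2⟩))
  filter_upwards [hopen] with s hs
  rw [hcoe, ← sub_eq_add_neg]
  have := toIcoDiv_eq_of_sub_zsmul_mem_Ico hpos (Ioo_subset_Ico_self hs)
  simp only [toIcoMod, this]

instance AddCircle.isManifoldReal : IsManifold 𝓘(ℝ, ℝ) ∞ (AddCircle T) := by
  apply isManifold_of_contDiffOn
  rintro _ _ ⟨a, rfl⟩ ⟨b, rfl⟩ t ht
  have htb : (t : AddCircle T) ≠ b := by
    have := ht.1.2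
    simpa using this
  obtain ⟨c, hc⟩ := AddCircle.equivIco_coe_eventuallyEq T b t htb
  apply ContDiffAt.contDiffWithinAt
  exact (contDiffAt_id.add contDiffAt_const : ContDiffAt ℝ ∞ (fun s : ℝ => s + c) t).congr_of_eventuallyEq hc

/-- The metric `dt²` on `ℝ / Tℤ`. All transition maps of the charts are locally translations, so
every tangent space is canonically `ℝ`. -/
def circleMetric : MetricTensor 𝓘(ℝ, ℝ) (AddCircle T) := fun _ => ContinuousLinearMap.mul ℝ ℝ

/-- The projection `ℝ → ℝ / Tℤ` is a local isometry. -/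
theorem circleMetric_pullback (t v w : ℝ) :
    MetricTensor.pullback 𝓘(ℝ, ℝ) (fun s : ℝ => (s : AddCircle T)) (circleMetric T) t v w
      = v * w := by
  have hm : HasMFDerivAt 𝓘(ℝ, ℝ) 𝓘(ℝ, ℝ) (fun s : ℝ => (s : AddCircle T)) t
      (ContinuousLinearMap.id ℝ ℝ) := by
    refine ⟨(AddCircle.continuous_mk' T).continuousAt, ?_⟩
    have hsrc := mem_chart_source ℝ (t : AddCircle T)
    obtain ⟨c, hc⟩ := AddCircle.equivIco_coe_eventuallyEq T _ t hsrc
    have : HasFDerivAt (fun s : ℝ => s + c) (ContinuousLinearMap.id ℝ ℝ) t :=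
      (hasFDerivAt_id t).add_const c
    simp only [mfld_simps]
    exact ((this.congr_of_eventuallyEq hc)).hasFDerivWithinAt
  change ContinuousLinearMap.mul ℝ ℝ
    (mfderiv 𝓘(ℝ, ℝ) 𝓘(ℝ, ℝ) (fun s : ℝ => (s : AddCircle T)) t v)
    (mfderiv 𝓘(ℝ, ℝ) 𝓘(ℝ, ℝ) (fun s : ℝ => (s : AddCircle T)) t w) = v * w
  rw [hm.mfderiv]
  rfl

end Circle

/-! ### Spheres, cylinders, pseudo-cylindric metrics and Derdzinski metrics -/

/-- The unit sphere `S^k` in `ℝ^{k+1}`. -/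
abbrev UnitSphere (k : ℕ) : Type := sphere (0 : EuclideanSpace ℝ (Fin (k + 1))) 1

/-- The Euclidean metric of `ℝ^m`. -/
def euclideanMetric (m : ℕ) :
    MetricTensor 𝓘(ℝ, EuclideanSpace ℝ (Fin m)) (EuclideanSpace ℝ (Fin m)) := fun _ =>
  (innerSL ℝ : EuclideanSpace ℝ (Fin m) →L[ℝ] EuclideanSpace ℝ (Fin m) →L[ℝ] ℝ)

/-- The standard metric `dξ²` of the unit sphere, induced by the Euclidean metric. -/
def roundMetric (k : ℕ) : MetricTensor (𝓡 k) (UnitSphere k) :=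
  MetricTensor.pullback (𝓡 k) (fun ξ => (ξ : EuclideanSpace ℝ (Fin (k + 1))))
    (euclideanMetric (k + 1))

section Warped

variable {E : Type*} [NormedAddCommGroup E] [NormedSpace ℝ E]
  {H : Type*} [TopologicalSpace H] {I : ModelWithCorners ℝ E H}
  {N : Type*} [TopologicalSpace N] [ChartedSpace H N]

/-- The warped product metric `dt² + φ(t) g_N` on `S¹(L) × N`. -/
def warpedMetric (L : ℝ) [Fact (0 < L)] (φ : AddCircle L → ℝ) (gN : MetricTensor I N) :
    MetricTensor (𝓘(ℝ, ℝ).prod I) (AddCircle L × N) := fun x =>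
  MetricTensor.pullback (𝓘(ℝ, ℝ).prod I) Prod.fst (circleMetric L) x +
    φ x.1 • MetricTensor.pullback (𝓘(ℝ, ℝ).prod I) Prod.snd gN x

/-- Derdzinski metrics on `S¹(L) × N`, where `N` has dimension `n - 1`: the metrics
`dt² + h(t)^{4/n} g_N`, where `g_N` is an Einstein metric of positive scalar curvature `R` and `h`
is a smooth, positive, nonconstant `L`-periodic solution of
`h'' - (n R / (4 (n - 1))) h^{1 - 4/n} = - (n / 4) C h` for some constant `C > 0`. -/
def IsDerdzinskiMetric [FiniteDimensional ℝ E] (n : ℕ) (L : ℝ) [Fact (0 < L)]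
    (gN : MetricTensor I N) (g : MetricTensor (𝓘(ℝ, ℝ).prod I) (AddCircle L × N)) : Prop :=
  Module.finrank ℝ E + 1 = n ∧
  ∃ R : ℝ, 0 < R ∧ IsEinstein gN R ∧
  ∃ h : AddCircle L → ℝ,
    (∀ t, 0 < h t) ∧ (¬ ∃ c, ∀ t, h t = c) ∧ ContDiff ℝ ∞ (fun t : ℝ => h t) ∧
    (∃ C : ℝ, 0 < C ∧ ∀ t : ℝ,
      iteratedDeriv 2 (fun s : ℝ => h s) t
        - n * R / (4 * ((n : ℝ) - 1)) * h t ^ (1 - 4 / (n : ℝ)) = - (n / 4 * C * h t)) ∧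
    g = warpedMetric L (fun t => h t ^ (4 / (n : ℝ))) gN

end Warped

/-- The model with corners of `S¹ × S^k`. -/
abbrev cylinderModel (k : ℕ) := 𝓘(ℝ, ℝ).prod (𝓡 k)

/-- The cylindric metric `dt² + dξ²` on `S¹(T) × S^k`. -/
def cylinderMetric (T : ℝ) [Fact (0 < T)] (k : ℕ) :
    MetricTensor (cylinderModel k) (AddCircle T × UnitSphere k) := fun x =>
  MetricTensor.pullback (cylinderModel k) Prod.fst (circleMetric T) x +
    MetricTensor.pullback (cylinderModel k) Prod.snd (roundMetric k) x

/-- Pseudo-cylindric metrics on `S¹(T) × S^{n-1}`: the metrics `u^{4/(n-2)} (dt² + dξ²)` of constant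
scalar curvature, where `u` is a smooth, positive, nonconstant function on `S¹(T) × S^{n-1}`. -/
def IsPseudoCylindric (n : ℕ) (T : ℝ) [Fact (0 < T)]
    (g : MetricTensor (cylinderModel (n - 1)) (AddCircle T × UnitSphere (n - 1))) : Prop :=
  ∃ u : AddCircle T × UnitSphere (n - 1) → ℝ,
    ContMDiff (cylinderModel (n - 1)) 𝓘(ℝ, ℝ) ∞ u ∧ (∀ x, 0 < u x) ∧ (¬ ∃ c, ∀ x, u x = c) ∧
    (∀ x, g x = u x ^ (4 / ((n : ℝ) - 2)) • cylinderMetric T (n - 1) x) ∧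
    ∃ c : ℝ, ∀ x, scalarCurvature g x = c

end

/-!
In polar coordinates the cylinder is the punctured space `ℝⁿ ∖ {0}` with the metric `|x|⁻² |dx|²`,
so that `g` lifts to a conformally flat metric `v ^ (4 / (n - 2)) |dx|²`, where `v` is a positive
solution of the Yamabe equation `Δ v = -K v ^ ((n + 2) / (n - 2))` singular at the origin. At a
maximum of `u` the equation gives `K > 0`, and the method of moving spheres (Kelvin transforms in
spheres centred at `x ≠ 0`, of all radii less than `|x|`) shows that `v` is radial: hence `u` only
depends on `t`.

A conformally flat metric has harmonic curvature as soon as its scalar curvature is constant, since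
the divergence of its curvature tensor only involves the derivative of the scalar curvature and the
antisymmetrized derivative of the Schouten tensor, which vanishes by conformal flatness. For a
radial factor, the Ricci tensor being parallel is a third order equation for `log u`, which is
compatible with the Yamabe equation only if `u` is constant. Finally, in the arc length
`s = ∫ u ^ (2 / (n - 2)) dt` the metric `g` is the warped product `ds² + h ^ (4 / n) dξ²` with
`h = u ^ (n / (n - 2))`, and the Yamabe equation becomes Derdzinski's equation for `h`.
-/

noncomputable section

open Filter Topology EuclideanGeometry
open scoped RealInnerProductSpace Laplacian

/-! ### Naturality of the curvature under local isometries -/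

namespace Coord

theorem trace_eq_of_semiconj {R V W : Type*} [CommRing R] [AddCommGroup V] [Module R V]
    [AddCommGroup W] [Module R W] (e : V ≃ₗ[R] W) {A : V →ₗ[R] V} {B : W →ₗ[R] W}
    (h : ∀ v, e (A v) = B (e v)) : LinearMap.trace R V A = LinearMap.trace R W B := by
  rw [← LinearMap.trace_conj' A e]
  congr 1
  ext w
  obtain ⟨v, rfl⟩ := e.surjective w
  rw [LinearEquiv.conj_apply_apply, e.symm_apply_apply, h]

variable {E : Type*} [NormedAddCommGroup E] [NormedSpace ℝ E]
  {E' : Type*} [NormedAddCommGroup E'] [NormedSpace ℝ E']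
  {E'' : Type*} [NormedAddCommGroup E''] [NormedSpace ℝ E'']

theorem contDiff_flip {n : WithTop ℕ∞} :
    ContDiff ℝ n (fun A : E →L[ℝ] E' →L[ℝ] E'' => A.flip) :=
  (ContinuousLinearMap.flipₗᵢ ℝ E E' E'').toContinuousLinearEquiv.contDiff

theorem fderiv_apply₂ {G : E → E →L[ℝ] E →L[ℝ] E'} {x : E} (h : DifferentiableAt ℝ G x)
    (a b c : E) : fderiv ℝ G x a b c = fderiv ℝ (fun y => G y b c) x a := by
  rw [((h.hasFDerivAt.clm_apply (hasFDerivAt_const b x)).clm_apply (hasFDerivAt_const c x)).fderiv]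
  simp

theorem fderiv_fderiv_comm {f : E → E'} {x : E} (h : ContDiffAt ℝ ∞ f x) (a b : E) :
    fderiv ℝ (fderiv ℝ f) x a b = fderiv ℝ (fderiv ℝ f) x b a :=
  (h.isSymmSndFDerivAt (by
    rw [minSmoothness_of_isRCLikeNormedField]; exact WithTop.coe_le_coe.2 le_top)).eq a b

/-- `G` is a pseudo-Riemannian metric near `x`: a smooth field of symmetric nondegenerate bilinear
forms. Since smoothness at a point does not propagate to a neighbourhood, it is required at all
points near `x`. -/
def IsMetricNear (G : E → E →L[ℝ] E →L[ℝ] ℝ) (x : E) : Prop :=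
  ∀ᶠ y in 𝓝 x, ContDiffAt ℝ ∞ G y ∧ (∀ v w, G y v w = G y w v) ∧ (G y).IsInvertible

namespace IsMetricNear

variable {G : E → E →L[ℝ] E →L[ℝ] ℝ} {x : E} (h : IsMetricNear G x)
include h

theorem eventually : ∀ᶠ y in 𝓝 x, IsMetricNear G y := eventually_eventually_nhds.2 h

theorem contDiffAt : ContDiffAt ℝ ∞ G x := h.self_of_nhds.1

theorem symm (v w : E) : G x v w = G x w v := h.self_of_nhds.2.1 v w

theorem isInvertible : (G x).IsInvertible := h.self_of_nhds.2.2

theorem congr {G₁ : E → E →L[ℝ] E →L[ℝ] ℝ} (he : G₁ =ᶠ[𝓝 x] G) : IsMetricNear G₁ x := by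
  filter_upwards [h, he.eventuallyEq_nhds] with y hy hey
  exact ⟨hy.1.congr_of_eventuallyEq hey, by rw [hey.self_of_nhds]; exact hy.2⟩

theorem apply_inverse (l : E →L[ℝ] ℝ) : G x ((G x).inverse l) = l := by
  obtain ⟨e, he⟩ := h.isInvertible
  rw [← he, ContinuousLinearMap.inverse_equiv]
  exact e.apply_symm_apply l

theorem ext {v w : E} (hvw : ∀ z, G x v z = G x w z) : v = w := by
  obtain ⟨e, he⟩ := h.isInvertible
  apply e.injective
  ext z
  simpa [← he] using hvw z

theorem apply_christoffel (v w z : E) : G x (christoffel G x v w) z = koszul G x v w z := by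
  rw [christoffel_apply, h.apply_inverse]

end IsMetricNear

theorem contDiffAt_koszul {G : E → E →L[ℝ] E →L[ℝ] ℝ} {x : E} (h : ContDiffAt ℝ ∞ G x) :
    ContDiffAt ℝ ∞ (koszul G) x := by
  have hD : ContDiffAt ℝ ∞ (fderiv ℝ G) x := h.fderiv_right (m := ∞) (by simp)
  have hflip := contDiff_flip.contDiffAt.comp x hD
  exact ((hD.add hflip).sub (contDiffAt_const.clm_comp hflip)).const_smul (2⁻¹ : ℝ)

theorem IsMetricNear.contDiffAt_christoffel [CompleteSpace E] {G : E → E →L[ℝ] E →L[ℝ] ℝ} {x : E}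
    (h : IsMetricNear G x) : ContDiffAt ℝ ∞ (christoffel G) x := by
  have hinv : ContDiffAt ℝ ∞ (fun y => (G y).inverse) x := by
    obtain ⟨e, he⟩ := h.isInvertible
    have hmap := contDiffAt_map_inverse (n := ∞) e
    rw [he] at hmap
    exact hmap.comp x h.contDiffAt
  exact ((ContinuousLinearMap.compL ℝ E (E →L[ℝ] ℝ) E).contDiff.contDiffAt.comp x hinv).clm_comp
    (contDiffAt_koszul h.contDiffAt)

theorem contDiffAt_riemann {G : E → E →L[ℝ] E →L[ℝ] ℝ} {x : E}
    (h : ContDiffAt ℝ ∞ (christoffel G) x) : ContDiffAt ℝ ∞ (riemann G) x := by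
  have hD : ContDiffAt ℝ ∞ (fderiv ℝ (christoffel G)) x := h.fderiv_right (m := ∞) (by simp)
  have hΓΓ : ContDiffAt ℝ ∞ (fun y => (ContinuousLinearMap.compL ℝ E E E).bilinearComp
      (christoffel G y) (christoffel G y)) x := by
    have hΓ : ContDiffAt ℝ ∞ (fun y => ContinuousLinearMap.compL ℝ E E E ∘L christoffel G y) x :=
      contDiffAt_const.clm_comp h
    exact contDiff_flip.contDiffAt.comp x ((contDiff_flip.contDiffAt.comp x hΓ).clm_comp h)
  exact ((hD.sub (contDiff_flip.contDiffAt.comp x hD)).add hΓΓ).sub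
    (contDiff_flip.contDiffAt.comp x hΓΓ)

theorem IsMetricNear.contDiffAt_ricci [FiniteDimensional ℝ E] {G : E → E →L[ℝ] E →L[ℝ] ℝ} {x : E}
    (h : IsMetricNear G x) : ContDiffAt ℝ ∞ (ricci G) x := by
  have := FiniteDimensional.complete ℝ E
  exact contDiffAt_const.clm_comp (contDiffAt_const.clm_comp
    (contDiff_flip.contDiffAt.comp x (contDiffAt_riemann h.contDiffAt_christoffel)))

/-- `Φ` is a smooth local diffeomorphism near `x`, expressed by the invertibility of its
derivative. -/
def IsLocalDiffeoNear (Φ : E → E') (x : E) : Prop :=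
  ∀ᶠ y in 𝓝 x, ContDiffAt ℝ ∞ Φ y ∧ (fderiv ℝ Φ y).IsInvertible

namespace IsLocalDiffeoNear

variable {Φ : E → E'} {x : E} (h : IsLocalDiffeoNear Φ x)
include h

theorem eventually : ∀ᶠ y in 𝓝 x, IsLocalDiffeoNear Φ y := eventually_eventually_nhds.2 h

theorem contDiffAt : ContDiffAt ℝ ∞ Φ x := h.self_of_nhds.1

theorem exists_equiv : ∃ e : E ≃L[ℝ] E', ∀ v, e v = fderiv ℝ Φ x v := by
  obtain ⟨e, he⟩ := h.self_of_nhds.2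
  exact ⟨e, fun v => by rw [← he]; rfl⟩

theorem surjective : Function.Surjective (fderiv ℝ Φ x) := by
  obtain ⟨e, he⟩ := h.exists_equiv
  exact fun w => ⟨e.symm w, by rw [← he, e.apply_symm_apply]⟩

theorem hasFDerivAt : HasFDerivAt Φ (fderiv ℝ Φ x) x :=
  (h.contDiffAt.differentiableAt (by simp)).hasFDerivAt

theorem contDiffAt_fderiv : ContDiffAt ℝ ∞ (fderiv ℝ Φ) x :=
  h.contDiffAt.fderiv_right (m := ∞) (by simp)

theorem hasFDerivAt_fderiv : HasFDerivAt (fderiv ℝ Φ) (fderiv ℝ (fderiv ℝ Φ) x) x :=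
  (h.contDiffAt_fderiv.differentiableAt (by simp)).hasFDerivAt

theorem hasFDerivAt_fderiv_apply (b : E) :
    HasFDerivAt (fun y => fderiv ℝ Φ y b) ((fderiv ℝ (fderiv ℝ Φ) x).flip b) x := by
  convert h.hasFDerivAt_fderiv.clm_apply (hasFDerivAt_const b x) using 1
  ext; simp

end IsLocalDiffeoNear

/-- The pull-back of a field of bilinear forms, the coordinate version of
`MetricTensor.pullback`. -/
def pull (Φ : E → E') (G : E' → E' →L[ℝ] E' →L[ℝ] ℝ) : E → E →L[ℝ] E →L[ℝ] ℝ :=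
  fun y => (G (Φ y)).bilinearComp (fderiv ℝ Φ y) (fderiv ℝ Φ y)

theorem pull_apply (Φ : E → E') (G : E' → E' →L[ℝ] E' →L[ℝ] ℝ) (x v w : E) :
    pull Φ G x v w = G (Φ x) (fderiv ℝ Φ x v) (fderiv ℝ Φ x w) := rfl

theorem contDiffAt_pull {Φ : E → E'} {x : E} {G : E' → E' →L[ℝ] E' →L[ℝ] ℝ}
    (hΦ : IsLocalDiffeoNear Φ x) (hG : ContDiffAt ℝ ∞ G (Φ x)) :
    ContDiffAt ℝ ∞ (pull Φ G) x :=
  contDiff_flip.contDiffAt.comp x ((contDiff_flip.contDiffAt.comp x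
    ((hG.comp x hΦ.contDiffAt).clm_comp hΦ.contDiffAt_fderiv)).clm_comp hΦ.contDiffAt_fderiv)

theorem isMetricNear_pull {Φ : E → E'} {x : E} {G : E' → E' →L[ℝ] E' →L[ℝ] ℝ}
    (hΦ : IsLocalDiffeoNear Φ x) (hG : IsMetricNear G (Φ x)) : IsMetricNear (pull Φ G) x := by
  filter_upwards [hΦ.eventually, hΦ.contDiffAt.continuousAt.eventually hG.eventually] with y hy hGy
  refine ⟨contDiffAt_pull hy hGy.contDiffAt, fun v w => hGy.symm _ _, ?_⟩
  obtain ⟨e, he⟩ := hGy.isInvertible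
  obtain ⟨d, hd⟩ := hy.exists_equiv
  refine ⟨(d.trans e).trans (d.arrowCongr (ContinuousLinearEquiv.refl ℝ ℝ)).symm, ?_⟩
  ext v w
  simp [pull_apply, ← hd, ← he, ContinuousLinearEquiv.arrowCongr]

/-- `Φ` is a local isometry from `G` to the metric `G'` near `x`. -/
structure IsLocalIsometryNear (Φ : E → E') (G : E → E →L[ℝ] E →L[ℝ] ℝ)
    (G' : E' → E' →L[ℝ] E' →L[ℝ] ℝ) (x : E) : Prop where
  isLocalDiffeoNear : IsLocalDiffeoNear Φ x
  isMetricNear_target : IsMetricNear G' (Φ x)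
  eventuallyEq : G =ᶠ[𝓝 x] pull Φ G'

namespace IsLocalIsometryNear

variable {Φ : E → E'} {x : E} {G : E → E →L[ℝ] E →L[ℝ] ℝ} {G' : E' → E' →L[ℝ] E' →L[ℝ] ℝ}
  (h : IsLocalIsometryNear Φ G G' x)
include h

theorem eventually : ∀ᶠ y in 𝓝 x, IsLocalIsometryNear Φ G G' y := by
  filter_upwards [h.isLocalDiffeoNear.eventually, h.eventuallyEq.eventuallyEq_nhds,
    h.isLocalDiffeoNear.contDiffAt.continuousAt.eventually h.isMetricNear_target.eventually]
    with y hΦ he hG'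
  exact ⟨hΦ, hG', he⟩

theorem isMetricNear_source : IsMetricNear G x :=
  (isMetricNear_pull h.isLocalDiffeoNear h.isMetricNear_target).congr h.eventuallyEq

theorem apply_eq (v w : E) : G x v w = G' (Φ x) (fderiv ℝ Φ x v) (fderiv ℝ Φ x w) := by
  rw [h.eventuallyEq.self_of_nhds, pull_apply]

theorem fderiv_apply (a b c : E) :
    fderiv ℝ G x a b c =
      fderiv ℝ G' (Φ x) (fderiv ℝ Φ x a) (fderiv ℝ Φ x b) (fderiv ℝ Φ x c) +
      G' (Φ x) (fderiv ℝ (fderiv ℝ Φ) x a b) (fderiv ℝ Φ x c) +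
      G' (Φ x) (fderiv ℝ Φ x b) (fderiv ℝ (fderiv ℝ Φ) x a c) := by
  have hΦ := h.isLocalDiffeoNear
  have hG' : HasFDerivAt (fun y => G' (Φ y)) ((fderiv ℝ G' (Φ x)).comp (fderiv ℝ Φ x)) x :=
    (h.isMetricNear_target.contDiffAt.differentiableAt (by simp)).hasFDerivAt.comp x
      hΦ.hasFDerivAt
  have hpull : fderiv ℝ (fun y => pull Φ G' y b c) x = _ :=
    ((hG'.clm_apply (hΦ.hasFDerivAt_fderiv_apply b)).clm_apply
      (hΦ.hasFDerivAt_fderiv_apply c)).fderiv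
  rw [h.eventuallyEq.fderiv_eq, fderiv_apply₂ ((contDiffAt_pull hΦ
    h.isMetricNear_target.contDiffAt).differentiableAt (by simp)), hpull]
  simp
  ring

theorem map_christoffel (v w : E) :
    fderiv ℝ Φ x (christoffel G x v w) =
      fderiv ℝ (fderiv ℝ Φ) x v w +
        christoffel G' (Φ x) (fderiv ℝ Φ x v) (fderiv ℝ Φ x w) := by
  have hG' := h.isMetricNear_target
  have hsymm := fderiv_fderiv_comm h.isLocalDiffeoNear.contDiffAt
  apply hG'.ext
  intro z
  obtain ⟨z, rfl⟩ := h.isLocalDiffeoNear.surjective z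
  rw [← h.apply_eq, h.isMetricNear_source.apply_christoffel, koszul_apply, map_add,
    _root_.add_apply, hG'.apply_christoffel, koszul_apply]
  simp only [h.fderiv_apply]
  rw [hsymm w v, hsymm z v, hsymm z w, hG'.symm _ (fderiv ℝ Φ x w),
    hG'.symm (fderiv ℝ Φ x v) (fderiv ℝ (fderiv ℝ Φ) x w z)]
  ring

variable [FiniteDimensional ℝ E] [FiniteDimensional ℝ E']

theorem map_fderiv_christoffel (v w z : E) :
    fderiv ℝ (fderiv ℝ Φ) x v (christoffel G x w z) +
        fderiv ℝ Φ x (fderiv ℝ (christoffel G) x v w z) =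
      fderiv ℝ (fderiv ℝ (fderiv ℝ Φ)) x v w z +
        fderiv ℝ (christoffel G') (Φ x) (fderiv ℝ Φ x v) (fderiv ℝ Φ x w) (fderiv ℝ Φ x z) +
        christoffel G' (Φ x) (fderiv ℝ (fderiv ℝ Φ) x v w) (fderiv ℝ Φ x z) +
        christoffel G' (Φ x) (fderiv ℝ Φ x w) (fderiv ℝ (fderiv ℝ Φ) x v z) := by
  have := FiniteDimensional.complete ℝ E
  have := FiniteDimensional.complete ℝ E'
  have hΦ := h.isLocalDiffeoNear
  have hev : (fun y => fderiv ℝ Φ y (christoffel G y w z)) =ᶠ[𝓝 x] fun y =>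
      fderiv ℝ (fderiv ℝ Φ) y w z + christoffel G' (Φ y) (fderiv ℝ Φ y w) (fderiv ℝ Φ y z) := by
    filter_upwards [h.eventually] with y hy using hy.map_christoffel w z
  have hΓ := (h.isMetricNear_source.contDiffAt_christoffel.differentiableAt (by simp)).hasFDerivAt
  have hΓ' := (h.isMetricNear_target.contDiffAt_christoffel.differentiableAt
    (by simp)).hasFDerivAt.comp x hΦ.hasFDerivAt
  have hD2 := ((hΦ.contDiffAt_fderiv.fderiv_right (m := ∞) (by simp)).differentiableAt
    (by simp)).hasFDerivAt
  have hleft := hΦ.hasFDerivAt_fderiv.clm_apply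
    ((hΓ.clm_apply (hasFDerivAt_const w x)).clm_apply (hasFDerivAt_const z x))
  have hright := ((hD2.clm_apply (hasFDerivAt_const w x)).clm_apply (hasFDerivAt_const z x)).add
    ((hΓ'.clm_apply (hΦ.hasFDerivAt_fderiv_apply w)).clm_apply (hΦ.hasFDerivAt_fderiv_apply z))
  have heq := congrArg (fun A => A v) ((hleft.congr_of_eventuallyEq hev.symm).unique hright)
  simp only [_root_.add_apply, ContinuousLinearMap.comp_apply, ContinuousLinearMap.flip_apply,
    Function.comp_apply, _root_.zero_apply, map_zero, zero_add] at heq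
  rw [add_comm, heq]
  abel

theorem map_riemann (v w z : E) :
    fderiv ℝ Φ x (riemann G x v w z) =
      riemann G' (Φ x) (fderiv ℝ Φ x v) (fderiv ℝ Φ x w) (fderiv ℝ Φ x z) := by
  have hvw := h.map_fderiv_christoffel v w z
  have hwv := h.map_fderiv_christoffel w v z
  rw [riemann_apply, riemann_apply]
  simp only [map_sub, map_add, h.map_christoffel]
  rw [fderiv_fderiv_comm h.isLocalDiffeoNear.contDiffAt w v,
    fderiv_fderiv_comm h.isLocalDiffeoNear.contDiffAt_fderiv w v] at hwv
  rw [← sub_eq_zero] at hvw hwv ⊢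
  rw [← sub_eq_zero.2 (hvw.trans hwv.symm)]
  abel

theorem map_covRiemann (a v w z : E) :
    fderiv ℝ Φ x (covRiemann G x v w z a) =
      covRiemann G' (Φ x) (fderiv ℝ Φ x v) (fderiv ℝ Φ x w) (fderiv ℝ Φ x z)
        (fderiv ℝ Φ x a) := by
  have := FiniteDimensional.complete ℝ E
  have := FiniteDimensional.complete ℝ E'
  have hΦ := h.isLocalDiffeoNear
  have hev : (fun y => fderiv ℝ Φ y (riemann G y v w z)) =ᶠ[𝓝 x] fun y =>
      riemann G' (Φ y) (fderiv ℝ Φ y v) (fderiv ℝ Φ y w) (fderiv ℝ Φ y z) := by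
    filter_upwards [h.eventually] with y hy using hy.map_riemann v w z
  have hR := ((contDiffAt_riemann
    h.isMetricNear_source.contDiffAt_christoffel).differentiableAt (by simp)).hasFDerivAt
  have hR' := ((contDiffAt_riemann h.isMetricNear_target.contDiffAt_christoffel).differentiableAt
    (by simp)).hasFDerivAt.comp x hΦ.hasFDerivAt
  have hleft := hΦ.hasFDerivAt_fderiv.clm_apply (((hR.clm_apply (hasFDerivAt_const v x)).clm_apply
    (hasFDerivAt_const w x)).clm_apply (hasFDerivAt_const z x))
  have hright := ((hR'.clm_apply (hΦ.hasFDerivAt_fderiv_apply v)).clm_apply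
    (hΦ.hasFDerivAt_fderiv_apply w)).clm_apply (hΦ.hasFDerivAt_fderiv_apply z)
  have heq := congrArg (fun A => A a) ((hleft.congr_of_eventuallyEq hev.symm).unique hright)
  simp only [_root_.add_apply, ContinuousLinearMap.comp_apply, ContinuousLinearMap.flip_apply,
    Function.comp_apply, _root_.zero_apply, map_zero, zero_add] at heq
  simp only [covRiemann, LinearMap.coe_mk, AddHom.coe_mk, map_sub, map_add,
    h.map_riemann, h.map_christoffel, _root_.add_apply]
  rw [← sub_eq_zero] at heq ⊢
  rw [← heq]
  abel

theorem divRiemann_eq (v w z : E) :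
    divRiemann G x v w z =
      divRiemann G' (Φ x) (fderiv ℝ Φ x v) (fderiv ℝ Φ x w) (fderiv ℝ Φ x z) := by
  obtain ⟨e, he⟩ := h.isLocalDiffeoNear.exists_equiv
  refine trace_eq_of_semiconj e.toLinearEquiv fun a => ?_
  change e _ = covRiemann G' (Φ x) _ _ _ (e a)
  rw [he, he, h.map_covRiemann]

theorem ricci_eq (w z : E) :
    ricci G x w z = ricci G' (Φ x) (fderiv ℝ Φ x w) (fderiv ℝ Φ x z) := by
  obtain ⟨e, he⟩ := h.isLocalDiffeoNear.exists_equiv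
  rw [ricci_apply, ricci_apply]
  refine trace_eq_of_semiconj e.toLinearEquiv fun a => ?_
  change e (riemann G x a w z) = riemann G' (Φ x) (e a) _ _
  rw [he, he, h.map_riemann]

theorem covRicci_eq (a v w : E) :
    covRicci G x a v w =
      covRicci G' (Φ x) (fderiv ℝ Φ x a) (fderiv ℝ Φ x v) (fderiv ℝ Φ x w) := by
  have hΦ := h.isLocalDiffeoNear
  have hev : (fun y => ricci G y v w) =ᶠ[𝓝 x] fun y =>
      ricci G' (Φ y) (fderiv ℝ Φ y v) (fderiv ℝ Φ y w) := by
    filter_upwards [h.eventually] with y hy using hy.ricci_eq v w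
  have hR := (h.isMetricNear_source.contDiffAt_ricci.differentiableAt (by simp)).hasFDerivAt
  have hR' := (h.isMetricNear_target.contDiffAt_ricci.differentiableAt
    (by simp)).hasFDerivAt.comp x hΦ.hasFDerivAt
  have hleft := (hR.clm_apply (hasFDerivAt_const v x)).clm_apply (hasFDerivAt_const w x)
  have hright := (hR'.clm_apply (hΦ.hasFDerivAt_fderiv_apply v)).clm_apply
    (hΦ.hasFDerivAt_fderiv_apply w)
  have heq := congrArg (fun A => A a) ((hleft.congr_of_eventuallyEq hev.symm).unique hright)
  simp only [_root_.add_apply, ContinuousLinearMap.comp_apply, ContinuousLinearMap.flip_apply,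
    Function.comp_apply, _root_.zero_apply, map_zero, zero_add] at heq
  simp only [covRicci, h.ricci_eq, h.map_christoffel, map_add, _root_.add_apply]
  linarith

theorem scalar_eq : scalar G x = scalar G' (Φ x) := by
  obtain ⟨e, he⟩ := h.isLocalDiffeoNear.exists_equiv
  refine trace_eq_of_semiconj e.toLinearEquiv fun a => ?_
  change e ((G x).inverse (ricci G x a)) = (G' (Φ x)).inverse (ricci G' (Φ x) (e a))
  apply h.isMetricNear_target.ext
  intro z
  obtain ⟨z, rfl⟩ := e.surjective z
  rw [he, he z, ← h.apply_eq, h.isMetricNear_source.apply_inverse,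
    h.isMetricNear_target.apply_inverse, h.ricci_eq, he]

end IsLocalIsometryNear

end Coord

/-! ### Curvature of conformally flat metrics -/

namespace Coord

section Trace

variable {E : Type*} [NormedAddCommGroup E] [NormedSpace ℝ E] [FiniteDimensional ℝ E]

theorem traceL_apply (A : E →L[ℝ] E) : traceL E A = LinearMap.trace ℝ E A := rfl

theorem traceL_id : traceL E (ContinuousLinearMap.id ℝ E) = Module.finrank ℝ E :=
  LinearMap.trace_id ℝ E

theorem traceL_smulRight (l : E →L[ℝ] ℝ) (w : E) : traceL E (l.smulRight w) = l w :=
  LinearMap.trace_smulRight (l : E →ₗ[ℝ] ℝ) w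

theorem traceL_comp_comm (A B : E →L[ℝ] E) : traceL E (A ∘L B) = traceL E (B ∘L A) :=
  LinearMap.trace_mul_comm ℝ (A : E →ₗ[ℝ] E) (B : E →ₗ[ℝ] E)

end Trace

variable {F : Type*} [NormedAddCommGroup F] [InnerProductSpace ℝ F]

/-- The conformally flat metric `e^{2f} ⟪·,·⟫`. -/
def conf (f : F → ℝ) : F → F →L[ℝ] F →L[ℝ] ℝ :=
  fun y => Real.exp (2 * f y) • (innerSL ℝ : F →L[ℝ] F →L[ℝ] ℝ)

theorem conf_apply (f : F → ℝ) (x v w : F) : conf f x v w = Real.exp (2 * f x) * ⟪v, w⟫ := rfl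

/-- Smoothness of `f` in a neighbourhood of `x`: unlike `ContDiffAt ℝ ∞`, this condition is open
in `x`. -/
def IsSmoothNear (f : F → ℝ) (x : F) : Prop := ∀ᶠ y in 𝓝 x, ContDiffAt ℝ ∞ f y

variable {f : F → ℝ} {x : F}

theorem IsSmoothNear.eventually (h : IsSmoothNear f x) : ∀ᶠ y in 𝓝 x, IsSmoothNear f y :=
  eventually_eventually_nhds.2 h

theorem IsSmoothNear.contDiffAt (h : IsSmoothNear f x) : ContDiffAt ℝ ∞ f x := h.self_of_nhds

theorem IsSmoothNear.contDiffAt_two (h : IsSmoothNear f x) : ContDiffAt ℝ 2 f x :=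
  h.contDiffAt.of_le (by norm_cast)

theorem IsSmoothNear.hasFDerivAt (h : IsSmoothNear f x) : HasFDerivAt f (fderiv ℝ f x) x :=
  (h.contDiffAt.differentiableAt (by simp)).hasFDerivAt

theorem isSmoothNear_of_isOpen {s : Set F} (hs : IsOpen s) (h : ContDiffOn ℝ ∞ f s) (hx : x ∈ s) :
    IsSmoothNear f x := by
  filter_upwards [hs.mem_nhds hx] with y hy
  exact h.contDiffAt (hs.mem_nhds hy)

variable [FiniteDimensional ℝ F]

theorem contDiffAt_gradient (h : ContDiffAt ℝ ∞ f x) :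
    ContDiffAt ℝ ∞ (gradient f) x := by
  have := FiniteDimensional.complete ℝ F
  have hdual := (InnerProductSpace.toDual ℝ F).symm.toContinuousLinearEquiv.contDiff (n := ∞)
  exact hdual.contDiffAt.comp x (h.fderiv_right (m := ∞) (by simp))

theorem IsSmoothNear.hasFDerivAt_gradient (h : IsSmoothNear f x) :
    HasFDerivAt (gradient f) (fderiv ℝ (gradient f) x) x :=
  ((contDiffAt_gradient h.contDiffAt).differentiableAt (by simp)).hasFDerivAt

theorem IsSmoothNear.hasFDerivAt_fderiv_gradient (h : IsSmoothNear f x) :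
    HasFDerivAt (fderiv ℝ (gradient f)) (fderiv ℝ (fderiv ℝ (gradient f)) x) x :=
  (((contDiffAt_gradient h.contDiffAt).fderiv_right (m := ∞) (by simp)).differentiableAt
    (by simp)).hasFDerivAt

theorem isInvertible_innerSL : (innerSL ℝ : F →L[ℝ] F →L[ℝ] ℝ).IsInvertible := by
  have := FiniteDimensional.complete ℝ F
  exact ⟨(InnerProductSpace.toDual ℝ F).toContinuousLinearEquiv, rfl⟩

theorem IsSmoothNear.isMetricNear (h : IsSmoothNear f x) : IsMetricNear (conf f) x := by
  filter_upwards [h] with y hy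
  refine ⟨?_, fun v w => by rw [conf_apply, conf_apply, real_inner_comm], ?_⟩
  · exact (Real.contDiff_exp.contDiffAt.comp y (contDiffAt_const.mul hy)).smul contDiffAt_const
  · obtain ⟨e, he⟩ := isInvertible_innerSL (F := F)
    refine ⟨e.trans (ContinuousLinearEquiv.smulLeft
      (Units.mk0 (Real.exp (2 * f y)) (Real.exp_ne_zero _))), ?_⟩
    ext v w
    have hev : e v = innerSL ℝ v := by rw [← he]; rfl
    simp [conf_apply, hev, ContinuousLinearEquiv.smulLeft, Units.smul_def]

theorem fderiv_eq_inner_gradient (f : F → ℝ) (x v : F) : fderiv ℝ f x v = ⟪gradient f x, v⟫ := by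
  have := FiniteDimensional.complete ℝ F
  exact inner_gradient_left.symm

theorem fderiv_conf_apply (h : IsSmoothNear f x) (a b c : F) :
    fderiv ℝ (conf f) x a b c = Real.exp (2 * f x) * (2 * ⟪gradient f x, a⟫ * ⟪b, c⟫) := by
  rw [fderiv_apply₂ (h.isMetricNear.contDiffAt.differentiableAt (by simp))]
  simp only [conf_apply]
  rw [((h.hasFDerivAt.const_mul 2).exp.mul_const ⟪b, c⟫).fderiv]
  simp only [← fderiv_eq_inner_gradient, _root_.smul_apply, smul_eq_mul]
  ring

theorem christoffel_conf (h : IsSmoothNear f x) (v w : F) :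
    christoffel (conf f) x v w =
      ⟪gradient f x, v⟫ • w + ⟪gradient f x, w⟫ • v - ⟪v, w⟫ • gradient f x := by
  apply h.isMetricNear.ext
  intro z
  rw [h.isMetricNear.apply_christoffel, koszul_apply]
  simp only [fderiv_conf_apply h, conf_apply, inner_sub_left, inner_add_left,
    real_inner_smul_left]
  ring

theorem inner_fderiv_gradient (h : IsSmoothNear f x) (v w : F) :
    ⟪fderiv ℝ (gradient f) x v, w⟫ = fderiv ℝ (fderiv ℝ f) x v w := by
  have hD : HasFDerivAt (fderiv ℝ f) (fderiv ℝ (fderiv ℝ f) x) x :=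
    ((h.contDiffAt.fderiv_right (m := ∞) (by simp)).differentiableAt (by simp)).hasFDerivAt
  have hleft := hD.clm_apply (hasFDerivAt_const w x)
  simp only [fderiv_eq_inner_gradient f _ w] at hleft
  have hright := h.hasFDerivAt_gradient.inner ℝ (hasFDerivAt_const w x)
  simpa using congrArg (fun A => A v) (hright.unique hleft)

theorem fderiv_gradient_symm (h : IsSmoothNear f x) (v w : F) :
    ⟪fderiv ℝ (gradient f) x v, w⟫ = ⟪fderiv ℝ (gradient f) x w, v⟫ := by
  rw [inner_fderiv_gradient h, inner_fderiv_gradient h, fderiv_fderiv_comm h.contDiffAt]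

/-- The endomorphism `∇²f - df ⊗ ∇f + ½ |∇f|² id` associated by `⟪·,·⟫` with *minus* the Schouten
tensor of `e^{2f} ⟪·,·⟫`. It carries the whole curvature of this metric. -/
def schouten (f : F → ℝ) (x : F) : F →L[ℝ] F :=
  fderiv ℝ (gradient f) x - (innerSL ℝ (gradient f x)).smulRight (gradient f x) +
    (2⁻¹ * ⟪gradient f x, gradient f x⟫) • ContinuousLinearMap.id ℝ F

theorem schouten_apply (f : F → ℝ) (x v : F) :
    schouten f x v = fderiv ℝ (gradient f) x v - ⟪gradient f x, v⟫ • gradient f x +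
      (2⁻¹ * ⟪gradient f x, gradient f x⟫) • v := by
  simp [schouten]

theorem schouten_symm (h : IsSmoothNear f x) (v w : F) :
    ⟪schouten f x v, w⟫ = ⟪schouten f x w, v⟫ := by
  simp only [schouten_apply, inner_add_left, inner_sub_left, real_inner_smul_left,
    fderiv_gradient_symm h v w, real_inner_comm v w]
  ring

theorem IsSmoothNear.contDiffAt_schouten (h : IsSmoothNear f x) :
    ContDiffAt ℝ ∞ (schouten f) x := by
  have hP := contDiffAt_gradient h.contDiffAt
  have hinner : ContDiffAt ℝ ∞ (fun y => (innerSL ℝ : F →L[ℝ] F →L[ℝ] ℝ) (gradient f y)) x :=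
    (innerSL ℝ : F →L[ℝ] F →L[ℝ] ℝ).contDiff.contDiffAt.comp x hP
  exact ((hP.fderiv_right (m := ∞) (by simp)).sub (hinner.smulRight hP)).add
    ((contDiffAt_const.mul (hP.inner ℝ hP)).smul contDiffAt_const)

theorem IsSmoothNear.hasFDerivAt_schouten (h : IsSmoothNear f x) :
    HasFDerivAt (schouten f) (fderiv ℝ (schouten f) x) x :=
  (h.contDiffAt_schouten.differentiableAt (by simp)).hasFDerivAt

/-- The Kulkarni–Nomizu product of `⟪·,·⟫` with the bilinear form `⟪S ·, ·⟫`, with its last argument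
raised: the curvature tensor `R(v,w)z` of a conformally flat metric has this shape. -/
def kulkarni (S : F →L[ℝ] F) (v w z : F) : F :=
  ⟪S v, z⟫ • w - ⟪S w, z⟫ • v + ⟪v, z⟫ • S w - ⟪w, z⟫ • S v

theorem fderiv_christoffel_conf (h : IsSmoothNear f x) (v w z : F) :
    fderiv ℝ (christoffel (conf f)) x v w z =
      ⟪fderiv ℝ (gradient f) x v, w⟫ • z + ⟪fderiv ℝ (gradient f) x v, z⟫ • w -
        ⟪w, z⟫ • fderiv ℝ (gradient f) x v := by
  have := FiniteDimensional.complete ℝ F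
  rw [fderiv_apply₂ (h.isMetricNear.contDiffAt_christoffel.differentiableAt (by simp))]
  have hev : (fun y => christoffel (conf f) y w z) =ᶠ[𝓝 x] fun y =>
      ⟪gradient f y, w⟫ • z + ⟪gradient f y, z⟫ • w - ⟪w, z⟫ • gradient f y := by
    filter_upwards [h.eventually] with y hy
    exact christoffel_conf hy w z
  rw [hev.fderiv_eq]
  have hP := h.hasFDerivAt_gradient
  have hD : fderiv ℝ (fun y => ⟪gradient f y, w⟫ • z + ⟪gradient f y, z⟫ • w -
      ⟪w, z⟫ • gradient f y) x = _ :=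
    ((((hP.inner ℝ (hasFDerivAt_const w x)).smul_const z).add
      ((hP.inner ℝ (hasFDerivAt_const z x)).smul_const w)).sub (hP.const_smul ⟪w, z⟫)).fderiv
  rw [hD]
  simp

theorem riemann_conf (h : IsSmoothNear f x) (v w z : F) :
    riemann (conf f) x v w z = kulkarni (schouten f x) v w z := by
  rw [riemann_apply]
  simp only [fderiv_christoffel_conf h, christoffel_conf h, kulkarni, schouten_apply,
    inner_add_right, inner_sub_right, inner_add_left, inner_sub_left, real_inner_smul_left,
    real_inner_smul_right, fderiv_gradient_symm h w v, real_inner_comm (gradient f x),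
    real_inner_comm v w]
  module

theorem ricci_conf (h : IsSmoothNear f x) (w z : F) :
    ricci (conf f) x w z = -((Module.finrank ℝ F : ℝ) - 2) * ⟪schouten f x w, z⟫ -
      traceL F (schouten f x) * ⟪w, z⟫ := by
  have hR : ((riemann (conf f) x).flip w).flip z =
      (innerSL ℝ z ∘L schouten f x).smulRight w -
        ⟪schouten f x w, z⟫ • ContinuousLinearMap.id ℝ F +
        (innerSL ℝ z).smulRight (schouten f x w) - ⟪w, z⟫ • schouten f x := by
    ext v
    simp [riemann_conf h, kulkarni, real_inner_comm z]
  rw [ricci_apply, ← traceL_apply, hR]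
  simp only [map_sub, map_add, map_smul, traceL_smulRight, traceL_id]
  simp [real_inner_comm z]
  ring

theorem scalar_conf (h : IsSmoothNear f x) :
    scalar (conf f) x = -2 * ((Module.finrank ℝ F : ℝ) - 1) * Real.exp (-2 * f x) *
      traceL F (schouten f x) := by
  have hexp : Real.exp (2 * f x) * Real.exp (-2 * f x) = 1 := by
    rw [← Real.exp_add]; simp
  have hRic : (conf f x).inverse ∘L ricci (conf f) x =
      Real.exp (-2 * f x) • (-((Module.finrank ℝ F : ℝ) - 2) • schouten f x -
        traceL F (schouten f x) • ContinuousLinearMap.id ℝ F) := by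
    ext w
    apply h.isMetricNear.ext
    intro z
    rw [ContinuousLinearMap.comp_apply, h.isMetricNear.apply_inverse, ricci_conf h, conf_apply]
    simp only [_root_.smul_apply, _root_.sub_apply, ContinuousLinearMap.id_apply,
      real_inner_smul_left, inner_sub_left]
    rw [← mul_assoc, hexp, one_mul]
  rw [scalar, hRic]
  simp only [map_sub, map_smul, traceL_id, smul_eq_mul]
  ring

/-- The covariant derivative `∇_a`, for the Levi-Civita connection of `e^{2f} ⟪·,·⟫`, of the
bilinear form `⟪schouten f x ·, ·⟫`, seen as an endomorphism through `⟪·,·⟫`. -/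
def covSchouten (f : F → ℝ) (x a : F) : F →L[ℝ] F :=
  fderiv ℝ (schouten f) x a +
    ((innerSL ℝ (gradient f x)).smulRight a - (innerSL ℝ a).smulRight (gradient f x)) ∘L
      schouten f x -
    schouten f x ∘L
      ((innerSL ℝ (gradient f x)).smulRight a - (innerSL ℝ a).smulRight (gradient f x)) -
    (2 * ⟪gradient f x, a⟫) • schouten f x

theorem covSchouten_apply (f : F → ℝ) (x a v : F) :
    covSchouten f x a v = fderiv ℝ (schouten f) x a v +
      ⟪gradient f x, schouten f x v⟫ • a - ⟪a, schouten f x v⟫ • gradient f x -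
      (⟪gradient f x, v⟫ • schouten f x a - ⟪a, v⟫ • schouten f x (gradient f x)) -
      (2 * ⟪gradient f x, a⟫) • schouten f x v := by
  simp [covSchouten]
  abel

theorem fderiv_schouten_apply (h : IsSmoothNear f x) (a v : F) :
    fderiv ℝ (schouten f) x a v = fderiv ℝ (fderiv ℝ (gradient f)) x a v -
      (⟪fderiv ℝ (gradient f) x a, v⟫ • gradient f x +
        ⟪gradient f x, v⟫ • fderiv ℝ (gradient f) x a) +
      ⟪gradient f x, fderiv ℝ (gradient f) x a⟫ • v := by
  have hP := h.hasFDerivAt_gradient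
  have hleft := h.hasFDerivAt_schouten.clm_apply (hasFDerivAt_const v x)
  simp only [schouten_apply] at hleft
  have hright := ((h.hasFDerivAt_fderiv_gradient.clm_apply (hasFDerivAt_const v x)).sub
    ((hP.inner ℝ (hasFDerivAt_const v x)).smul hP)).add
    (((hP.inner ℝ hP).const_mul 2⁻¹).smul_const v)
  have heq := congrArg (fun A => A a) (hleft.unique hright)
  simp only [_root_.add_apply, ContinuousLinearMap.comp_apply, ContinuousLinearMap.flip_apply,
    _root_.zero_apply, map_zero, zero_add] at heq
  rw [heq]
  simp [real_inner_comm (gradient f x)]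
  module

theorem covSchouten_codazzi (h : IsSmoothNear f x) (a v : F) :
    covSchouten f x a v = covSchouten f x v a := by
  simp only [covSchouten_apply, fderiv_schouten_apply h,
    fderiv_fderiv_comm (contDiffAt_gradient h.contDiffAt) a v]
  rw [real_inner_comm _ a, real_inner_comm _ v, schouten_symm h v a]
  simp only [schouten_apply, inner_add_right, inner_sub_right, real_inner_smul_right,
    fderiv_gradient_symm h v a, real_inner_comm a v]
  module

theorem fderiv_riemann_conf (h : IsSmoothNear f x) (a v w z : F) :
    fderiv ℝ (riemann (conf f)) x a v w z = kulkarni (fderiv ℝ (schouten f) x a) v w z := by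
  have := FiniteDimensional.complete ℝ F
  have hR : HasFDerivAt (riemann (conf f)) (fderiv ℝ (riemann (conf f)) x) x :=
    ((contDiffAt_riemann h.isMetricNear.contDiffAt_christoffel).differentiableAt
      (by simp)).hasFDerivAt
  have hleft := ((hR.clm_apply (hasFDerivAt_const v x)).clm_apply
    (hasFDerivAt_const w x)).clm_apply (hasFDerivAt_const z x)
  have hSv := fun v => h.hasFDerivAt_schouten.clm_apply (hasFDerivAt_const v x)
  have hright := (((((hSv v).inner ℝ (hasFDerivAt_const z x)).smul_const w).sub
    (((hSv w).inner ℝ (hasFDerivAt_const z x)).smul_const v)).add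
    ((hSv w).const_smul ⟪v, z⟫)).sub ((hSv v).const_smul ⟪w, z⟫)
  have hev : (fun y => riemann (conf f) y v w z) =ᶠ[𝓝 x] fun y =>
      kulkarni (schouten f y) v w z := by
    filter_upwards [h.eventually] with y hy using riemann_conf hy v w z
  have heq := congrArg (fun A => A a) ((hleft.congr_of_eventuallyEq hev.symm).unique hright)
  simp only [_root_.add_apply, ContinuousLinearMap.comp_apply, ContinuousLinearMap.flip_apply,
    _root_.zero_apply, map_zero, zero_add] at heq
  rw [heq]
  simp [kulkarni]

theorem covRiemann_conf (h : IsSmoothNear f x) (a v w z : F) :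
    covRiemann (conf f) x v w z a = kulkarni (covSchouten f x a) v w z := by
  simp only [covRiemann, LinearMap.coe_mk, AddHom.coe_mk, riemann_conf h, christoffel_conf h,
    fderiv_riemann_conf h]
  simp only [kulkarni, covSchouten_apply, map_add, map_sub, map_smul, inner_add_right,
    inner_sub_right, inner_add_left, inner_sub_left, real_inner_smul_left, real_inner_smul_right]
  have hS : ∀ p q, ⟪p, schouten f x q⟫ = ⟪schouten f x q, p⟫ := fun p q => real_inner_comm _ _
  simp only [hS, schouten_symm h (gradient f x) z, schouten_symm h a z,
    real_inner_comm (gradient f x) v, real_inner_comm (gradient f x) w, real_inner_comm a v,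
    real_inner_comm a w]
  module

theorem traceL_covSchouten (f : F → ℝ) (x a : F) :
    traceL F (covSchouten f x a) = traceL F (fderiv ℝ (schouten f) x a) -
      2 * ⟪gradient f x, a⟫ * traceL F (schouten f x) := by
  rw [covSchouten, map_sub, map_sub, map_add, traceL_comp_comm, map_smul, smul_eq_mul]
  ring

theorem traceL_covSchouten_eq_zero (hF : 2 ≤ Module.finrank ℝ F) (h : IsSmoothNear f x) {c : ℝ}
    (hc : ∀ᶠ y in 𝓝 x, scalar (conf f) y = c) (a : F) : traceL F (covSchouten f x a) = 0 := by
  have hF' : (2 : ℝ) ≤ Module.finrank ℝ F := by exact_mod_cast hF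
  have htrace := (h.hasFDerivAt.const_mul (-2)).exp.mul
    ((traceL F).hasFDerivAt.comp x h.hasFDerivAt_schouten)
  have hev : (fun y => Real.exp (-2 * f y) * traceL F (schouten f y)) =ᶠ[𝓝 x]
      fun _ => c / (-2 * ((Module.finrank ℝ F : ℝ) - 1)) := by
    filter_upwards [h.eventually, hc] with y hy hcy
    rw [← hcy, scalar_conf hy, eq_div_iff (by linarith)]
    ring
  have hzero := congrArg (fun A => A a)
    ((htrace.congr_of_eventuallyEq hev.symm).unique (hasFDerivAt_const _ x))
  simp only [_root_.add_apply, _root_.smul_apply, ContinuousLinearMap.comp_apply, smul_eq_mul,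
    Function.comp_apply, _root_.zero_apply, fderiv_eq_inner_gradient] at hzero
  rw [traceL_covSchouten]
  apply mul_left_cancel₀ (Real.exp_pos (-2 * f x)).ne'
  linarith

/-- By the Codazzi equation, only the trace of `∇_a S` survives in the divergence. -/
theorem divRiemann_conf (h : IsSmoothNear f x) (v w z : F) :
    divRiemann (conf f) x v w z = ⟪v, z⟫ * traceL F (covSchouten f x w) -
      ⟪w, z⟫ * traceL F (covSchouten f x v) := by
  have hR : covRiemann (conf f) x v w z =
      ((innerSL ℝ z ∘L covSchouten f x v).smulRight w -
        (innerSL ℝ z ∘L covSchouten f x w).smulRight v +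
        ⟪v, z⟫ • covSchouten f x w - ⟪w, z⟫ • covSchouten f x v : F →L[ℝ] F) := by
    ext a
    rw [covRiemann_conf h]
    simp [kulkarni, covSchouten_codazzi h a, real_inner_comm z]
  rw [divRiemann, hR, ← traceL_apply]
  simp only [map_sub, map_add, traceL_smulRight, map_smul]
  simp [covSchouten_codazzi h v w]

theorem divRiemann_conf_eq_zero (hF : 2 ≤ Module.finrank ℝ F) (h : IsSmoothNear f x) {c : ℝ}
    (hc : ∀ᶠ y in 𝓝 x, scalar (conf f) y = c) (v w z : F) :
    divRiemann (conf f) x v w z = 0 := by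
  rw [divRiemann_conf h, traceL_covSchouten_eq_zero hF h hc, traceL_covSchouten_eq_zero hF h hc]
  ring

end Coord

/-! ### The Laplacian and the Yamabe equation -/

namespace Coord

section IsLocalMin

theorem deriv_deriv_nonneg_of_isLocalMin {f : ℝ → ℝ} {t : ℝ} (h : IsLocalMin f t)
    (hf : ContinuousAt f t) : 0 ≤ deriv (deriv f) t := by
  by_contra! hneg
  have hmax : IsLocalMax f t := isLocalMax_of_deriv_deriv_neg hneg h.deriv_eq_zero hf
  have hconst : f =ᶠ[𝓝 t] fun _ => f t := by
    filter_upwards [h, hmax] with s hs hs' using le_antisymm hs' hs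
  have hderiv : deriv f =ᶠ[𝓝 t] fun _ => 0 := by
    filter_upwards [hconst.eventuallyEq_nhds] with s hs
    rw [hs.deriv_eq, deriv_const]
  rw [hderiv.deriv_eq, deriv_const] at hneg
  exact hneg.false

theorem fderiv_fderiv_nonneg_of_isLocalMin {E : Type*} [NormedAddCommGroup E] [NormedSpace ℝ E]
    {f : E → ℝ} {x : E} (h : IsLocalMin f x) (hf : ContDiffAt ℝ 2 f x) (e : E) :
    0 ≤ fderiv ℝ (fderiv ℝ f) x e e := by
  set line : ℝ → E := fun t => x + t • e with hline
  have hline₀ : line 0 = x := by simp [hline]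
  have htendsto : Tendsto line (𝓝 0) (𝓝 x) := by
    have hcont : Continuous line := by fun_prop
    simpa [hline₀] using hcont.tendsto 0
  have hderivLine (t : ℝ) : HasDerivAt line e t := by
    simpa [hline] using ((hasDerivAt_id t).smul_const e).const_add x
  have hderiv : deriv (f ∘ line) =ᶠ[𝓝 0] fun t => fderiv ℝ f (line t) e := by
    filter_upwards [htendsto.eventually (hf.eventually (by simp))] with t ht
    exact ((ht.differentiableAt (by simp)).hasFDerivAt.comp_hasDerivAt t (hderivLine t)).deriv
  have hD : HasFDerivAt (fderiv ℝ f) (fderiv ℝ (fderiv ℝ f) x) (line 0) := by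
    rw [hline₀]
    exact ((hf.fderiv_right (m := 1) (by norm_num)).differentiableAt (by simp)).hasFDerivAt
  have hderiv₂ : HasDerivAt (fun t => fderiv ℝ f (line t) e) (fderiv ℝ (fderiv ℝ f) x e e) 0 := by
    simpa using (hD.comp_hasDerivAt 0 (hderivLine 0)).clm_apply (hasDerivAt_const (0 : ℝ) e)
  have hmin : IsLocalMin (f ∘ line) 0 := by
    have hle : ∀ᶠ t : ℝ in 𝓝 0, f x ≤ f (line t) := htendsto.eventually h
    simpa [IsLocalMin, IsMinFilter, hline₀] using hle
  have hcont : ContinuousAt (f ∘ line) 0 := by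
    rw [← hline₀] at hf
    exact hf.continuousAt.comp (hderivLine 0).continuousAt
  rw [← hderiv₂.deriv, ← hderiv.deriv_eq]
  exact deriv_deriv_nonneg_of_isLocalMin hmin hcont

end IsLocalMin

variable {F : Type*} [NormedAddCommGroup F] [InnerProductSpace ℝ F]
  {u v : F → ℝ} {x : F}

theorem IsSmoothNear.comp {g : ℝ → ℝ} (hv : IsSmoothNear v x)
    (hg : ∀ᶠ s in 𝓝 (v x), ContDiffAt ℝ ∞ g s) : IsSmoothNear (fun y => g (v y)) x := by
  filter_upwards [hv, hv.self_of_nhds.continuousAt.eventually hg] with y hy hgy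
  exact hgy.comp y hy

theorem IsSmoothNear.sub (hu : IsSmoothNear u x) (hv : IsSmoothNear v x) :
    IsSmoothNear (fun y => u y - v y) x := by
  filter_upwards [hu, hv] with y hy hy' using hy.sub hy'

theorem IsSmoothNear.const_mul (hu : IsSmoothNear u x) (c : ℝ) :
    IsSmoothNear (fun y => c * u y) x := by
  filter_upwards [hu] with y hy using contDiffAt_const.mul hy

theorem isSmoothNear_of_contDiff (h : ContDiff ℝ ∞ v) : IsSmoothNear v x :=
  Eventually.of_forall fun _ => h.contDiffAt

theorem isSmoothNear_log_norm {c : F} (hx : x ≠ c) :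
    IsSmoothNear (fun y => Real.log ‖y - c‖) x := by
  filter_upwards [isOpen_ne.mem_nhds hx] with y hy
  have hyc : y - c ≠ 0 := sub_ne_zero.2 hy
  exact ((contDiffAt_norm ℝ hyc).comp y (contDiffAt_id.sub contDiffAt_const)).log
    (norm_ne_zero_iff.2 hyc)

theorem isSmoothNear_norm_rpow {c : F} (hx : x ≠ c) (β : ℝ) :
    IsSmoothNear (fun y => ‖y - c‖ ^ β) x := by
  filter_upwards [isOpen_ne.mem_nhds hx] with y hy
  have hyc : y - c ≠ 0 := sub_ne_zero.2 hy
  exact ((contDiffAt_norm ℝ hyc).comp y (contDiffAt_id.sub contDiffAt_const)).rpow_const_of_ne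
    (norm_ne_zero_iff.2 hyc)

theorem hasFDerivAt_norm_sub_sq (c x : F) :
    HasFDerivAt (fun y : F => ‖y - c‖ ^ 2) (2 • innerSL ℝ (x - c)) x := by
  simpa using ((hasFDerivAt_id x).sub_const c).norm_sq

variable [FiniteDimensional ℝ F]

theorem gradient_eq_of_hasFDerivAt {w : F} {A : F →L[ℝ] ℝ} (h : HasFDerivAt v A x)
    (hw : ∀ z, A z = ⟪w, z⟫) : gradient v x = w := by
  have := FiniteDimensional.complete ℝ F
  refine ext_inner_right ℝ fun z => ?_
  rw [← fderiv_eq_inner_gradient, h.fderiv, hw]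

theorem laplacian_eq_traceL (hv : IsSmoothNear v x) :
    Δ v x = traceL F (fderiv ℝ (gradient v) x) := by
  rw [InnerProductSpace.laplacian_eq_iteratedFDeriv_stdOrthonormalBasis, traceL_apply,
    LinearMap.trace_eq_sum_inner _ (stdOrthonormalBasis ℝ F)]
  refine Finset.sum_congr rfl fun i _ => ?_
  rw [iteratedFDeriv_two_apply, real_inner_comm]
  exact (inner_fderiv_gradient hv _ _).symm

theorem gradient_comp {g : ℝ → ℝ} (hv : DifferentiableAt ℝ v x)
    (hg : DifferentiableAt ℝ g (v x)) :
    gradient (fun y => g (v y)) x = deriv g (v x) • gradient v x := by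
  apply gradient_eq_of_hasFDerivAt (hg.hasDerivAt.comp_hasFDerivAt x hv.hasFDerivAt)
  intro z
  rw [real_inner_smul_left, _root_.smul_apply, smul_eq_mul, fderiv_eq_inner_gradient]

theorem fderiv_gradient_comp {g : ℝ → ℝ} (hv : IsSmoothNear v x)
    (hg : ∀ᶠ s in 𝓝 (v x), ContDiffAt ℝ ∞ g s) :
    fderiv ℝ (gradient fun y => g (v y)) x =
      deriv g (v x) • fderiv ℝ (gradient v) x +
        (deriv (deriv g) (v x) • innerSL ℝ (gradient v x)).smulRight (gradient v x) := by
  have hev : (gradient fun y => g (v y)) =ᶠ[𝓝 x] fun y => deriv g (v y) • gradient v y := by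
    filter_upwards [hv, hv.contDiffAt.continuousAt.eventually hg] with y hy hgy
    exact gradient_comp (hy.differentiableAt (by simp)) (hgy.differentiableAt (by simp))
  have hg' : DifferentiableAt ℝ (deriv g) (v x) :=
    ((hg.self_of_nhds.fderiv_right (m := ∞) (by simp)).clm_apply
      (contDiffAt_const (c := (1 : ℝ)))).differentiableAt (by simp)
  have hD : fderiv ℝ (fun y => deriv g (v y) • gradient v y) x = _ :=
    ((hg'.hasDerivAt.comp_hasFDerivAt x hv.hasFDerivAt).smul hv.hasFDerivAt_gradient).fderiv
  rw [hev.fderiv_eq, hD]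
  ext z
  simp only [_root_.add_apply, _root_.smul_apply, ContinuousLinearMap.smulRight_apply,
    fderiv_eq_inner_gradient, Function.comp_apply, innerSL_apply_apply]

theorem laplacian_comp {g : ℝ → ℝ} (hv : IsSmoothNear v x)
    (hg : ∀ᶠ s in 𝓝 (v x), ContDiffAt ℝ ∞ g s) :
    Δ (fun y => g (v y)) x =
      deriv g (v x) * Δ v x + deriv (deriv g) (v x) * ⟪gradient v x, gradient v x⟫ := by
  rw [laplacian_eq_traceL (hv.comp hg), laplacian_eq_traceL hv, fderiv_gradient_comp hv hg,
    map_add, map_smul, traceL_smulRight]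
  simp

theorem traceL_schouten {f : F → ℝ} (hf : IsSmoothNear f x) :
    traceL F (schouten f x) = Δ f x +
      ((Module.finrank ℝ F : ℝ) - 2) / 2 * ⟪gradient f x, gradient f x⟫ := by
  rw [laplacian_eq_traceL hf, schouten]
  simp only [map_sub, map_add, map_smul, traceL_smulRight, traceL_id, innerSL_apply_apply,
    smul_eq_mul]
  ring

theorem exp_neg_two_mul_log {a s : ℝ} (hs : 0 < s) :
    Real.exp (-2 * (2 / a * Real.log s)) = s ^ (-(4 / a)) := by
  rw [Real.rpow_def_of_pos hs]
  congr 1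
  ring

/-- The Yamabe equation for `v^{4/(m-2)} ⟪·,·⟫`, in dimension `m`. -/
theorem scalar_conf_log (hF : 3 ≤ Module.finrank ℝ F) (hv : IsSmoothNear v x) (hpos : 0 < v x) :
    scalar (conf fun y => 2 / ((Module.finrank ℝ F : ℝ) - 2) * Real.log (v y)) x =
      -(4 * ((Module.finrank ℝ F : ℝ) - 1) / ((Module.finrank ℝ F : ℝ) - 2)) *
        (Δ v x * v x ^ (-(((Module.finrank ℝ F : ℝ) + 2) / ((Module.finrank ℝ F : ℝ) - 2)))) := by
  have hF' : (3 : ℝ) ≤ Module.finrank ℝ F := by exact_mod_cast hF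
  have hlog : ∀ᶠ s in 𝓝 (v x), ContDiffAt ℝ ∞
      (fun s => 2 / ((Module.finrank ℝ F : ℝ) - 2) * Real.log s) s := by
    filter_upwards [isOpen_ne.mem_nhds hpos.ne'] with s hs
    exact contDiffAt_const.mul (contDiffAt_id.log hs)
  rw [scalar_conf (hv.comp hlog), traceL_schouten (hv.comp hlog), laplacian_comp hv hlog,
    gradient_comp (hv.contDiffAt.differentiableAt (by simp))
      (hlog.self_of_nhds.differentiableAt (by simp))]
  generalize (Module.finrank ℝ F : ℝ) = m at hF'
  have hm : m - 2 ≠ 0 := by linarith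
  have hderiv : deriv (fun s => 2 / (m - 2) * Real.log s) = fun s => 2 / (m - 2) * s⁻¹ := by
    funext s
    simp
  have hderiv₂ : deriv (deriv fun s => 2 / (m - 2) * Real.log s) (v x) =
      -(2 / (m - 2) * (v x ^ 2)⁻¹) := by
    rw [hderiv]
    simp
  have hpow : v x ^ (-((m + 2) / (m - 2))) = v x ^ (-(4 / (m - 2))) * (v x)⁻¹ := by
    rw [← Real.rpow_neg_one, ← Real.rpow_add hpos]
    congr 1
    field_simp
    ring
  rw [hderiv₂, hderiv, exp_neg_two_mul_log hpos, hpow]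
  simp only [real_inner_smul_left, real_inner_smul_right]
  field_simp
  ring

theorem laplacian_nonneg_of_isLocalMin (hv : ContDiffAt ℝ 2 v x) (h : IsLocalMin v x) :
    0 ≤ Δ v x := by
  rw [InnerProductSpace.laplacian_eq_iteratedFDeriv_stdOrthonormalBasis]
  refine Finset.sum_nonneg fun i _ => ?_
  rw [iteratedFDeriv_two_apply]
  exact fderiv_fderiv_nonneg_of_isLocalMin h hv _

theorem laplacian_sub (hu : IsSmoothNear u x) (hv : IsSmoothNear v x) :
    Δ (fun y => u y - v y) x = Δ u x - Δ v x :=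
  hu.contDiffAt_two.laplacian_sub hv.contDiffAt_two

theorem laplacian_const_mul (hu : IsSmoothNear u x) (c : ℝ) :
    Δ (fun y => c * u y) x = c * Δ u x :=
  InnerProductSpace.laplacian_smul c hu.contDiffAt_two

theorem laplacian_norm_sq (x : F) : Δ (fun y : F => ‖y‖ ^ 2) x = 2 * Module.finrank ℝ F := by
  have hgrad : (gradient fun y : F => ‖y‖ ^ 2) = fun y => (2 : ℝ) • y := by
    funext y
    apply gradient_eq_of_hasFDerivAt (hasStrictFDerivAt_norm_sq y).hasFDerivAt
    intro z
    simp [real_inner_smul_left]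
  have hD : fderiv ℝ (fun y : F => (2 : ℝ) • y) x = (2 : ℝ) • ContinuousLinearMap.id ℝ F :=
    ((hasFDerivAt_id x).const_smul (2 : ℝ)).fderiv
  rw [laplacian_eq_traceL (isSmoothNear_of_contDiff (contDiff_norm_sq ℝ)), hgrad, hD, map_smul,
    traceL_id, smul_eq_mul]

theorem nonneg_of_laplacian_nonpos [Nontrivial F] {K : Set F} (hK : IsCompact K) {w : F → ℝ}
    (hc : ContinuousOn w K)
    (h : ∀ y ∈ K, 0 ≤ w y ∨ (K ∈ 𝓝 y ∧ IsSmoothNear w y ∧ Δ w y ≤ 0)) {y : F} (hy : y ∈ K) :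
    0 ≤ w y := by
  by_contra! hneg
  obtain ⟨R, hR⟩ := hK.isBounded.exists_norm_le
  -- Subtracting `η ‖·‖²` makes the Laplacian negative where it was only nonpositive; `η` is so
  -- small that the minimum of the difference is still attained where `w` is negative.
  obtain ⟨η, hη, hηR⟩ : ∃ η > 0, η * R ^ 2 < -(w y) :=
    exists_pos_mul_lt (neg_pos.2 hneg) (R ^ 2) |>.imp fun η hη => ⟨hη.1, by linarith [hη.2]⟩
  obtain ⟨z, hz, hmin⟩ := hK.exists_isMinOn ⟨y, hy⟩
    (f := fun y => w y - η * ‖y‖ ^ 2) (hc.sub (by fun_prop))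
  have hle : w z - η * ‖z‖ ^ 2 ≤ w y - η * ‖y‖ ^ 2 := hmin hy
  have hzR : ‖z‖ ^ 2 ≤ R ^ 2 := by
    have := hR z hz
    gcongr
  have hwz : w z < 0 := by nlinarith [sq_nonneg ‖y‖]
  obtain hwz' | ⟨hKz, hsmooth, hlap⟩ := h z hz
  · linarith
  · have hsq : IsSmoothNear (fun y : F => ‖y‖ ^ 2) z :=
      isSmoothNear_of_contDiff (contDiff_norm_sq ℝ)
    have hsub := hsmooth.sub (hsq.const_mul η)
    have hlap' := laplacian_nonneg_of_isLocalMin hsub.contDiffAt_two (hmin.isLocalMin hKz)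
    rw [laplacian_sub hsmooth (hsq.const_mul η), laplacian_const_mul hsq,
      laplacian_norm_sq] at hlap'
    have hdim : (0 : ℝ) < Module.finrank ℝ F := by exact_mod_cast Module.finrank_pos
    nlinarith [mul_pos hη hdim]

section Radial

variable {c : F}

theorem gradient_log_norm (hx : x ≠ c) :
    gradient (fun y => Real.log ‖y - c‖) x = (‖x - c‖ ^ 2)⁻¹ • (x - c) := by
  have hxc : ‖x - c‖ ^ 2 ≠ 0 := by simpa [sub_eq_zero] using hx
  have hsq : (fun y => Real.log ‖y - c‖) = fun y => 2⁻¹ * Real.log (‖y - c‖ ^ 2) := by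
    funext y
    rw [Real.log_pow]; push_cast; ring
  rw [hsq]
  apply gradient_eq_of_hasFDerivAt (((hasFDerivAt_norm_sub_sq c x).log hxc).const_mul 2⁻¹)
  intro z
  simp [real_inner_smul_left, inner_sub_left]
  ring

theorem fderiv_gradient_log_norm (hx : x ≠ c) :
    fderiv ℝ (gradient fun y => Real.log ‖y - c‖) x =
      (‖x - c‖ ^ 2)⁻¹ • ContinuousLinearMap.id ℝ F -
        (2 * ((‖x - c‖ ^ 2)⁻¹) ^ 2) • (innerSL ℝ (x - c)).smulRight (x - c) := by
  have hxc : ‖x - c‖ ^ 2 ≠ 0 := by simpa [sub_eq_zero] using hx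
  have hev : (gradient fun y => Real.log ‖y - c‖) =ᶠ[𝓝 x]
      fun y => (‖y - c‖ ^ 2)⁻¹ • (y - c) := by
    filter_upwards [isOpen_ne.mem_nhds hx] with y hy using gradient_log_norm hy
  have hD : fderiv ℝ (fun y => (‖y - c‖ ^ 2)⁻¹ • (y - c)) x = _ :=
    (((hasDerivAt_inv hxc).comp_hasFDerivAt x (hasFDerivAt_norm_sub_sq c x)).smul
      ((hasFDerivAt_id x).sub_const c)).fderiv
  rw [hev.fderiv_eq, hD]
  ext z
  simp
  module

theorem laplacian_log_norm (hx : x ≠ c) :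
    Δ (fun y => Real.log ‖y - c‖) x = ((Module.finrank ℝ F : ℝ) - 2) / ‖x - c‖ ^ 2 := by
  have : ‖x - c‖ ^ 2 ≠ 0 := by simpa [sub_eq_zero] using hx
  rw [laplacian_eq_traceL (isSmoothNear_log_norm hx), fderiv_gradient_log_norm hx, map_sub,
    map_smul, map_smul, traceL_id, traceL_smulRight, innerSL_apply_apply,
    real_inner_self_eq_norm_sq, smul_eq_mul, smul_eq_mul]
  field_simp

theorem laplacian_comp_log_norm (hx : x ≠ c) {g : ℝ → ℝ} (hg : ContDiff ℝ ∞ g) :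
    Δ (fun y => g (Real.log ‖y - c‖)) x =
      (deriv (deriv g) (Real.log ‖x - c‖) +
        ((Module.finrank ℝ F : ℝ) - 2) * deriv g (Real.log ‖x - c‖)) / ‖x - c‖ ^ 2 := by
  have : ‖x - c‖ ^ 2 ≠ 0 := by simpa [sub_eq_zero] using hx
  rw [laplacian_comp (isSmoothNear_log_norm hx) (Eventually.of_forall fun _ => hg.contDiffAt),
    laplacian_log_norm hx, gradient_log_norm hx, real_inner_smul_left, real_inner_smul_right,
    real_inner_self_eq_norm_sq]
  field_simp
  ring

theorem deriv_exp_mul {w : ℝ → ℝ} (hw : Differentiable ℝ w) (β : ℝ) :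
    deriv (fun s => Real.exp (β * s) * w s) =
      fun s => Real.exp (β * s) * (deriv w s + β * w s) := by
  funext s
  have hexp : HasDerivAt (fun s => Real.exp (β * s)) (Real.exp (β * s) * (β * 1)) s :=
    ((hasDerivAt_id s).const_mul β).exp
  have hmul : HasDerivAt (fun s => Real.exp (β * s) * w s) _ s := hexp.mul (hw s).hasDerivAt
  rw [hmul.deriv]
  ring

theorem laplacian_norm_rpow_mul_comp_log_norm (hx : x ≠ c) (β : ℝ) {w : ℝ → ℝ}
    (hw : ContDiff ℝ ∞ w) :
    Δ (fun y => ‖y - c‖ ^ β * w (Real.log ‖y - c‖)) x =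
      ‖x - c‖ ^ β * (deriv (deriv w) (Real.log ‖x - c‖) +
        (2 * β + (Module.finrank ℝ F : ℝ) - 2) * deriv w (Real.log ‖x - c‖) +
        β * (β + (Module.finrank ℝ F : ℝ) - 2) * w (Real.log ‖x - c‖)) / ‖x - c‖ ^ 2 := by
  have hexp {y} (hy : y ≠ c) : ‖y - c‖ ^ β = Real.exp (β * Real.log ‖y - c‖) := by
    rw [Real.rpow_def_of_pos (norm_pos_iff.2 (sub_ne_zero.2 hy)), mul_comm]
  have hev : (fun y => ‖y - c‖ ^ β * w (Real.log ‖y - c‖)) =ᶠ[𝓝 x]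
      fun y => (fun s => Real.exp (β * s) * w s) (Real.log ‖y - c‖) := by
    filter_upwards [isOpen_ne.mem_nhds hx] with y hy
    rw [hexp hy]
  have hw₁ := hw.differentiable (by simp)
  have hw₂ := (contDiff_infty_iff_deriv.1 hw).2.differentiable (by simp)
  rw [(InnerProductSpace.laplacian_congr_nhds hev).self_of_nhds, laplacian_comp_log_norm hx
    (g := fun s => Real.exp (β * s) * w s) (by fun_prop), deriv_exp_mul hw₁,
    deriv_exp_mul (w := fun s => deriv w s + β * w s) (by fun_prop), hexp hx]
  beta_reduce
  rw [deriv_fun_add (hw₂ _) ((hw₁ _).const_mul β), deriv_const_mul _ (hw₁ _)]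
  ring

theorem laplacian_norm_rpow (hx : x ≠ c) (β : ℝ) :
    Δ (fun y => ‖y - c‖ ^ β) x =
      β * (β + (Module.finrank ℝ F : ℝ) - 2) * ‖x - c‖ ^ β / ‖x - c‖ ^ 2 := by
  have h := laplacian_norm_rpow_mul_comp_log_norm hx β (w := fun _ => 1) contDiff_const
  simp only [mul_one, deriv_const', deriv_const, mul_zero, zero_add] at h
  rw [h]
  ring

end Radial

end Coord

/-! ### Kelvin transforms of singular solutions of the Yamabe equation -/

namespace Coord

variable {F : Type*} [NormedAddCommGroup F] {a K c l r M : ℝ} {x y : F}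

theorem ne_zero_of_norm_sub_le (hr : r < ‖x‖) (hy : ‖y - x‖ ≤ r) : y ≠ 0 := by
  rintro rfl
  rw [zero_sub, norm_neg] at hy
  linarith

theorem ne_of_le_norm_sub (hl : 0 < l) (hy : l ≤ ‖y - x‖) : y ≠ x :=
  sub_ne_zero.1 (norm_pos_iff.1 (hl.trans_le hy))

variable [InnerProductSpace ℝ F] {v : F → ℝ}

/-- The Kelvin transform of `v` in the sphere of centre `x` and radius `l`. The Yamabe equation in
dimension `m` is invariant under it for `a = (m - 2) / 2`. -/
def kelvin (v : F → ℝ) (a : ℝ) (x : F) (l : ℝ) (y : F) : ℝ :=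
  (l / ‖y - x‖) ^ (2 * a) * v (inversion x l y)

section Inversion

theorem norm_inversion_sub (x y : F) (l : ℝ) : ‖inversion x l y - x‖ = l ^ 2 / ‖y - x‖ := by
  rw [← dist_eq_norm, ← dist_eq_norm, dist_inversion_center]

theorem norm_inversion_sub_le (hl : 0 < l) (hy : l ≤ ‖y - x‖) : ‖inversion x l y - x‖ ≤ l := by
  rw [norm_inversion_sub, div_le_iff₀ (hl.trans_le hy), pow_two]
  gcongr

theorem inversion_ne_zero (hl : 0 < l) (hlx : l < ‖x‖) (hy : l ≤ ‖y - x‖) :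
    inversion x l y ≠ 0 :=
  ne_zero_of_norm_sub_le hlx (norm_inversion_sub_le hl hy)

theorem continuousAt_inversion_uncurry (hy : y ≠ x) :
    ContinuousAt (fun q : ℝ × F => inversion x q.1 q.2) (l, y) :=
  ContinuousAt.inversion continuousAt_const continuousAt_fst continuousAt_snd hy

theorem isInvertible_fderiv_inversion (hl : 0 < l) (hy : y ≠ x) :
    (fderiv ℝ (inversion x l) y).IsInvertible := by
  rw [(hasFDerivAt_inversion hy).fderiv]
  have hscale : (l / dist y x) ^ 2 ≠ 0 := by
    have := dist_pos.2 hy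
    positivity
  refine ⟨((ℝ ∙ (y - x))ᗮ.reflection.toContinuousLinearEquiv).trans
    (ContinuousLinearEquiv.smulLeft (Units.mk0 _ hscale)), ?_⟩
  ext z
  simp [ContinuousLinearEquiv.smulLeft, Units.smul_def]

theorem isLocalDiffeoNear_inversion (hl : 0 < l) (hy : y ≠ x) :
    IsLocalDiffeoNear (inversion x l) y := by
  filter_upwards [isOpen_ne.mem_nhds hy] with z hz
  exact ⟨contDiffAt_const.inversion contDiffAt_const contDiffAt_id hz,
    isInvertible_fderiv_inversion hl hz⟩

theorem inner_fderiv_inversion (hy : y ≠ x) (b d : F) :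
    ⟪fderiv ℝ (inversion x l) y b, fderiv ℝ (inversion x l) y d⟫ =
      (l / ‖y - x‖) ^ 4 * ⟪b, d⟫ := by
  have hrefl : ⟪((ℝ ∙ (y - x))ᗮ.reflection : F →L[ℝ] F) b,
      ((ℝ ∙ (y - x))ᗮ.reflection : F →L[ℝ] F) d⟫ = ⟪b, d⟫ :=
    LinearIsometryEquiv.inner_map_map (ℝ ∙ (y - x))ᗮ.reflection b d
  rw [(hasFDerivAt_inversion hy).fderiv]
  simp only [_root_.smul_apply, real_inner_smul_left, real_inner_smul_right, hrefl, dist_eq_norm]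
  ring

end Inversion

section Kelvin

theorem kelvin_of_mem_sphere (hl : 0 < l) (hy : ‖y - x‖ = l) : kelvin v a x l y = v y := by
  rw [kelvin, hy, div_self hl.ne', Real.one_rpow, one_mul,
    inversion_of_mem_sphere (by rwa [Metric.mem_sphere, dist_eq_norm])]

theorem kelvin_sub_const (δ : ℝ) :
    kelvin (fun z => v z - δ) a x l y = kelvin v a x l y - δ * kelvin (fun _ => 1) a x l y := by
  simp only [kelvin]
  ring

theorem kelvin_one_lt_one (ha : 0 < a) (hl : 0 < l) (hy : l < ‖y - x‖) :
    kelvin (fun _ => 1) a x l y < 1 := by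
  have := hl.trans hy
  rw [kelvin, mul_one]
  exact Real.rpow_lt_one (by positivity) ((div_lt_one this).2 hy) (by positivity)

theorem kelvin_pos (hl : 0 < l) (hy : y ≠ x) (hv : 0 < v (inversion x l y)) :
    0 < kelvin v a x l y := by
  have := norm_pos_iff.2 (sub_ne_zero.2 hy)
  rw [kelvin]
  positivity

theorem kelvin_le_rpow_mul (hM : ∀ y, ‖y - x‖ ≤ r → v y ≤ M) (hl : 0 < l) (hlr : l ≤ r)
    (hy : l ≤ ‖y - x‖) : kelvin v a x l y ≤ (l / ‖y - x‖) ^ (2 * a) * M := by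
  have := hl.trans_le hy
  rw [kelvin]
  gcongr
  exact hM _ ((norm_inversion_sub_le hl hy).trans hlr)

theorem kelvin_le (hM : ∀ y, ‖y - x‖ ≤ r → v y ≤ M) (hM₀ : 0 ≤ M) (ha : 0 ≤ a) (hl : 0 < l)
    (hlr : l ≤ r) (hy : l ≤ ‖y - x‖) : kelvin v a x l y ≤ M :=
  (kelvin_le_rpow_mul hM hl hlr hy).trans <| mul_le_of_le_one_left hM₀ <|
    Real.rpow_le_one (by positivity) ((div_le_one (hl.trans_le hy)).2 hy) (by positivity)

theorem kelvin_le_norm_rpow (hM : ∀ y, ‖y - x‖ ≤ r → v y ≤ M) (hM₀ : 0 ≤ M) (ha : 0 ≤ a)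
    (hl : 0 < l) (hlr : l ≤ r) (hy : l ≤ ‖y - x‖) (hy₀ : y ≠ 0) (hxy : 2 * ‖x‖ ≤ ‖y‖) :
    kelvin v a x l y ≤ (2 * r) ^ (2 * a) * M * ‖y‖ ^ (-(2 * a)) := by
  have hy₀ : 0 < ‖y‖ := norm_pos_iff.2 hy₀
  have hr : 0 < r := hl.trans_le hlr
  have hdist : ‖y‖ / 2 ≤ ‖y - x‖ := by linarith [norm_sub_norm_le y x]
  calc kelvin v a x l y ≤ (l / ‖y - x‖) ^ (2 * a) * M := kelvin_le_rpow_mul hM hl hlr hy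
    _ ≤ (r / (‖y‖ / 2)) ^ (2 * a) * M := by gcongr
    _ = (2 * r * ‖y‖⁻¹) ^ (2 * a) * M := by congr 2; field_simp
    _ = (2 * r) ^ (2 * a) * M * ‖y‖ ^ (-(2 * a)) := by
      rw [Real.mul_rpow (by positivity) (by positivity), Real.inv_rpow hy₀.le,
        ← Real.rpow_neg hy₀.le]
      ring

theorem isSmoothNear_kelvin (hl : 0 < l) (hy : y ≠ x) (hv : IsSmoothNear v (inversion x l y)) :
    IsSmoothNear (kelvin v a x l) y := by
  have hd := isLocalDiffeoNear_inversion hl hy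
  filter_upwards [isOpen_ne.mem_nhds hy, hd, hd.contDiffAt.continuousAt.eventually hv]
    with z hz hinv hvz
  have hz : z - x ≠ 0 := sub_ne_zero.2 hz
  have hscale : ContDiffAt ℝ ∞ (fun z => l / ‖z - x‖) z :=
    contDiffAt_const.div ((contDiffAt_norm ℝ hz).comp z (contDiffAt_id.sub contDiffAt_const))
      (norm_ne_zero_iff.2 hz)
  exact (hscale.rpow_const_of_ne (div_ne_zero hl.ne' (norm_ne_zero_iff.2 hz))).mul
    (hvz.comp z hinv.1)

variable [FiniteDimensional ℝ F]

theorem isLocalIsometryNear_inversion (hm : 3 ≤ Module.finrank ℝ F)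
    (ha : (Module.finrank ℝ F : ℝ) = 2 * a + 2) (hl : 0 < l) (hy : y ≠ x)
    (hv : IsSmoothNear v (inversion x l y)) (hpos : 0 < v (inversion x l y)) :
    IsLocalIsometryNear (inversion x l)
      (conf fun y => 2 / ((Module.finrank ℝ F : ℝ) - 2) * Real.log (kelvin v a x l y))
      (conf fun y => 2 / ((Module.finrank ℝ F : ℝ) - 2) * Real.log (v y)) y where
  isLocalDiffeoNear := isLocalDiffeoNear_inversion hl hy
  isMetricNear_target := by
    refine (hv.comp (g := fun s => 2 / ((Module.finrank ℝ F : ℝ) - 2) * Real.log s) ?_).isMetricNear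
    filter_upwards [isOpen_ne.mem_nhds hpos.ne'] with s hs
    exact contDiffAt_const.mul (contDiffAt_id.log hs)
  eventuallyEq := by
    have hm' : (3 : ℝ) ≤ Module.finrank ℝ F := by exact_mod_cast hm
    have ha₀ : 0 < a := by linarith
    have hm₂ : (Module.finrank ℝ F : ℝ) - 2 = 2 * a := by linarith
    have hcont := (isLocalDiffeoNear_inversion hl hy).contDiffAt.continuousAt
    filter_upwards [isOpen_ne.mem_nhds hy,
      hcont.eventually (hv.contDiffAt.continuousAt.eventually (lt_mem_nhds hpos))] with z hz hvz
    have hscale : 0 < l / ‖z - x‖ := div_pos hl (norm_pos_iff.2 (sub_ne_zero.2 hz))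
    have hexp : 2 * (2 / (2 * a) * Real.log (kelvin v a x l z)) =
        2 * (2 / (2 * a) * Real.log (v (inversion x l z))) + (4 : ℕ) * Real.log (l / ‖z - x‖) := by
      rw [kelvin, Real.log_mul (Real.rpow_pos_of_pos hscale _).ne' hvz.ne', Real.log_rpow hscale]
      push_cast
      field_simp
      ring
    ext b d
    rw [pull_apply, conf_apply, conf_apply, inner_fderiv_inversion hz, hm₂, hexp, Real.exp_add,
      Real.exp_nat_mul, Real.exp_log hscale]
    ring

theorem laplacian_kelvin (hm : 3 ≤ Module.finrank ℝ F)
    (ha : (Module.finrank ℝ F : ℝ) = 2 * a + 2) (hl : 0 < l) (hy : y ≠ x)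
    (hv : IsSmoothNear v (inversion x l y)) (hpos : 0 < v (inversion x l y)) :
    Δ (kelvin v a x l) y * kelvin v a x l y ^ (-((a + 2) / a)) =
      Δ v (inversion x l y) * v (inversion x l y) ^ (-((a + 2) / a)) := by
  have hm' : (3 : ℝ) ≤ Module.finrank ℝ F := by exact_mod_cast hm
  have ha₀ : 0 < a := by linarith
  have hscalar := (isLocalIsometryNear_inversion hm ha hl hy hv hpos).scalar_eq
  rw [scalar_conf_log hm hv hpos,
    scalar_conf_log hm (isSmoothNear_kelvin hl hy hv) (kelvin_pos hl hy hpos)] at hscalar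
  have hcoef : -(4 * ((Module.finrank ℝ F : ℝ) - 1) / ((Module.finrank ℝ F : ℝ) - 2)) ≠ 0 :=
    neg_ne_zero.2 (div_ne_zero (by linarith) (by linarith))
  have hexponent :
      ((Module.finrank ℝ F : ℝ) + 2) / ((Module.finrank ℝ F : ℝ) - 2) = (a + 2) / a := by
    rw [show (Module.finrank ℝ F : ℝ) - 2 = 2 * a by linarith, ha]
    field_simp
    ring
  rw [hexponent] at hscalar
  exact mul_left_cancel₀ hcoef hscalar

theorem laplacian_kelvin_one (hm : 3 ≤ Module.finrank ℝ F)
    (ha : (Module.finrank ℝ F : ℝ) = 2 * a + 2) (hl : 0 < l) (hy : y ≠ x) :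
    Δ (kelvin (fun _ => 1) a x l) y = 0 := by
  have h := laplacian_kelvin hm ha hl hy (isSmoothNear_of_contDiff contDiff_const) one_pos
  rw [InnerProductSpace.laplacian_const, Pi.zero_apply, zero_mul] at h
  exact (mul_eq_zero.1 h).resolve_right
    (Real.rpow_pos_of_pos (kelvin_pos hl hy one_pos) _).ne'

end Kelvin

/-- `v` lies above its Kelvin transform outside the sphere of centre `x` and radius `l`: the
property that is propagated in `l` by the method of moving spheres. -/
def DominatesKelvin (v : F → ℝ) (a : ℝ) (x : F) (l : ℝ) : Prop :=
  ∀ y, y ≠ 0 → l ≤ ‖y - x‖ → kelvin v a x l y ≤ v y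

/-- A positive solution `v` of the Yamabe equation `Δ v = -K v ^ ((m + 2) / (m - 2))` on the
punctured Euclidean space of dimension `m = 2 a + 2`, singular at the origin and not decaying too
fast at infinity: both are encoded by the lower bound. -/
structure IsSingularSolution [FiniteDimensional ℝ F] (v : F → ℝ) (a K c : ℝ) : Prop where
  three_le_finrank : 3 ≤ Module.finrank ℝ F
  finrank_eq : (Module.finrank ℝ F : ℝ) = 2 * a + 2
  contDiffOn : ContDiffOn ℝ ∞ v {0}ᶜ
  pos : ∀ x, x ≠ 0 → 0 < v x
  laplacian_eq : ∀ x, x ≠ 0 → Δ v x = -K * v x ^ ((a + 2) / a)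
  nonneg : 0 ≤ K
  const_pos : 0 < c
  le_apply : ∀ x, x ≠ 0 → c * ‖x‖ ^ (-a) ≤ v x

namespace IsSingularSolution

variable [FiniteDimensional ℝ F] (h : IsSingularSolution v a K c)

include h

theorem weight_pos : 0 < a := by
  have hm : (3 : ℝ) ≤ Module.finrank ℝ F := by exact_mod_cast h.three_le_finrank
  linarith [h.finrank_eq]

theorem nontrivial : Nontrivial F :=
  Module.nontrivial_of_finrank_pos (R := ℝ) (by have := h.three_le_finrank; omega)

theorem isSmoothNear (hy : y ≠ 0) : IsSmoothNear v y :=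
  isSmoothNear_of_isOpen isOpen_compl_singleton h.contDiffOn hy

theorem continuousAt (hy : y ≠ 0) : ContinuousAt v y :=
  (h.isSmoothNear hy).contDiffAt.continuousAt

section Annulus

theorem exists_le_of_norm_sub_le (hr : r < ‖x‖) :
    ∃ M, 0 < M ∧ ∀ y, ‖y - x‖ ≤ r → v y ≤ M := by
  have hcont : ContinuousOn v (closedBall x r) := fun y hy =>
    (h.continuousAt (ne_zero_of_norm_sub_le hr (mem_closedBall_iff_norm.1 hy))).continuousWithinAt
  obtain ⟨M, hM⟩ := (isCompact_closedBall x r).exists_bound_of_continuousOn hcont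
  exact ⟨max M 1, by positivity, fun y hy => (le_abs_self _).trans
    ((hM y (mem_closedBall_iff_norm.2 hy)).trans (le_max_left _ _))⟩

theorem exists_le_apply_of_norm_le (M : ℝ) : ∃ ε > 0, ∀ y, y ≠ 0 → ‖y‖ ≤ ε → M ≤ v y := by
  have ha := h.weight_pos
  have hc := h.const_pos
  set q := (|M| + 1) / c with hq
  have hq₀ : 0 < q := by positivity
  refine ⟨q ^ (-a)⁻¹, by positivity, fun y hy hyq => ?_⟩
  have hrpow : q ≤ ‖y‖ ^ (-a) :=
    calc q = (q ^ (-a)⁻¹) ^ (-a) := by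
          rw [← Real.rpow_mul hq₀.le, inv_mul_cancel₀ (neg_ne_zero.2 ha.ne'), Real.rpow_one]
      _ ≤ ‖y‖ ^ (-a) := Real.rpow_le_rpow_of_nonpos (norm_pos_iff.2 hy) hyq (by linarith)
  rw [hq, div_le_iff₀ hc] at hrpow
  linarith [le_abs_self M, h.le_apply y hy]

theorem exists_forall_mul_rpow_le (A : ℝ) :
    ∃ R > 0, ∀ y, y ≠ 0 → R ≤ ‖y‖ → A * ‖y‖ ^ (-(2 * a)) ≤ v y := by
  have ha := h.weight_pos
  have hc := h.const_pos
  set q := (|A| + 1) / c with hq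
  have hq₀ : 0 < q := by positivity
  refine ⟨q ^ a⁻¹, by positivity, fun y hy hyq => ?_⟩
  have hy₀ := norm_pos_iff.2 hy
  have hrpow : q ≤ ‖y‖ ^ a :=
    calc q = (q ^ a⁻¹) ^ a := by rw [← Real.rpow_mul hq₀.le, inv_mul_cancel₀ ha.ne', Real.rpow_one]
      _ ≤ ‖y‖ ^ a := by gcongr
  rw [hq, div_le_iff₀ hc] at hrpow
  calc A * ‖y‖ ^ (-(2 * a)) ≤ c * ‖y‖ ^ a * ‖y‖ ^ (-(2 * a)) := by
        gcongr
        linarith [le_abs_self A]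
    _ = c * ‖y‖ ^ (-a) := by
      rw [mul_assoc, ← Real.rpow_add hy₀]
      ring_nf
    _ ≤ v y := h.le_apply y hy

/-- Moving spheres cannot touch `v` first near the origin, where `v` is unbounded, nor near
infinity, where `v` decays more slowly than its Kelvin transforms. -/
theorem exists_annulus (hr : r < ‖x‖) : ∃ ε > 0, ∃ R > 0, ∃ δ > 0,
    ∀ l, 0 < l → l ≤ r → ∀ y, y ≠ 0 → l ≤ ‖y - x‖ →
      (‖y‖ = ε ∨ ‖y‖ = R → kelvin v a x l y + δ ≤ v y) ∧
        (v y ≤ kelvin v a x l y → ε < ‖y‖ ∧ ‖y‖ < R) := by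
  have ha := h.weight_pos
  obtain ⟨M, hM₀, hM⟩ := h.exists_le_of_norm_sub_le hr
  obtain ⟨ε, hε, hzero⟩ := h.exists_le_apply_of_norm_le (M + 1)
  obtain ⟨R₀, hR₀, hinf⟩ := h.exists_forall_mul_rpow_le ((2 * r) ^ (2 * a) * M + 1)
  set R := max R₀ (2 * ‖x‖)
  have hR : 0 < R := hR₀.trans_le (le_max_left _ _)
  have hinner : ∀ l, 0 < l → l ≤ r → ∀ y, y ≠ 0 → l ≤ ‖y - x‖ → ‖y‖ ≤ ε →
      kelvin v a x l y + 1 ≤ v y := fun l hl hlr y hy hly hyε => by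
    linarith [kelvin_le hM hM₀.le ha.le hl hlr hly, hzero y hy hyε]
  have houter : ∀ l, 0 < l → l ≤ r → ∀ y, y ≠ 0 → l ≤ ‖y - x‖ → R ≤ ‖y‖ →
      kelvin v a x l y + ‖y‖ ^ (-(2 * a)) ≤ v y := fun l hl hlr y hy hly hyR => by
    linarith [kelvin_le_norm_rpow hM hM₀.le ha.le hl hlr hly hy ((le_max_right _ _).trans hyR),
      hinf y hy ((le_max_left _ _).trans hyR)]
  refine ⟨ε, hε, R, hR, min 1 (R ^ (-(2 * a))), by positivity, fun l hl hlr y hy hly =>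
    ⟨?_, fun hle => ⟨?_, ?_⟩⟩⟩
  · rintro (hyε | hyR)
    · linarith [hinner l hl hlr y hy hly hyε.le, min_le_left 1 (R ^ (-(2 * a)))]
    · have hgap := houter l hl hlr y hy hly hyR.ge
      rw [hyR] at hgap
      linarith [min_le_right 1 (R ^ (-(2 * a)))]
  · by_contra! hyε
    linarith [hinner l hl hlr y hy hly hyε]
  · by_contra! hyR
    have : 0 < ‖y‖ ^ (-(2 * a)) := Real.rpow_pos_of_pos (norm_pos_iff.2 hy) _
    linarith [houter l hl hlr y hy hly hyR]

end Annulus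

theorem kelvin_pos (hl : 0 < l) (hlx : l < ‖x‖) (hy : l ≤ ‖y - x‖) : 0 < kelvin v a x l y :=
  Coord.kelvin_pos hl (ne_of_le_norm_sub hl hy) (h.pos _ (inversion_ne_zero hl hlx hy))

theorem isSmoothNear_kelvin (hl : 0 < l) (hlx : l < ‖x‖) (hy : l ≤ ‖y - x‖) :
    IsSmoothNear (kelvin v a x l) y :=
  Coord.isSmoothNear_kelvin hl (ne_of_le_norm_sub hl hy)
    (h.isSmoothNear (inversion_ne_zero hl hlx hy))

theorem continuousAt_kelvin (hl : 0 < l) (hlx : l < ‖x‖) (hy : l ≤ ‖y - x‖) :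
    ContinuousAt (fun q : ℝ × F => kelvin v a x q.1 q.2) (l, y) := by
  have ha := h.weight_pos
  refine ContinuousAt.mul (ContinuousAt.rpow_const ?_ (Or.inr (by positivity))) ?_
  · exact continuousAt_fst.div (by fun_prop) (hl.trans_le hy).ne'
  · exact ContinuousAt.comp (f := fun q : ℝ × F => inversion x q.1 q.2) (g := v)
      (h.continuousAt (inversion_ne_zero hl hlx hy))
      (continuousAt_inversion_uncurry (ne_of_le_norm_sub hl hy))

theorem laplacian_kelvin (hl : 0 < l) (hlx : l < ‖x‖) (hy : l ≤ ‖y - x‖) :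
    Δ (kelvin v a x l) y = -K * kelvin v a x l y ^ ((a + 2) / a) := by
  have hinv := inversion_ne_zero hl hlx hy
  have hcov := Coord.laplacian_kelvin h.three_le_finrank h.finrank_eq hl
    (ne_of_le_norm_sub hl hy) (h.isSmoothNear hinv) (h.pos _ hinv)
  have hv := Real.rpow_pos_of_pos (h.pos _ hinv) ((a + 2) / a)
  have hk := Real.rpow_pos_of_pos (h.kelvin_pos hl hlx hy) ((a + 2) / a)
  rw [h.laplacian_eq _ hinv, Real.rpow_neg (h.pos _ hinv).le,
    Real.rpow_neg (h.kelvin_pos hl hlx hy).le] at hcov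
  field_simp at hcov
  linarith

section Barrier

theorem isSmoothNear_sub_kelvin (hl : 0 < l) (hlx : l < ‖x‖) (hy₀ : y ≠ 0) (hy : l ≤ ‖y - x‖)
    (δ : ℝ) : IsSmoothNear (fun z => v z - δ - kelvin (fun z => v z - δ) a x l z) y :=
  ((h.isSmoothNear hy₀).sub (isSmoothNear_of_contDiff contDiff_const)).sub
    (Coord.isSmoothNear_kelvin hl (ne_of_le_norm_sub hl hy)
      ((h.isSmoothNear (inversion_ne_zero hl hlx hy)).sub
        (isSmoothNear_of_contDiff contDiff_const)))

/-- `v` and its Kelvin transform solve the same equation, and the Kelvin transform of a constant is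
harmonic. -/
theorem laplacian_sub_kelvin_nonpos (hl : 0 < l) (hlx : l < ‖x‖) (hy₀ : y ≠ 0)
    (hy : l ≤ ‖y - x‖) (hle : kelvin v a x l y ≤ v y) (δ : ℝ) :
    Δ (fun z => v z - δ - kelvin (fun z => v z - δ) a x l z) y ≤ 0 := by
  have ha := h.weight_pos
  have hyx := ne_of_le_norm_sub hl hy
  have hv := h.isSmoothNear hy₀
  have hk := h.isSmoothNear_kelvin hl hlx hy
  have hone : IsSmoothNear (kelvin (fun _ => 1) a x l) y :=
    Coord.isSmoothNear_kelvin hl hyx (isSmoothNear_of_contDiff contDiff_const)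
  have hconst : IsSmoothNear (fun _ : F => δ) y := isSmoothNear_of_contDiff contDiff_const
  simp only [kelvin_sub_const]
  rw [laplacian_sub (hv.sub hconst) (hk.sub (hone.const_mul δ)), laplacian_sub hv hconst,
    laplacian_sub hk (hone.const_mul δ), laplacian_const_mul hone,
    laplacian_kelvin_one h.three_le_finrank h.finrank_eq hl hyx,
    InnerProductSpace.laplacian_const, Pi.zero_apply, h.laplacian_eq y hy₀,
    h.laplacian_kelvin hl hlx hy]
  have hrpow : kelvin v a x l y ^ ((a + 2) / a) ≤ v y ^ ((a + 2) / a) :=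
    Real.rpow_le_rpow (h.kelvin_pos hl hlx hy).le hle (by positivity)
  linarith [mul_le_mul_of_nonneg_left hrpow h.nonneg]

theorem kelvin_sub_const_le_of_annulus {ε R δ : ℝ} (hε : 0 < ε) (hδ : 0 ≤ δ) (hl : 0 < l)
    (hlx : l < ‖x‖) (hle : DominatesKelvin v a x l)
    (hgap : ∀ y, y ≠ 0 → l ≤ ‖y - x‖ → ‖y‖ = ε ∨ ‖y‖ = R → kelvin v a x l y + δ ≤ v y)
    (hεy : ε ≤ ‖y‖) (hyR : ‖y‖ ≤ R) (hy : l ≤ ‖y - x‖) :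
    kelvin (fun z => v z - δ) a x l y ≤ v y - δ := by
  have := h.nontrivial
  set S : Set F := {y | ε ≤ ‖y‖ ∧ ‖y‖ ≤ R ∧ l ≤ ‖y - x‖}
  have hne : ∀ y ∈ S, y ≠ 0 := fun y hy => norm_pos_iff.1 (hε.trans_le hy.1)
  have hcompact : IsCompact S := by
    refine (isCompact_closedBall (0 : F) R).of_isClosed_subset ?_ fun y hy => by simpa using hy.2.1
    exact (isClosed_le continuous_const continuous_norm).inter
      ((isClosed_le continuous_norm continuous_const).inter
        (isClosed_le continuous_const (continuous_id.sub continuous_const).norm))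
  have hsmooth : ∀ y ∈ S, IsSmoothNear (fun z => v z - δ - kelvin (fun z => v z - δ) a x l z) y :=
    fun y hy => h.isSmoothNear_sub_kelvin hl hlx (hne y hy) hy.2.2 δ
  refine sub_nonneg.1 <| nonneg_of_laplacian_nonpos hcompact
    (fun y hy => (hsmooth y hy).contDiffAt.continuousAt.continuousWithinAt) ?_ ⟨hεy, hyR, hy⟩
  intro y hy
  by_cases hedge : ‖y‖ = ε ∨ ‖y‖ = R
  · left
    have hk : 0 ≤ kelvin (fun _ => 1) a x l y :=
      (Coord.kelvin_pos hl (ne_of_le_norm_sub hl hy.2.2) one_pos).le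
    rw [kelvin_sub_const]
    linarith [hgap y (hne y hy) hy.2.2 hedge, mul_nonneg hδ hk]
  by_cases hsphere : ‖y - x‖ = l
  · exact Or.inl (by rw [kelvin_of_mem_sphere hl hsphere, sub_self])
  right
  push Not at hedge
  refine ⟨?_, hsmooth y hy,
    h.laplacian_sub_kelvin_nonpos hl hlx (hne y hy) hy.2.2 (hle y (hne y hy) hy.2.2) δ⟩
  have hdist : Continuous fun z : F => ‖z - x‖ := by fun_prop
  filter_upwards [continuous_norm.continuousAt.eventually (lt_mem_nhds (hy.1.lt_of_ne' hedge.1)),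
    continuous_norm.continuousAt.eventually (gt_mem_nhds (hy.2.1.lt_of_ne hedge.2)),
    hdist.continuousAt.eventually (lt_mem_nhds (hy.2.2.lt_of_ne' hsphere))]
    with z hzε hzR hzl using ⟨hzε.le, hzR.le, hzl.le⟩

end Barrier

end IsSingularSolution

end Coord

/-! ### The method of moving spheres -/

namespace Coord

variable {F : Type*} [NormedAddCommGroup F] [InnerProductSpace ℝ F]
variable {v : F → ℝ} {a K c l : ℝ} {x y : F}

section Radial

theorem inversion_add_smul (hl : 0 < l) (hy : ‖y - x‖ = l) {t : ℝ} (ht : 0 < t) :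
    inversion x l (x + t • (y - x)) = x + t⁻¹ • (y - x) := by
  have hdist : dist (x + t • (y - x)) x = t * l := by
    rw [dist_eq_norm, add_sub_cancel_left, norm_smul, Real.norm_of_nonneg ht.le, hy]
  rw [inversion, hdist, vsub_eq_sub, vadd_eq_add, add_sub_cancel_left, smul_smul, add_comm]
  congr 2
  field_simp

theorem inversion_eq_add_smul (x y : F) (l : ℝ) :
    inversion x l y = x + (l / ‖y - x‖) ^ 2 • (y - x) := by
  rw [inversion, dist_eq_norm, vsub_eq_sub, vadd_eq_add, add_comm]

theorem kelvin_add_smul (hl : 0 < l) (hy : ‖y - x‖ = l) {t : ℝ} (ht : 0 < t) :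
    kelvin v a x l (x + t • (y - x)) = t ^ (-(2 * a)) * v (x + t⁻¹ • (y - x)) := by
  have hscale : l / ‖x + t • (y - x) - x‖ = t⁻¹ := by
    rw [add_sub_cancel_left, norm_smul, Real.norm_of_nonneg ht.le, hy]
    field_simp
  rw [kelvin, inversion_add_smul hl hy ht, hscale, Real.inv_rpow ht.le, Real.rpow_neg ht.le]

theorem kelvin_eq_rpow_mul (hl : 0 ≤ l) :
    kelvin v a x l y =
      ((l / ‖y - x‖) ^ 2) ^ a * v (x + (l / ‖y - x‖) ^ 2 • (y - x)) := by
  rw [kelvin, inversion_eq_add_smul, Real.rpow_mul (by positivity), Real.rpow_two]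

/-- The derivative of `s ↦ s ^ a * v (x + s • (y - x))` at `s = 1`, whose sign decides on which side
of `v` the Kelvin transforms in spheres of centre `x` through `y` lie near `y`. -/
def radial (v : F → ℝ) (a : ℝ) (x y : F) : ℝ := a * v y + fderiv ℝ v y (y - x)

theorem radial_sub_const (δ : ℝ) : radial (fun z => v z - δ) a x y = radial v a x y - a * δ := by
  rw [radial, radial, fderiv_sub_const]
  ring

theorem hasDerivAt_line (hv : DifferentiableAt ℝ v y) {f : ℝ → ℝ} {f' t : ℝ} {x w : F}
    (hf : HasDerivAt f f' t) (hft : x + f t • w = y) :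
    HasDerivAt (fun s => v (x + f s • w)) (f' * fderiv ℝ v y w) t := by
  subst hft
  exact (hv.hasFDerivAt.comp_hasDerivAt t ((hf.smul_const w).const_add x)).congr_deriv (by simp)

theorem nonneg_of_hasDerivAt_of_le_nhdsGT {j : ℝ → ℝ} {j' t : ℝ} (hj : HasDerivAt j j' t)
    (h : ∀ᶠ s in 𝓝[>] t, j t ≤ j s) : 0 ≤ j' := by
  refine ge_of_tendsto (hj.tendsto_slope.mono_left (nhdsGT_le_nhdsNE t)) ?_
  filter_upwards [h, self_mem_nhdsWithin] with s hs hts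
  rw [slope_def_field]
  exact div_nonneg (sub_nonneg.2 hs) (sub_nonneg.2 (le_of_lt hts))

theorem radial_nonneg_of_kelvin_le (hl : 0 < l) (hy : ‖y - x‖ = l) (hv : DifferentiableAt ℝ v y)
    (hle : ∀ᶠ z in 𝓝 y, l ≤ ‖z - x‖ → kelvin v a x l z ≤ v z) : 0 ≤ radial v a x y := by
  set j : ℝ → ℝ := fun t => v (x + t • (y - x)) - t ^ (-(2 * a)) * v (x + t⁻¹ • (y - x)) with hj
  have hrpow : HasDerivAt (fun t : ℝ => t ^ (-(2 * a))) (-(2 * a)) 1 := by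
    simpa using Real.hasDerivAt_rpow_const (x := 1) (p := -(2 * a)) (Or.inl one_ne_zero)
  have hinv : HasDerivAt (fun t : ℝ => t⁻¹) (-1) 1 := by
    simpa using hasDerivAt_inv (one_ne_zero (α := ℝ))
  have hderiv : HasDerivAt j (2 * radial v a x y) 1 := by
    refine ((hasDerivAt_line (x := x) (w := y - x) hv (hasDerivAt_id (1 : ℝ)) (by simp)).sub
      (hrpow.mul (hasDerivAt_line (x := x) (w := y - x) hv hinv (by simp)))).congr_deriv ?_
    simp only [inv_one, one_smul, add_sub_cancel, Real.one_rpow, radial]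
    ring
  have hj₁ : j 1 = 0 := by simp [hj]
  suffices h : ∀ᶠ t in 𝓝[>] 1, j 1 ≤ j t by
    linarith [nonneg_of_hasDerivAt_of_le_nhdsGT hderiv h]
  have hlim : Tendsto (fun t : ℝ => x + t • (y - x)) (𝓝[>] 1) (𝓝 y) := by
    have hcont : Continuous fun t : ℝ => x + t • (y - x) := by fun_prop
    simpa using (hcont.tendsto 1).mono_left nhdsWithin_le_nhds
  filter_upwards [hlim.eventually hle, self_mem_nhdsWithin] with t ht ht₁
  have ht₁ : 1 < t := ht₁
  have hdist : l ≤ ‖x + t • (y - x) - x‖ := by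
    rw [add_sub_cancel_left, norm_smul, Real.norm_of_nonneg (by linarith), hy]
    nlinarith
  rw [hj₁, hj, sub_nonneg, ← kelvin_add_smul hl hy (one_pos.trans ht₁)]
  exact ht hdist

theorem monotoneOn_rpow_mul_of_radial_nonneg {w : F} {s₀ s₁ : ℝ} (hs₀ : 0 < s₀)
    (hv : ∀ s ∈ Icc s₀ s₁, DifferentiableAt ℝ v (x + s • w))
    (hr : ∀ s ∈ Icc s₀ s₁, 0 ≤ radial v a x (x + s • w)) :
    MonotoneOn (fun s : ℝ => s ^ a * v (x + s • w)) (Icc s₀ s₁) := by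
  have hderiv : ∀ s ∈ Icc s₀ s₁, HasDerivAt (fun s : ℝ => s ^ a * v (x + s • w))
      (s ^ (a - 1) * radial v a x (x + s • w)) s := by
    intro s hs
    have hs' : s ≠ 0 := (hs₀.trans_le hs.1).ne'
    refine ((Real.hasDerivAt_rpow_const (p := a) (Or.inl hs')).mul
      (hasDerivAt_line (hv s hs) (hasDerivAt_id s) rfl)).congr_deriv ?_
    rw [radial, add_sub_cancel_left, map_smul, smul_eq_mul, id, Real.rpow_sub_one hs']
    field_simp
  refine monotoneOn_of_hasDerivWithinAt_nonneg (convex_Icc _ _)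
    (fun s hs => (hderiv s hs).continuousAt.continuousWithinAt)
    (fun s hs => (hderiv s (interior_subset hs)).hasDerivWithinAt) fun s hs => ?_
  have hs := interior_subset hs
  exact mul_nonneg (Real.rpow_nonneg (hs₀.le.trans hs.1) _) (hr s hs)

theorem kelvin_le_of_radial_nonneg {U : Set F} (hU : Convex ℝ U)
    (hv : ∀ z ∈ U, DifferentiableAt ℝ v z) (hr : ∀ z ∈ U, 0 ≤ radial v a x z) (hl : 0 < l)
    (hly : l ≤ ‖y - x‖) (hy : y ∈ U) (hinv : inversion x l y ∈ U) : kelvin v a x l y ≤ v y := by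
  have hdist : 0 < ‖y - x‖ := hl.trans_le hly
  set s₀ := (l / ‖y - x‖) ^ 2 with hs₀
  have hs₀_pos : 0 < s₀ := by positivity
  have hs₀_le : s₀ ≤ 1 := pow_le_one₀ (by positivity) ((div_le_one hdist).2 hly)
  have hseg : ∀ s ∈ Icc s₀ 1, x + s • (y - x) ∈ U := by
    have hline (s : ℝ) : AffineMap.lineMap x y s = x + s • (y - x) := by
      rw [AffineMap.lineMap_apply_module', add_comm]
    have hconv := (hU.affine_preimage (AffineMap.lineMap x y : ℝ →ᵃ[ℝ] F)).ordConnected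
    intro s hs
    rw [← hline]
    refine hconv.out (x := s₀) (y := 1) ?_ ?_ hs
    · rwa [mem_preimage, hline, hs₀, ← inversion_eq_add_smul]
    · rwa [mem_preimage, AffineMap.lineMap_apply_one]
  have hmono := monotoneOn_rpow_mul_of_radial_nonneg hs₀_pos (fun s hs => hv _ (hseg s hs))
    (fun s hs => hr _ (hseg s hs)) (left_mem_Icc.2 hs₀_le) (right_mem_Icc.2 hs₀_le) hs₀_le
  rw [kelvin_eq_rpow_mul hl.le]
  simpa using hmono

end Radial

section Reflection

theorem tendsto_div_norm_sub_inv_smul (y e : F) (he : ‖e‖ = 1) :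
    Tendsto (fun s : ℝ => (s⁻¹ - s) / ‖y - s⁻¹ • e‖) (𝓝[>] 0) (𝓝 1) := by
  have hcont : ContinuousAt (fun s : ℝ => (1 - s ^ 2) / ‖s • y - e‖) 0 :=
    ContinuousAt.div (by fun_prop) (by fun_prop) (by simp [he])
  have hlim := hcont.tendsto.mono_left (nhdsWithin_le_nhds (s := Ioi 0))
  simp only [zero_smul, zero_sub, norm_neg, he, ne_eq, OfNat.ofNat_ne_zero, not_false_eq_true,
    zero_pow, sub_zero, div_one] at hlim
  refine hlim.congr' ?_
  filter_upwards [self_mem_nhdsWithin] with s (hs : 0 < s)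
  have hdist : ‖y - s⁻¹ • e‖ = s⁻¹ * ‖s • y - e‖ := by
    rw [← Real.norm_of_nonneg (inv_pos.2 hs).le, ← norm_smul, smul_sub, inv_smul_smul₀ hs.ne',
      Real.norm_of_nonneg (inv_pos.2 hs).le]
  rw [hdist, ← div_div]
  congr 1
  field_simp

/-- Spheres of centre `s⁻¹ • e` and radius `s⁻¹ - s` converge to the hyperplane orthogonal to `e` as
`s → 0`. -/
theorem inversion_inv_smul {s : ℝ} {y e : F} (hs : 0 < s) (he : ‖e‖ = 1) (hy : ‖s • y - e‖ ≠ 0) :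
    inversion (s⁻¹ • e) (s⁻¹ - s) y = ((1 - s ^ 2) ^ 2 / ‖s • y - e‖ ^ 2) • y +
      ((s * ‖y‖ ^ 2 - 2 * ⟪e, y⟫ + 2 * s - s ^ 3) / ‖s • y - e‖ ^ 2) • e := by
  have hdist : ‖y - s⁻¹ • e‖ = ‖s • y - e‖ / s := by
    rw [show y - s⁻¹ • e = s⁻¹ • (s • y - e) by rw [smul_sub, inv_smul_smul₀ hs.ne'],
      norm_smul, Real.norm_of_nonneg (inv_pos.2 hs).le, inv_mul_eq_div]
  have hratio : ((s⁻¹ - s) / ‖y - s⁻¹ • e‖) ^ 2 = (1 - s ^ 2) ^ 2 / ‖s • y - e‖ ^ 2 := by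
    rw [hdist]
    field_simp
  have hcoeff : (s * ‖y‖ ^ 2 - 2 * ⟪e, y⟫ + 2 * s - s ^ 3) / ‖s • y - e‖ ^ 2 =
      s⁻¹ * (1 - (1 - s ^ 2) ^ 2 / ‖s • y - e‖ ^ 2) := by
    have hexpand : ‖s • y - e‖ ^ 2 = s ^ 2 * ‖y‖ ^ 2 - 2 * s * ⟪e, y⟫ + 1 := by
      rw [norm_sub_sq_real, norm_smul, real_inner_smul_left, he, Real.norm_of_nonneg hs.le,
        real_inner_comm]
      ring
    field_simp
    rw [hexpand]
    ring
  rw [inversion_eq_add_smul, hratio, hcoeff]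
  module

theorem tendsto_inversion_reflection (y e : F) (he : ‖e‖ = 1) :
    Tendsto (fun s : ℝ => inversion (s⁻¹ • e) (s⁻¹ - s) y) (𝓝[>] 0)
      (𝓝 ((ℝ ∙ e)ᗮ.reflection y)) := by
  have hcont : ContinuousAt (fun s : ℝ => ((1 - s ^ 2) ^ 2 / ‖s • y - e‖ ^ 2) • y +
      ((s * ‖y‖ ^ 2 - 2 * ⟪e, y⟫ + 2 * s - s ^ 3) / ‖s • y - e‖ ^ 2) • e) 0 :=
    ((ContinuousAt.div (by fun_prop) (by fun_prop) (by simp [he])).smul continuousAt_const).add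
      ((ContinuousAt.div (by fun_prop) (by fun_prop) (by simp [he])).smul continuousAt_const)
  have hreflection : (ℝ ∙ e)ᗮ.reflection y = y + (-(2 * ⟪e, y⟫)) • e := by
    rw [Submodule.reflection_orthogonal_apply, Submodule.reflection_singleton_apply]
    simp only [he, RCLike.ofReal_real_eq_id, id_eq, one_pow, div_one, two_smul]
    module
  have hlim := hcont.tendsto.mono_left (nhdsWithin_le_nhds (s := Ioi 0))
  simp only [zero_smul, zero_sub, norm_neg, he, ne_eq, OfNat.ofNat_ne_zero, not_false_eq_true,
    zero_pow, sub_zero, one_pow, div_one, one_smul, zero_mul, mul_zero, add_zero] at hlim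
  rw [hreflection]
  have hne : ∀ᶠ s : ℝ in 𝓝 0, ‖s • y - e‖ ≠ 0 :=
    ContinuousAt.eventually_ne (by fun_prop) (by simp [he])
  refine hlim.congr' ?_
  filter_upwards [self_mem_nhdsWithin, nhdsWithin_le_nhds hne] with s (hs : 0 < s) hsy
  exact (inversion_inv_smul hs he hsy).symm

end Reflection

namespace IsSingularSolution

variable [FiniteDimensional ℝ F] (h : IsSingularSolution v a K c)

include h

theorem differentiableAt (hy : y ≠ 0) : DifferentiableAt ℝ v y :=
  (h.isSmoothNear hy).contDiffAt.differentiableAt (by simp)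

theorem continuousAt_radial (hy : y ≠ 0) : ContinuousAt (radial v a x) y := by
  have hfderiv : ContinuousAt (fderiv ℝ v) y :=
    ((h.isSmoothNear hy).contDiffAt.fderiv_right (m := ∞) (by simp)).continuousAt
  exact (continuousAt_const.mul (h.continuousAt hy)).add
    (hfderiv.clm_apply (continuousAt_id.sub continuousAt_const))

theorem exists_ball_radial_nonneg (hy : y ≠ 0) (hr : 0 < radial v a x y) : ∃ ρ > 0,
    (∀ z ∈ ball y ρ, DifferentiableAt ℝ v z) ∧ ∀ z ∈ ball y ρ, 0 ≤ radial v a x z := by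
  obtain ⟨ρ, hρ, hball⟩ := Metric.mem_nhds_iff.1
    (inter_mem (isOpen_ne.mem_nhds hy) ((h.continuousAt_radial hy).eventually (lt_mem_nhds hr)))
  exact ⟨ρ, hρ, fun z hz => h.differentiableAt (hball hz).1, fun z hz => (hball hz).2.le⟩

section SmallSpheres

theorem exists_le_apply_of_norm_mem_Icc {ε R : ℝ} (hε : 0 < ε) (hR : 0 < R) :
    ∃ μ > 0, ∀ y : F, ε ≤ ‖y‖ → ‖y‖ ≤ R → μ ≤ v y := by
  have hc := h.const_pos
  refine ⟨c * R ^ (-a), by positivity, fun y hyε hyR => ?_⟩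
  have hy : 0 < ‖y‖ := hε.trans_le hyε
  refine le_trans ?_ (h.le_apply y (norm_pos_iff.1 hy))
  gcongr ?_ * ?_
  exact Real.rpow_le_rpow_of_nonpos hy hyR (by linarith [h.weight_pos])

theorem eventually_kelvin_le {r ρ μ : ℝ} (hr₀ : 0 < r) (hr : r < ‖x‖) (hρ : 0 < ρ) (hμ : 0 < μ) :
    ∀ᶠ l in 𝓝[>] (0 : ℝ), ∀ y, l ≤ ‖y - x‖ → ρ ≤ ‖y - x‖ → kelvin v a x l y ≤ μ := by
  have ha := h.weight_pos
  obtain ⟨M, hM₀, hM⟩ := h.exists_le_of_norm_sub_le hr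
  have hlim : Tendsto (fun l : ℝ => (l / ρ) ^ (2 * a) * M) (𝓝[>] 0) (𝓝 0) := by
    have hcont : ContinuousAt (fun l : ℝ => (l / ρ) ^ (2 * a) * M) 0 :=
      (ContinuousAt.rpow_const (by fun_prop) (Or.inr (by positivity))).mul continuousAt_const
    have hlim₀ := hcont.tendsto
    rw [zero_div, Real.zero_rpow (by positivity), zero_mul] at hlim₀
    exact hlim₀.mono_left nhdsWithin_le_nhds
  filter_upwards [hlim.eventually (gt_mem_nhds hμ), Ioo_mem_nhdsGT hr₀] with l hlμ hl y hly hρy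
  have hl₀ : 0 < l := hl.1
  calc kelvin v a x l y ≤ (l / ‖y - x‖) ^ (2 * a) * M := kelvin_le_rpow_mul hM hl.1 hl.2.le hly
    _ ≤ (l / ρ) ^ (2 * a) * M := by gcongr
    _ ≤ μ := hlμ.le

theorem eventually_dominatesKelvin_nhdsGT_zero (hx : x ≠ 0) :
    ∀ᶠ l in 𝓝[>] (0 : ℝ), DominatesKelvin v a x l := by
  obtain ⟨r, hr₀, hr⟩ := exists_between (norm_pos_iff.2 hx)
  have hradial : 0 < radial v a x x := by
    rw [radial, sub_self, map_zero, add_zero]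
    exact mul_pos h.weight_pos (h.pos x hx)
  obtain ⟨ρ, hρ, hdiff, hball⟩ := h.exists_ball_radial_nonneg hx hradial
  obtain ⟨ε, hε, R, hR, δ, -, hannulus⟩ := h.exists_annulus hr
  obtain ⟨μ, hμ, hμv⟩ := h.exists_le_apply_of_norm_mem_Icc hε hR
  filter_upwards [h.eventually_kelvin_le hr₀ hr hρ hμ, Ioo_mem_nhdsGT hr₀] with l hfar hl y hy hly
  rcases lt_or_ge ‖y - x‖ ρ with hyρ | hyρ
  · exact kelvin_le_of_radial_nonneg (convex_ball x ρ) hdiff hball hl.1 hly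
      (mem_ball_iff_norm.2 hyρ)
      (mem_ball_iff_norm.2 (((norm_inversion_sub_le hl.1 hly).trans hly).trans_lt hyρ))
  · by_contra! hlt
    obtain ⟨hyε, hyR⟩ := (hannulus l hl.1 hl.2.le y hy hly).2 hlt.le
    exact hlt.not_ge ((hfar y hly hyρ).trans (hμv y hyε.le hyR.le))

end SmallSpheres

section OpenClosed

/-- The constant `δ` is a substitute for the Hopf boundary point lemma. -/
theorem radial_pos_of_kelvin_sub_const_le {δ : ℝ} (hδ : 0 < δ) (hl : 0 < l) (hy₀ : y ≠ 0)
    (hy : ‖y - x‖ = l) (hle : ∀ᶠ z in 𝓝 y, l ≤ ‖z - x‖ →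
      kelvin (fun w => v w - δ) a x l z ≤ v z - δ) : 0 < radial v a x y := by
  have hradial := radial_nonneg_of_kelvin_le hl hy ((h.differentiableAt hy₀).sub_const δ) hle
  rw [radial_sub_const] at hradial
  linarith [mul_pos h.weight_pos hδ]

theorem eventually_kelvin_le_of_lt (hl : 0 < l) (hlx : l < ‖x‖) (hy₀ : y ≠ 0) (hy : l ≤ ‖y - x‖)
    (hlt : kelvin v a x l y < v y) : ∀ᶠ q : ℝ × F in 𝓝 (l, y), kelvin v a x q.1 q.2 ≤ v q.2 := by
  have hv : ContinuousAt (fun q : ℝ × F => v q.2) (l, y) :=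
    ContinuousAt.comp (f := Prod.snd) (h.continuousAt hy₀) continuousAt_snd
  filter_upwards [(h.continuousAt_kelvin hl hlx hy).eventually_lt hv hlt] with q hq using hq.le

theorem eventually_kelvin_le_of_radial_pos (hl : 0 < l) (hy₀ : y ≠ 0) (hy : ‖y - x‖ = l)
    (hr : 0 < radial v a x y) :
    ∀ᶠ q : ℝ × F in 𝓝 (l, y), q.1 ≤ ‖q.2 - x‖ → kelvin v a x q.1 q.2 ≤ v q.2 := by
  obtain ⟨ρ, hρ, hdiff, hball⟩ := h.exists_ball_radial_nonneg hy₀ hr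
  have hinv : Tendsto (fun q : ℝ × F => inversion x q.1 q.2) (𝓝 (l, y)) (𝓝 y) := by
    have hcont := continuousAt_inversion_uncurry (l := l) (ne_of_le_norm_sub hl hy.ge)
    rwa [ContinuousAt, inversion_of_mem_sphere (mem_sphere_iff_norm.2 hy)] at hcont
  filter_upwards [continuousAt_fst.eventually (lt_mem_nhds hl),
    continuousAt_snd.eventually (ball_mem_nhds y hρ), hinv.eventually (ball_mem_nhds y hρ)]
    with q hq hqball hqinv hqx
  exact kelvin_le_of_radial_nonneg (convex_ball y ρ) hdiff hball hq hqx hqball hqinv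

theorem eventually_dominatesKelvin (hl : 0 < l) (hlx : l < ‖x‖) (hB : DominatesKelvin v a x l) :
    ∀ᶠ s in 𝓝 l, DominatesKelvin v a x s := by
  obtain ⟨r, hlr, hr⟩ := exists_between hlx
  obtain ⟨ε, hε, R, -, δ, hδ, hannulus⟩ := h.exists_annulus hr
  have hbarrier (w : F) (hwε : ε ≤ ‖w‖) (hwR : ‖w‖ ≤ R) (hlw : l ≤ ‖w - x‖) :
      kelvin (fun z => v z - δ) a x l w ≤ v w - δ :=
    h.kelvin_sub_const_le_of_annulus hε hδ.le hl hlx hB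
      (fun y hy hly => (hannulus l hl hlr.le y hy hly).1) hwε hwR hlw
  have hcompact : IsCompact (closedBall (0 : F) R ∩ {y | ε ≤ ‖y‖}) :=
    (isCompact_closedBall _ _).inter_right (isClosed_le continuous_const continuous_norm)
  have hlocal : ∀ z ∈ closedBall (0 : F) R ∩ {y | ε ≤ ‖y‖}, ∀ᶠ q : ℝ × F in 𝓝 (l, z),
      q.1 ≤ ‖q.2 - x‖ → kelvin v a x q.1 q.2 ≤ v q.2 := by
    rintro z ⟨hzR, hzε : ε ≤ ‖z‖⟩
    rw [mem_closedBall_zero_iff] at hzR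
    have hz : z ≠ 0 := norm_pos_iff.1 (hε.trans_le hzε)
    rcases lt_trichotomy ‖z - x‖ l with hzl | hzl | hzl
    · have hdist : ContinuousAt (fun q : ℝ × F => ‖q.2 - x‖) (l, z) := by fun_prop
      filter_upwards [hdist.eventually_lt continuousAt_fst hzl] with q hq hqx
      exact absurd hqx hq.not_ge
    · have hinterior := (hannulus l hl hlr.le z hz hzl.ge).2 (kelvin_of_mem_sphere hl hzl).ge
      refine h.eventually_kelvin_le_of_radial_pos hl hz hzl
        (h.radial_pos_of_kelvin_sub_const_le hδ hl hz hzl ?_)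
      filter_upwards [continuous_norm.continuousAt.eventually
        (Ioo_mem_nhds hinterior.1 hinterior.2)] with w hw using hbarrier w hw.1.le hw.2.le
    · have hlt : kelvin v a x l z < v z := by
        have hgap := hbarrier z hzε hzR hzl.le
        rw [kelvin_sub_const] at hgap
        have hone := kelvin_one_lt_one h.weight_pos hl hzl
        nlinarith
      filter_upwards [h.eventually_kelvin_le_of_lt hl hlx hz hzl.le hlt] with q hq _ using hq
  filter_upwards [hcompact.eventually_forall_of_forall_eventually
    (P := fun s y => s ≤ ‖y - x‖ → kelvin v a x s y ≤ v y) hlocal, Ioo_mem_nhds hl hlr]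
    with s hs hsr y hy hsy
  by_contra! hlt
  obtain ⟨hyε, hyR⟩ := (hannulus s hsr.1 hsr.2.le y hy hsy).2 hlt.le
  exact hlt.not_ge (hs y ⟨mem_closedBall_zero_iff.2 hyR.le, hyε.le⟩ hsy)

theorem eventually_not_dominatesKelvin (hl : 0 < l) (hlx : l < ‖x‖)
    (hB : ¬ DominatesKelvin v a x l) : ∀ᶠ s in 𝓝 l, ¬ DominatesKelvin v a x s := by
  simp only [DominatesKelvin, not_forall, not_le] at hB
  obtain ⟨y, hy, hly, hlt⟩ := hB
  have hly : l < ‖y - x‖ :=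
    hly.lt_of_ne fun heq => hlt.ne' (kelvin_of_mem_sphere hl heq.symm)
  have hcont : ContinuousAt (fun s => kelvin v a x s y) l :=
    ContinuousAt.comp (f := fun s : ℝ => (s, y)) (h.continuousAt_kelvin hl hlx hly.le)
      (by fun_prop)
  filter_upwards [hcont.eventually (lt_mem_nhds hlt), gt_mem_nhds hly] with s hs hsy hB
  exact hs.not_ge (hB y hy hsy.le)

end OpenClosed

theorem dominatesKelvin (hl : 0 < l) (hlx : l < ‖x‖) : DominatesKelvin v a x l := by
  have hx : x ≠ 0 := norm_pos_iff.1 (hl.trans hlx)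
  have hnonempty : (Ioo 0 ‖x‖ ∩ interior {s | DominatesKelvin v a x s}).Nonempty := by
    obtain ⟨s, hB, hs⟩ := ((h.eventually_dominatesKelvin_nhdsGT_zero hx).and
      (Ioo_mem_nhdsGT (norm_pos_iff.2 hx))).exists
    exact ⟨s, hs, mem_interior_iff_mem_nhds.2 (h.eventually_dominatesKelvin hs.1 hs.2 hB)⟩
  refine interior_subset <| isPreconnected_Ioo.subset_left_of_subset_union isOpen_interior
    isOpen_interior (disjoint_compl_right.mono interior_subset interior_subset)
    (fun s hs => ?_) hnonempty ⟨hl, hlx⟩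
  by_cases hB : DominatesKelvin v a x s
  · exact Or.inl (mem_interior_iff_mem_nhds.2 (h.eventually_dominatesKelvin hs.1 hs.2 hB))
  · exact Or.inr (mem_interior_iff_mem_nhds.2 (h.eventually_not_dominatesKelvin hs.1 hs.2 hB))

theorem apply_reflection_le {e : F} (he : ‖e‖ = 1) (hye : ⟪e, y⟫ < 0) :
    v ((ℝ ∙ e)ᗮ.reflection y) ≤ v y := by
  have ha := h.weight_pos
  have hy : y ≠ 0 := by
    rintro rfl
    simp at hye
  have hlim : Tendsto (fun s : ℝ => kelvin v a (s⁻¹ • e) (s⁻¹ - s) y) (𝓝[>] 0)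
      (𝓝 (1 ^ (2 * a) * v ((ℝ ∙ e)ᗮ.reflection y))) :=
    ((tendsto_div_norm_sub_inv_smul y e he).rpow_const (Or.inr (by positivity))).mul
      ((h.continuousAt (by simpa using hy)).tendsto.comp (tendsto_inversion_reflection y e he))
  rw [Real.one_rpow, one_mul] at hlim
  refine le_of_tendsto hlim ?_
  filter_upwards [Ioo_mem_nhdsGT (one_pos (α := ℝ))] with s ⟨hs₀, hs₁⟩
  have hs : 1 < s⁻¹ := (one_lt_inv₀ hs₀).2 hs₁
  have hnorm : ‖s⁻¹ • e‖ = s⁻¹ := by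
    rw [norm_smul, he, mul_one, Real.norm_of_nonneg (by positivity)]
  have hdist : s⁻¹ ≤ ‖y - s⁻¹ • e‖ := by
    refine le_of_sq_le_sq ?_ (norm_nonneg _)
    rw [norm_sub_sq_real, hnorm, real_inner_smul_right, real_inner_comm]
    nlinarith [sq_nonneg ‖y‖]
  exact h.dominatesKelvin (by linarith) (by rw [hnorm]; linarith) y hy (by linarith)

theorem apply_le_of_norm_eq {z : F} (hyz : ‖y‖ = ‖z‖) : v z ≤ v y := by
  rcases eq_or_ne y z with rfl | hne
  · exact le_rfl
  have hd : 0 < ‖z - y‖ := norm_pos_iff.2 (sub_ne_zero.2 hne.symm)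
  have hspan : (ℝ ∙ (‖z - y‖⁻¹ • (z - y))) = ℝ ∙ (y - z) := by
    rw [Submodule.span_singleton_smul_eq (IsUnit.mk0 _ (inv_ne_zero hd.ne')), ← neg_sub,
      ← Submodule.span_neg, Set.neg_singleton, neg_neg]
  have hinner : ⟪z - y, y⟫ < 0 := by
    have hexpand := norm_add_sq_real (z - y) y
    rw [sub_add_cancel, hyz] at hexpand
    nlinarith
  have hle := h.apply_reflection_le (y := y) (e := ‖z - y‖⁻¹ • (z - y))
    (by rw [norm_smul, norm_inv, norm_norm, inv_mul_cancel₀ hd.ne'])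
    (by rw [real_inner_smul_left]; exact mul_neg_of_pos_of_neg (inv_pos.2 hd) hinner)
  simpa only [hspan, Submodule.reflection_sub hyz] using hle

theorem eq_of_norm_eq {z : F} (hyz : ‖y‖ = ‖z‖) : v y = v z :=
  le_antisymm (h.apply_le_of_norm_eq hyz.symm) (h.apply_le_of_norm_eq hyz)

end IsSingularSolution

end Coord

open Coord

/-! ### The charts of the circle and of the sphere -/

section CircleCharts

variable {T : ℝ} [Fact (0 < T)]

theorem exists_extChartAt_coe_eventuallyEq (t : ℝ) :
    ∃ c, (fun s : ℝ => extChartAt 𝓘(ℝ, ℝ) (t : AddCircle T) s) =ᶠ[𝓝 t] fun s => s + c :=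
  AddCircle.equivIco_coe_eventuallyEq T _ t (mem_chart_source ℝ (t : AddCircle T))

theorem hasMFDerivAt_coe_addCircle (t : ℝ) :
    HasMFDerivAt 𝓘(ℝ, ℝ) 𝓘(ℝ, ℝ) (fun s : ℝ => (s : AddCircle T)) t
      (ContinuousLinearMap.id ℝ ℝ) := by
  obtain ⟨c, hc⟩ := exists_extChartAt_coe_eventuallyEq (T := T) t
  refine ⟨(AddCircle.continuous_mk' T).continuousAt, ?_⟩
  simp only [mfld_simps]
  exact (((hasFDerivAt_id t).add_const c).congr_of_eventuallyEq hc).hasFDerivWithinAt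

theorem contMDiff_coe_addCircle :
    ContMDiff 𝓘(ℝ, ℝ) 𝓘(ℝ, ℝ) ∞ (fun s : ℝ => (s : AddCircle T)) := by
  intro t
  obtain ⟨c, hc⟩ := exists_extChartAt_coe_eventuallyEq (T := T) t
  have hadd : ContDiffAt ℝ ∞ (fun s : ℝ => s + c) t := contDiffAt_id.add contDiffAt_const
  refine contMDiffAt_iff.2 ⟨(AddCircle.continuous_mk' T).continuousAt, ?_⟩
  simp only [mfld_simps]
  exact (hadd.congr_of_eventuallyEq hc).contDiffWithinAt

theorem extChartAt_addCircle_symm_apply (x : AddCircle T) (t : ℝ) :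
    (extChartAt 𝓘(ℝ, ℝ) x).symm t = (t : AddCircle T) := rfl

theorem coe_extChartAt_addCircle (x : AddCircle T) :
    ((extChartAt 𝓘(ℝ, ℝ) x x : ℝ) : AddCircle T) = x := by
  rw [← extChartAt_addCircle_symm_apply x]
  exact extChartAt_to_inv x

end CircleCharts

theorem mdifferentiableAt_extChartAt_symm {E : Type*} [NormedAddCommGroup E] [NormedSpace ℝ E]
    {H : Type*} [TopologicalSpace H] {I : ModelWithCorners ℝ E H} [I.Boundaryless]
    {M : Type*} [TopologicalSpace M] [ChartedSpace H M] [IsManifold I 1 M]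
    {p : M} {q : E} (hq : q ∈ (extChartAt I p).target) :
    MDifferentiableAt 𝓘(ℝ, E) I (extChartAt I p).symm q := by
  rw [← mdifferentiableWithinAt_univ, ← I.range_eq_univ]
  exact mdifferentiableWithinAt_extChartAt_symm hq

section Stereographic

variable {F : Type*} [NormedAddCommGroup F]

/-- The exponent `f` for which `e^{2f} ⟪·, ·⟫` is the round metric in the stereographic coordinates
used by the charts of the sphere, which map the equator to the sphere of radius `2`. -/
def stereographicExponent (w : F) : ℝ := Real.log 4 - Real.log (‖w‖ ^ 2 + 4)

theorem norm_sq_add_four_ne_zero (w : F) : ‖w‖ ^ 2 + 4 ≠ 0 := by positivity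

theorem exp_two_mul_stereographicExponent (w : F) :
    Real.exp (2 * stereographicExponent w) = 16 / (‖w‖ ^ 2 + 4) ^ 2 := by
  have hpos : 0 < ‖w‖ ^ 2 + 4 := by positivity
  rw [stereographicExponent, ← Real.log_div (by norm_num) hpos.ne', two_mul, Real.exp_add,
    Real.exp_log (by positivity), div_mul_div_comm]
  ring

variable [InnerProductSpace ℝ F]

theorem hasFDerivAt_norm_sq_add_four (w : F) :
    HasFDerivAt (fun w : F => ‖w‖ ^ 2 + 4) (2 • innerSL ℝ w) w :=
  (hasStrictFDerivAt_norm_sq w).hasFDerivAt.add_const 4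

theorem hasFDerivAt_inv_norm_sq_add_four (w : F) :
    HasFDerivAt (fun w : F => (‖w‖ ^ 2 + 4)⁻¹)
      (-((‖w‖ ^ 2 + 4) ^ 2)⁻¹ • (2 • innerSL ℝ w)) w :=
  (hasDerivAt_inv (norm_sq_add_four_ne_zero w)).comp_hasFDerivAt w (hasFDerivAt_norm_sq_add_four w)

theorem isSmoothNear_stereographicExponent (w : F) : IsSmoothNear stereographicExponent w :=
  isSmoothNear_of_contDiff <| contDiff_const.sub <|
    ((contDiff_norm_sq ℝ).add contDiff_const).log norm_sq_add_four_ne_zero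

variable [FiniteDimensional ℝ F]

theorem gradient_stereographicExponent (w : F) :
    gradient stereographicExponent w = -((2 * (‖w‖ ^ 2 + 4)⁻¹) • w) := by
  refine gradient_eq_of_hasFDerivAt (((hasFDerivAt_norm_sq_add_four w).log
    (norm_sq_add_four_ne_zero w)).const_sub (Real.log 4)) fun z => ?_
  simp [real_inner_smul_left, inner_neg_left]
  ring

theorem fderiv_gradient_stereographicExponent (w z : F) :
    fderiv ℝ (gradient stereographicExponent) w z = -((2 * (‖w‖ ^ 2 + 4)⁻¹) • z) +
      (4 * ⟪w, z⟫ * (‖w‖ ^ 2 + 4)⁻¹ ^ 2) • w := by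
  have hderiv : HasFDerivAt (fun w : F => -((2 * (‖w‖ ^ 2 + 4)⁻¹) • w)) _ w :=
    (((hasFDerivAt_inv_norm_sq_add_four w).const_mul 2).smul (hasFDerivAt_id w)).neg
  rw [funext gradient_stereographicExponent, hderiv.fderiv]
  simp
  module

theorem schouten_stereographicExponent (w : F) :
    schouten stereographicExponent w =
      (-(8 / (‖w‖ ^ 2 + 4) ^ 2)) • ContinuousLinearMap.id ℝ F := by
  ext1 z
  have hcoeff : -(8 / (‖w‖ ^ 2 + 4) ^ 2) =
      -(2 * (‖w‖ ^ 2 + 4)⁻¹) + 2 * (‖w‖ ^ 2 * (‖w‖ ^ 2 + 4)⁻¹ ^ 2) := by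
    field_simp
    ring
  rw [schouten_apply, fderiv_gradient_stereographicExponent, gradient_stereographicExponent]
  simp only [inner_neg_left, inner_neg_right, real_inner_smul_left, real_inner_smul_right,
    _root_.smul_apply, ContinuousLinearMap.id_apply]
  rw [real_inner_self_eq_norm_sq, hcoeff]
  module

theorem ricci_conf_stereographicExponent (x w z : F) :
    ricci (conf stereographicExponent) x w z =
      ((Module.finrank ℝ F : ℝ) - 1) * conf stereographicExponent x w z := by
  rw [ricci_conf (isSmoothNear_stereographicExponent x), schouten_stereographicExponent,
    conf_apply, exp_two_mul_stereographicExponent, map_smul, traceL_id, _root_.smul_apply,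
    ContinuousLinearMap.id_apply, real_inner_smul_left, smul_eq_mul]
  ring

end Stereographic

section SphereCharts

variable {k : ℕ}

instance : IsManifold (𝓡 k) ∞ (UnitSphere k) := IsManifold.of_le (n := ω) le_top

/-- The inverse of the preferred chart of the unit sphere at `ξ`, with values in the ambient
space. -/
def sphereParam (ξ : UnitSphere k) (w : EuclideanSpace ℝ (Fin k)) :
    EuclideanSpace ℝ (Fin (k + 1)) := ((extChartAt (𝓡 k) ξ).symm w : UnitSphere k)

theorem norm_sphereParam (ξ : UnitSphere k) (w : EuclideanSpace ℝ (Fin k)) :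
    ‖sphereParam ξ w‖ = 1 := norm_eq_of_mem_sphere _

theorem exists_sphereParam_eq (ξ : UnitSphere k) :
    ∃ (U : EuclideanSpace ℝ (Fin k) →ₗᵢ[ℝ] EuclideanSpace ℝ (Fin (k + 1)))
      (e : EuclideanSpace ℝ (Fin (k + 1))), ‖e‖ = 1 ∧ (∀ w, ⟪U w, e⟫ = 0) ∧
      sphereParam ξ = fun w => e + (‖w‖ ^ 2 + 4)⁻¹ • ((4 : ℝ) • U w - (8 : ℝ) • e) := by
  have := Fact.mk (@finrank_euclideanSpace_fin ℝ _ (k + 1))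
  let e : EuclideanSpace ℝ (Fin (k + 1)) := ((-ξ : UnitSphere k) : EuclideanSpace ℝ (Fin (k + 1)))
  let W : (ℝ ∙ e)ᗮ ≃ₗᵢ[ℝ] EuclideanSpace ℝ (Fin k) :=
    (OrthonormalBasis.fromOrthogonalSpanSingleton k (ne_zero_of_mem_unit_sphere (-ξ))).repr
  refine ⟨(Submodule.subtypeₗᵢ _).comp W.symm.toLinearIsometry, e, norm_eq_of_mem_sphere (-ξ),
    fun w => Submodule.mem_orthogonal_singleton_iff_inner_left.1 (W.symm w).2, funext fun w => ?_⟩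
  have hnorm : ‖(W.symm w : EuclideanSpace ℝ (Fin (k + 1)))‖ = ‖w‖ := W.symm.norm_map w
  have hcoeff : (‖w‖ ^ 2 + 4)⁻¹ * (‖w‖ ^ 2 - 4) = 1 - (‖w‖ ^ 2 + 4)⁻¹ * 8 := by
    field_simp
    ring
  calc sphereParam ξ w
      = (‖w‖ ^ 2 + 4)⁻¹ • (4 : ℝ) • (W.symm w : EuclideanSpace ℝ (Fin (k + 1))) +
        (‖w‖ ^ 2 + 4)⁻¹ • (‖w‖ ^ 2 - 4) • e := by
        rw [← hnorm]
        exact stereographic'_symm_apply (-ξ) w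
    _ = e + (‖w‖ ^ 2 + 4)⁻¹ • ((4 : ℝ) • (W.symm w : EuclideanSpace ℝ (Fin (k + 1))) -
        (8 : ℝ) • e) := by
        rw [smul_smul _ (‖w‖ ^ 2 - 4), hcoeff]
        module

theorem contDiff_sphereParam (ξ : UnitSphere k) : ContDiff ℝ ∞ (sphereParam ξ) := by
  obtain ⟨U, e, -, -, hparam⟩ := exists_sphereParam_eq ξ
  rw [hparam]
  exact contDiff_const.add ((((contDiff_norm_sq ℝ).add contDiff_const).inv
    norm_sq_add_four_ne_zero).smul ((U.contDiff.const_smul (4 : ℝ)).sub contDiff_const))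

theorem inner_fderiv_sphereParam (ξ : UnitSphere k) (w a b : EuclideanSpace ℝ (Fin k)) :
    ⟪fderiv ℝ (sphereParam ξ) w a, fderiv ℝ (sphereParam ξ) w b⟫ =
      16 / (‖w‖ ^ 2 + 4) ^ 2 * ⟪a, b⟫ := by
  obtain ⟨U, e, he, hU, hparam⟩ := exists_sphereParam_eq ξ
  have hfderiv (a) : fderiv ℝ (sphereParam ξ) w a = (‖w‖ ^ 2 + 4)⁻¹ • ((4 : ℝ) • U a) -
      (2 * ⟪w, a⟫ / (‖w‖ ^ 2 + 4) ^ 2) • ((4 : ℝ) • U w - (8 : ℝ) • e) := by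
    have hlinear : HasFDerivAt (fun w => (4 : ℝ) • U w - (8 : ℝ) • e)
        ((4 : ℝ) • U.toContinuousLinearMap) w :=
      (U.toContinuousLinearMap.hasFDerivAt.const_smul (4 : ℝ)).sub_const ((8 : ℝ) • e)
    have hderiv : HasFDerivAt
        (fun w => e + (‖w‖ ^ 2 + 4)⁻¹ • ((4 : ℝ) • U w - (8 : ℝ) • e)) _ w :=
      ((hasFDerivAt_inv_norm_sq_add_four w).smul hlinear).const_add e
    rw [hparam, hderiv.fderiv]
    simp
    module
  have hU' (a) : ⟪e, U a⟫ = 0 := by rw [real_inner_comm, hU]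
  rw [hfderiv, hfderiv]
  simp only [inner_sub_left, inner_sub_right, real_inner_smul_left, real_inner_smul_right,
    LinearIsometry.inner_map_map, hU, hU', real_inner_self_eq_norm_sq, he, real_inner_comm w]
  field_simp
  ring

theorem mem_target_extChartAt_unitSphere (ξ : UnitSphere k) (w : EuclideanSpace ℝ (Fin k)) :
    w ∈ (extChartAt (𝓡 k) ξ).target := by
  have := Fact.mk (@finrank_euclideanSpace_fin ℝ _ (k + 1))
  have htarget : (extChartAt (𝓡 k) ξ).target = univ := by
    simp only [mfld_simps]
    exact stereographic'_target (-ξ)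
  exact htarget ▸ mem_univ w

theorem contMDiff_coe_unitSphere :
    ContMDiff (𝓡 k) 𝓘(ℝ, EuclideanSpace ℝ (Fin (k + 1))) ∞
      (fun ξ : UnitSphere k => (ξ : EuclideanSpace ℝ (Fin (k + 1)))) :=
  have := Fact.mk (@finrank_euclideanSpace_fin ℝ _ (k + 1))
  contMDiff_coe_sphere

theorem mfderiv_coe_mfderiv_extChartAt_symm (ξ : UnitSphere k) (w a : EuclideanSpace ℝ (Fin k)) :
    mfderiv (𝓡 k) 𝓘(ℝ, EuclideanSpace ℝ (Fin (k + 1)))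
      (fun ξ : UnitSphere k => (ξ : EuclideanSpace ℝ (Fin (k + 1))))
      ((extChartAt (𝓡 k) ξ).symm w)
      (mfderiv 𝓘(ℝ, EuclideanSpace ℝ (Fin k)) (𝓡 k) (extChartAt (𝓡 k) ξ).symm w a) =
      fderiv ℝ (sphereParam ξ) w a := by
  have hcomp := mfderiv_comp w
    (contMDiff_coe_unitSphere.mdifferentiable (by simp) ((extChartAt (𝓡 k) ξ).symm w))
    (mdifferentiableAt_extChartAt_symm (mem_target_extChartAt_unitSphere ξ w))
  rw [← mfderiv_eq_fderiv]
  exact (congrArg (fun A => A a) hcomp).symm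

theorem roundMetric_inChart (ξ : UnitSphere k) :
    (roundMetric k).inChart ξ = conf stereographicExponent := by
  funext w
  ext a b
  rw [conf_apply, exp_two_mul_stereographicExponent, ← inner_fderiv_sphereParam ξ]
  exact congrArg₂ (fun p q : EuclideanSpace ℝ (Fin (k + 1)) => ⟪p, q⟫)
    (mfderiv_coe_mfderiv_extChartAt_symm ξ w a) (mfderiv_coe_mfderiv_extChartAt_symm ξ w b)

theorem isEinstein_roundMetric (hk : k ≠ 0) : IsEinstein (roundMetric k) ((k : ℝ) * (k - 1)) := by
  intro p w z
  rw [roundMetric_inChart, ricci_conf_stereographicExponent, finrank_euclideanSpace_fin]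
  field_simp

end SphereCharts

/-! ### Polar coordinates on the punctured space -/

section Polar

variable {k : ℕ} (ξ : UnitSphere k)

theorem hasFDerivAt_sphereParam (w : EuclideanSpace ℝ (Fin k)) :
    HasFDerivAt (sphereParam ξ) (fderiv ℝ (sphereParam ξ) w) w :=
  ((contDiff_sphereParam ξ).differentiable (by simp) w).hasFDerivAt

theorem inner_sphereParam_fderiv (w a : EuclideanSpace ℝ (Fin k)) :
    ⟪sphereParam ξ w, fderiv ℝ (sphereParam ξ) w a⟫ = 0 := by
  have hsq : (fun w => ‖sphereParam ξ w‖ ^ 2) = fun _ => 1 :=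
    funext fun w => by rw [norm_sphereParam, one_pow]
  have hderiv := (hasFDerivAt_sphereParam ξ w).norm_sq
  rw [hsq] at hderiv
  simpa using congrArg (fun A => A a) (hderiv.unique (hasFDerivAt_const (1 : ℝ) w))

/-- Polar coordinates `(t, w) ↦ e^t ξ(w)` of the punctured space, with logarithmic radius `t` and
the stereographic parametrisation `sphereParam` of the unit sphere. -/
def polar (q : ℝ × EuclideanSpace ℝ (Fin k)) : EuclideanSpace ℝ (Fin (k + 1)) :=
  Real.exp q.1 • sphereParam ξ q.2

theorem norm_polar (q : ℝ × EuclideanSpace ℝ (Fin k)) : ‖polar ξ q‖ = Real.exp q.1 := by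
  rw [polar, norm_smul, norm_sphereParam, mul_one, Real.norm_of_nonneg (Real.exp_pos _).le]

theorem polar_ne_zero (q : ℝ × EuclideanSpace ℝ (Fin k)) : polar ξ q ≠ 0 :=
  norm_pos_iff.1 (norm_polar ξ q ▸ Real.exp_pos _)

theorem contDiff_polar : ContDiff ℝ ∞ (polar ξ) :=
  (Real.contDiff_exp.comp contDiff_fst).smul ((contDiff_sphereParam ξ).comp contDiff_snd)

theorem fderiv_polar (q a : ℝ × EuclideanSpace ℝ (Fin k)) :
    fderiv ℝ (polar ξ) q a =
      Real.exp q.1 • (a.1 • sphereParam ξ q.2 + fderiv ℝ (sphereParam ξ) q.2 a.2) := by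
  have hexp : HasFDerivAt (fun q : ℝ × EuclideanSpace ℝ (Fin k) => Real.exp q.1) _ q :=
    (hasFDerivAt_fst (𝕜 := ℝ) (p := q)).exp
  have hpolar : HasFDerivAt (polar ξ) _ q :=
    hexp.smul ((hasFDerivAt_sphereParam ξ q.2).comp q hasFDerivAt_snd)
  rw [hpolar.fderiv]
  simp
  module

theorem inner_fderiv_polar (q a b : ℝ × EuclideanSpace ℝ (Fin k)) :
    ⟪fderiv ℝ (polar ξ) q a, fderiv ℝ (polar ξ) q b⟫ = Real.exp q.1 ^ 2 *
      (a.1 * b.1 + ⟪fderiv ℝ (sphereParam ξ) q.2 a.2, fderiv ℝ (sphereParam ξ) q.2 b.2⟫) := by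
  have hortho (a) : ⟪fderiv ℝ (sphereParam ξ) q.2 a, sphereParam ξ q.2⟫ = 0 := by
    rw [real_inner_comm, inner_sphereParam_fderiv]
  rw [fderiv_polar, fderiv_polar]
  simp only [inner_add_left, inner_add_right, real_inner_smul_left, real_inner_smul_right,
    inner_sphereParam_fderiv, hortho]
  rw [real_inner_self_eq_norm_sq, norm_sphereParam]
  ring

theorem injective_fderiv_polar (q : ℝ × EuclideanSpace ℝ (Fin k)) :
    Function.Injective (fderiv ℝ (polar ξ) q) := by
  refine (injective_iff_map_eq_zero _).2 fun a ha => ?_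
  have hnorm := inner_fderiv_polar ξ q a a
  rw [ha, inner_zero_left, inner_fderiv_sphereParam, real_inner_self_eq_norm_sq, eq_comm,
    mul_eq_zero_iff_left (by positivity), add_eq_zero_iff_of_nonneg (mul_self_nonneg _)
    (by positivity), mul_self_eq_zero, mul_eq_zero_iff_left (by positivity)] at hnorm
  exact Prod.ext hnorm.1 (by simpa using hnorm.2)

theorem isLocalDiffeoNear_polar (q : ℝ × EuclideanSpace ℝ (Fin k)) :
    IsLocalDiffeoNear (polar ξ) q := by
  refine Eventually.of_forall fun q => ⟨(contDiff_polar ξ).contDiffAt, ?_⟩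
  have hdim : Module.finrank ℝ (ℝ × EuclideanSpace ℝ (Fin k)) =
      Module.finrank ℝ (EuclideanSpace ℝ (Fin (k + 1))) := by
    simp [add_comm]
  exact ⟨(LinearEquiv.ofInjectiveOfFinrankEq _ (injective_fderiv_polar ξ q)
    hdim).toContinuousLinearEquiv, rfl⟩

theorem isLocalDiffeoNear_polar_add (q b : ℝ × EuclideanSpace ℝ (Fin k)) :
    IsLocalDiffeoNear (fun q => polar ξ (q + b)) q := by
  refine Eventually.of_forall fun q =>
    ⟨((contDiff_polar ξ).comp (contDiff_id.add contDiff_const)).contDiffAt, ?_⟩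
  rw [fderiv_comp_add_right]
  exact (isLocalDiffeoNear_polar ξ (q + b)).self_of_nhds.2

end Polar

section CylinderCharts

variable {k : ℕ} {T : ℝ} [Fact (0 < T)] (p : AddCircle T × UnitSphere k)

theorem extChartAt_cylinder_symm_apply (q : ℝ × EuclideanSpace ℝ (Fin k)) :
    (extChartAt (cylinderModel k) p).symm q =
      ((q.1 : AddCircle T), (extChartAt (𝓡 k) p.2).symm q.2) := by
  rw [extChartAt_prod]
  rfl

theorem mfderiv_fst_mfderiv_extChartAt_symm {q : ℝ × EuclideanSpace ℝ (Fin k)}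
    (hq : q ∈ (extChartAt (cylinderModel k) p).target) (a : ℝ × EuclideanSpace ℝ (Fin k)) :
    mfderiv (cylinderModel k) 𝓘(ℝ, ℝ) (Prod.fst : AddCircle T × UnitSphere k → AddCircle T)
      ((extChartAt (cylinderModel k) p).symm q)
      (mfderiv 𝓘(ℝ, ℝ × EuclideanSpace ℝ (Fin k)) (cylinderModel k)
        (extChartAt (cylinderModel k) p).symm q a) = a.1 := by
  have : IsManifold (cylinderModel k) 1 (AddCircle T × UnitSphere k) :=
    IsManifold.of_le (n := ∞) (by simp)
  have hchain := mfderiv_comp q (mdifferentiableAt_fst (I := 𝓘(ℝ, ℝ)) (I' := 𝓡 k)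
    (x := (extChartAt (cylinderModel k) p).symm q)) (mdifferentiableAt_extChartAt_symm hq)
  have hcomp : (Prod.fst : AddCircle T × UnitSphere k → AddCircle T) ∘
      (extChartAt (cylinderModel k) p).symm = (fun s : ℝ => (s : AddCircle T)) ∘ Prod.fst :=
    funext fun q => congrArg Prod.fst (extChartAt_cylinder_symm_apply p q)
  have hderiv : HasMFDerivAt 𝓘(ℝ, ℝ × EuclideanSpace ℝ (Fin k)) 𝓘(ℝ, ℝ)
      ((fun s : ℝ => (s : AddCircle T)) ∘ Prod.fst) q
      ((ContinuousLinearMap.id ℝ ℝ).comp (ContinuousLinearMap.fst ℝ ℝ _)) :=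
    (hasMFDerivAt_coe_addCircle q.1).comp q hasFDerivAt_fst.hasMFDerivAt
  rw [hcomp, hderiv.mfderiv] at hchain
  exact (congrArg (fun A => A a) hchain).symm

theorem mfderiv_coe_mfderiv_snd_mfderiv_extChartAt_symm {q : ℝ × EuclideanSpace ℝ (Fin k)}
    (hq : q ∈ (extChartAt (cylinderModel k) p).target) (a : ℝ × EuclideanSpace ℝ (Fin k)) :
    mfderiv (𝓡 k) 𝓘(ℝ, EuclideanSpace ℝ (Fin (k + 1)))
      (fun ξ : UnitSphere k => (ξ : EuclideanSpace ℝ (Fin (k + 1))))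
      ((extChartAt (cylinderModel k) p).symm q).2
      (mfderiv (cylinderModel k) (𝓡 k) (Prod.snd : AddCircle T × UnitSphere k → UnitSphere k)
        ((extChartAt (cylinderModel k) p).symm q)
        (mfderiv 𝓘(ℝ, ℝ × EuclideanSpace ℝ (Fin k)) (cylinderModel k)
          (extChartAt (cylinderModel k) p).symm q a)) =
      fderiv ℝ (sphereParam p.2) q.2 a.2 := by
  have : IsManifold (cylinderModel k) 1 (AddCircle T × UnitSphere k) :=
    IsManifold.of_le (n := ∞) (by simp)
  have hsnd := mdifferentiableAt_snd (I := 𝓘(ℝ, ℝ)) (I' := 𝓡 k)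
    (x := (extChartAt (cylinderModel k) p).symm q)
  have hcoe : MDifferentiableAt (𝓡 k) 𝓘(ℝ, EuclideanSpace ℝ (Fin (k + 1)))
      (fun ξ : UnitSphere k => (ξ : EuclideanSpace ℝ (Fin (k + 1))))
      ((extChartAt (cylinderModel k) p).symm q).2 :=
    contMDiff_coe_unitSphere.mdifferentiable (by simp) _
  have hchain := mfderiv_comp q (hcoe.comp _ hsnd) (mdifferentiableAt_extChartAt_symm hq)
  have hcomp : ((fun ξ : UnitSphere k => (ξ : EuclideanSpace ℝ (Fin (k + 1)))) ∘ Prod.snd) ∘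
      (extChartAt (cylinderModel k) p).symm = sphereParam p.2 ∘ Prod.snd :=
    funext fun q => congrArg (fun x => (x.2 : EuclideanSpace ℝ (Fin (k + 1))))
      (extChartAt_cylinder_symm_apply p q)
  have hderiv : HasFDerivAt (sphereParam p.2 ∘ Prod.snd)
      ((fderiv ℝ (sphereParam p.2) q.2).comp (ContinuousLinearMap.snd ℝ ℝ _)) q :=
    (hasFDerivAt_sphereParam p.2 q.2).comp q hasFDerivAt_snd
  rw [mfderiv_comp _ hcoe hsnd, hcomp, hderiv.hasMFDerivAt.mfderiv] at hchain
  exact (congrArg (fun A => A a) hchain).symm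

theorem cylinderMetric_inChart_apply {q : ℝ × EuclideanSpace ℝ (Fin k)}
    (hq : q ∈ (extChartAt (cylinderModel k) p).target) (a b : ℝ × EuclideanSpace ℝ (Fin k)) :
    (cylinderMetric T k).inChart p q a b = a.1 * b.1 +
      ⟪fderiv ℝ (sphereParam p.2) q.2 a.2, fderiv ℝ (sphereParam p.2) q.2 b.2⟫ := by
  have hfst := congrArg₂ (fun s t : ℝ => s * t)
    (mfderiv_fst_mfderiv_extChartAt_symm p hq a) (mfderiv_fst_mfderiv_extChartAt_symm p hq b)
  have hsnd := congrArg₂ (fun s t : EuclideanSpace ℝ (Fin (k + 1)) => ⟪s, t⟫)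
    (mfderiv_coe_mfderiv_snd_mfderiv_extChartAt_symm p hq a)
    (mfderiv_coe_mfderiv_snd_mfderiv_extChartAt_symm p hq b)
  exact congrArg₂ (fun s t : ℝ => s + t) hfst hsnd

-- The translation by a period `τ` matches the chart at `p` with any prescribed lift of `p.1`.
theorem inChart_eventuallyEq_pull {g : MetricTensor (cylinderModel k) (AddCircle T × UnitSphere k)}
    {ρ : AddCircle T × UnitSphere k → ℝ} (hg : ∀ x, g x = ρ x • cylinderMetric T k x)
    {f : EuclideanSpace ℝ (Fin (k + 1)) → ℝ}
    (hf : ∀ (ξ : UnitSphere k) q, Real.exp (2 * f (polar ξ q)) * Real.exp q.1 ^ 2 =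
      ρ ((q.1 : AddCircle T), (extChartAt (𝓡 k) ξ).symm q.2))
    {τ : ℝ} (hτ : (τ : AddCircle T) = 0) :
    g.inChart p =ᶠ[𝓝 (extChartAt (cylinderModel k) p p)]
      pull (fun q => polar p.2 (q + (τ, 0))) (conf f) := by
  filter_upwards [(isOpen_extChartAt_target (I := cylinderModel k) p).mem_nhds
    (mem_extChartAt_target p)] with q hq
  refine ContinuousLinearMap.ext fun a => ContinuousLinearMap.ext fun b => ?_
  have hscale : g.inChart p q a b = ρ ((extChartAt (cylinderModel k) p).symm q) *
      (cylinderMetric T k).inChart p q a b := by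
    have hx := hg ((extChartAt (cylinderModel k) p).symm q)
    change g ((extChartAt (cylinderModel k) p).symm q) _ _ = _
    rw [hx]
    rfl
  have hfst : (q + (τ, 0)).1 = q.1 + τ := rfl
  have hsnd : (q + (τ, 0)).2 = q.2 := add_zero q.2
  have hρ := hf p.2 (q + (τ, 0))
  rw [hsnd, hfst, AddCircle.coe_add, hτ, add_zero] at hρ
  rw [hscale, cylinderMetric_inChart_apply p hq, pull_apply, conf_apply, fderiv_comp_add_right,
    inner_fderiv_polar, extChartAt_cylinder_symm_apply, ← hρ, hfst, hsnd]
  ring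

end CylinderCharts

/-! ### Conformally cylindric metrics on the punctured space -/

namespace Coord

theorem IsLocalDiffeoNear.contDiffAt_of_comp {E E' G : Type*} [NormedAddCommGroup E]
    [NormedSpace ℝ E] [CompleteSpace E] [NormedAddCommGroup E'] [NormedSpace ℝ E']
    [NormedAddCommGroup G] [NormedSpace ℝ G] {Φ : E → E'} {x : E} (hΦ : IsLocalDiffeoNear Φ x)
    {v : E' → G} (hv : ContDiffAt ℝ ∞ (v ∘ Φ) x) : ContDiffAt ℝ ∞ v (Φ x) := by
  obtain ⟨hsmooth, e, he⟩ := hΦ.self_of_nhds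
  have hderiv : HasFDerivAt Φ (e : E →L[ℝ] E') x :=
    he ▸ (hsmooth.differentiableAt (by simp)).hasFDerivAt
  have hinv : hsmooth.localInverse hderiv (by simp) (Φ x) = x :=
    hsmooth.localInverse_apply_image hderiv (by simp)
  refine ContDiffAt.congr_of_eventuallyEq
    ((hinv.symm ▸ hv).comp (Φ x) (hsmooth.to_localInverse hderiv (by simp))) ?_
  filter_upwards [(hsmooth.hasStrictFDerivAt' hderiv (by simp)).eventually_right_inverse] with y hy
  exact (congrArg v hy).symm

section LaplacianComparison

variable {F : Type*} [NormedAddCommGroup F] [InnerProductSpace ℝ F] [FiniteDimensional ℝ F]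

theorem laplacian_neg_of_le_norm_rpow {v : F → ℝ} {x : F} {a M : ℝ} (ha : 0 < a) (hM : 0 < M)
    (hfin : (Module.finrank ℝ F : ℝ) = 2 * a + 2) (hx : x ≠ 0) (hv : IsSmoothNear v x)
    (hle : ∀ᶠ y in 𝓝 x, v y ≤ M * ‖y‖ ^ (-a)) (heq : v x = M * ‖x‖ ^ (-a)) : Δ v x < 0 := by
  have hs := isSmoothNear_norm_rpow hx (-a)
  have hΔ := laplacian_norm_rpow hx (-a)
  simp only [sub_zero] at hs hΔ
  have hmin : IsLocalMin (fun y => M * ‖y‖ ^ (-a) - v y) x := by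
    filter_upwards [hle] with y hy
    linarith
  have hnonneg := laplacian_nonneg_of_isLocalMin ((hs.const_mul M).sub hv).contDiffAt_two hmin
  rw [laplacian_sub (hs.const_mul M) hv, laplacian_const_mul hs, hΔ, hfin] at hnonneg
  have hpos : 0 < M * (a ^ 2 * ‖x‖ ^ (-a) / ‖x‖ ^ 2) := by
    have := norm_pos_iff.2 hx
    positivity
  calc Δ v x ≤ M * (-a * (-a + (2 * a + 2) - 2) * ‖x‖ ^ (-a) / ‖x‖ ^ 2) := by linarith
    _ = -(M * (a ^ 2 * ‖x‖ ^ (-a) / ‖x‖ ^ 2)) := by ring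
    _ < 0 := neg_lt_zero.2 hpos

end LaplacianComparison

end Coord

section ToSphere

variable {k : ℕ}

/-- The radial projection of the punctured space to the unit sphere, with an arbitrary value at the
origin. -/
def toSphere (x : EuclideanSpace ℝ (Fin (k + 1))) : UnitSphere k :=
  if h : x ≠ 0 then ⟨‖x‖⁻¹ • x, by
    rw [Metric.mem_sphere, dist_zero_right, norm_smul, norm_inv, norm_norm,
      inv_mul_cancel₀ (norm_ne_zero_iff.2 h)]⟩
  else ⟨EuclideanSpace.single 0 1, by simp⟩

theorem norm_exp_smul_coe (t : ℝ) (ξ : UnitSphere k) :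
    ‖Real.exp t • (ξ : EuclideanSpace ℝ (Fin (k + 1)))‖ = Real.exp t := by
  rw [norm_smul, norm_eq_of_mem_sphere, mul_one, Real.norm_of_nonneg (Real.exp_pos t).le]

theorem exp_smul_coe_ne_zero (t : ℝ) (ξ : UnitSphere k) :
    Real.exp t • (ξ : EuclideanSpace ℝ (Fin (k + 1))) ≠ 0 :=
  smul_ne_zero (Real.exp_pos t).ne' (ne_zero_of_mem_unit_sphere ξ)

theorem toSphere_exp_smul (t : ℝ) (ξ : UnitSphere k) :
    toSphere (Real.exp t • (ξ : EuclideanSpace ℝ (Fin (k + 1)))) = ξ := by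
  rw [toSphere, dif_pos (exp_smul_coe_ne_zero t ξ)]
  apply Subtype.ext
  change ‖Real.exp t • (ξ : EuclideanSpace ℝ (Fin (k + 1)))‖⁻¹ • Real.exp t •
    (ξ : EuclideanSpace ℝ (Fin (k + 1))) = ξ
  rw [norm_exp_smul_coe, inv_smul_smul₀ (Real.exp_pos t).ne']

theorem norm_smul_toSphere {x : EuclideanSpace ℝ (Fin (k + 1))} (hx : x ≠ 0) :
    ‖x‖ • (toSphere x : EuclideanSpace ℝ (Fin (k + 1))) = x := by
  rw [toSphere, dif_pos hx, smul_inv_smul₀ (norm_ne_zero_iff.2 hx)]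

theorem polar_toSphere {x : EuclideanSpace ℝ (Fin (k + 1))} (hx : x ≠ 0) :
    polar (toSphere x) (Real.log ‖x‖, extChartAt (𝓡 k) (toSphere x) (toSphere x)) = x := by
  rw [polar, Real.exp_log (norm_pos_iff.2 hx), sphereParam, extChartAt_to_inv]
  exact norm_smul_toSphere hx

end ToSphere

section Cone

variable {k : ℕ} {T : ℝ}

/-- The function on the punctured space which corresponds to the function `u` on the cylinder under
`e^t ξ ↦ (t, ξ)`. -/
def coneExtension (u : AddCircle T × UnitSphere k → ℝ) (x : EuclideanSpace ℝ (Fin (k + 1))) : ℝ :=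
  u ((Real.log ‖x‖ : ℝ), toSphere x)

/-- The density `v` on the punctured space of dimension `n = k + 1` for which
`v ^ (4 / (n - 2)) |dx|²` corresponds to `u ^ (4 / (n - 2)) (dt² + dξ²)` under `e^t ξ ↦ (t, ξ)`. -/
def coneDensity (u : AddCircle T × UnitSphere k → ℝ) (x : EuclideanSpace ℝ (Fin (k + 1))) : ℝ :=
  ‖x‖ ^ (-(((k : ℝ) - 1) / 2)) * coneExtension u x

/-- The exponent `f` for which `e^{2f} |dx|²` corresponds to `u ^ (4 / (n - 2)) (dt² + dξ²)`, where
`n = k + 1`. -/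
def coneExponent (u : AddCircle T × UnitSphere k → ℝ) (x : EuclideanSpace ℝ (Fin (k + 1))) : ℝ :=
  2 / ((k : ℝ) - 1) * Real.log (coneDensity u x)

variable {u : AddCircle T × UnitSphere k → ℝ} {x : EuclideanSpace ℝ (Fin (k + 1))}

theorem coneExtension_exp_smul (t : ℝ) (ξ : UnitSphere k) :
    coneExtension u (Real.exp t • (ξ : EuclideanSpace ℝ (Fin (k + 1)))) = u (t, ξ) := by
  rw [coneExtension, toSphere_exp_smul, norm_exp_smul_coe, Real.log_exp]

theorem coneExtension_polar (ξ : UnitSphere k) (q : ℝ × EuclideanSpace ℝ (Fin k)) :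
    coneExtension u (polar ξ q) = u (q.1, (extChartAt (𝓡 k) ξ).symm q.2) :=
  coneExtension_exp_smul _ _

theorem coneDensity_pos (hpos : ∀ x, 0 < u x) (hx : x ≠ 0) : 0 < coneDensity u x :=
  mul_pos (Real.rpow_pos_of_pos (norm_pos_iff.2 hx) _) (hpos _)

theorem coneExponent_eq (hk : 2 ≤ k) (hpos : ∀ x, 0 < u x) (hx : x ≠ 0) :
    coneExponent u x = 2 / ((k : ℝ) - 1) * Real.log (coneExtension u x) - Real.log ‖x‖ := by
  have hk' : (2 : ℝ) ≤ k := by exact_mod_cast hk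
  have hk1 : (k : ℝ) - 1 ≠ 0 := by linarith
  have hnorm := norm_pos_iff.2 hx
  have hext : 0 < coneExtension u x := hpos _
  rw [coneExponent, coneDensity, Real.log_mul (Real.rpow_pos_of_pos hnorm _).ne' hext.ne',
    Real.log_rpow hnorm]
  field_simp
  ring

variable [Fact (0 < T)]

theorem exists_forall_le_apply_coe (hu : Continuous u) :
    ∃ (t : ℝ) (ξ : UnitSphere k), ∀ x, u x ≤ u ((t : AddCircle T), ξ) := by
  obtain ⟨⟨b, ξ⟩, -, hb⟩ := isCompact_univ.exists_isMaxOn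
    ⟨((0 : AddCircle T), toSphere 0), mem_univ _⟩ hu.continuousOn
  obtain ⟨t, rfl⟩ := QuotientAddGroup.mk_surjective b
  exact ⟨t, ξ, fun x => hb (mem_univ x)⟩

theorem exists_forall_apply_coe_le (hu : Continuous u) :
    ∃ (t : ℝ) (ξ : UnitSphere k), ∀ x, u ((t : AddCircle T), ξ) ≤ u x := by
  obtain ⟨t, ξ, h⟩ := exists_forall_le_apply_coe hu.neg
  exact ⟨t, ξ, fun x => neg_le_neg_iff.1 (h x)⟩

theorem contDiff_slice (hu : ContMDiff (cylinderModel k) 𝓘(ℝ, ℝ) ∞ u) (ξ : UnitSphere k) :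
    ContDiff ℝ ∞ fun t : ℝ => u (t, ξ) :=
  contMDiff_iff_contDiff.1 (hu.comp (contMDiff_coe_addCircle.prodMk contMDiff_const))

theorem contDiffAt_coneExtension (hu : ContMDiff (cylinderModel k) 𝓘(ℝ, ℝ) ∞ u) (hx : x ≠ 0) :
    ContDiffAt ℝ ∞ (coneExtension u) x := by
  set ξ := toSphere x
  set q : ℝ × EuclideanSpace ℝ (Fin k) := (Real.log ‖x‖, extChartAt (𝓡 k) ξ ξ)
  have hq : polar ξ q = x := polar_toSphere hx
  have hcircle : ContMDiffAt 𝓘(ℝ, ℝ) 𝓘(ℝ, ℝ) ∞ (fun t : ℝ => (t : AddCircle T)) q.1 :=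
    contMDiff_coe_addCircle _
  have hsphere : ContMDiffAt 𝓘(ℝ, EuclideanSpace ℝ (Fin k)) (𝓡 k) ∞
      (extChartAt (𝓡 k) ξ).symm q.2 :=
    (contMDiffOn_extChartAt_symm ξ).contMDiffAt
      ((isOpen_extChartAt_target ξ).mem_nhds (mem_target_extChartAt_unitSphere ξ _))
  have hfst : ContMDiffAt 𝓘(ℝ, ℝ × EuclideanSpace ℝ (Fin k)) 𝓘(ℝ, ℝ) ∞ Prod.fst q :=
    contDiff_fst.contMDiff _
  have hsnd : ContMDiffAt 𝓘(ℝ, ℝ × EuclideanSpace ℝ (Fin k)) 𝓘(ℝ, EuclideanSpace ℝ (Fin k)) ∞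
      Prod.snd q := contDiff_snd.contMDiff _
  have hcomp := (hu _).comp q ((hcircle.comp q hfst).prodMk (hsphere.comp q hsnd))
  rw [← hq]
  refine (isLocalDiffeoNear_polar ξ q).contDiffAt_of_comp ?_
  exact (contMDiffAt_iff_contDiffAt.1 hcomp).congr_of_eventuallyEq
    (Eventually.of_forall (coneExtension_polar ξ))

theorem isSmoothNear_coneDensity (hu : ContMDiff (cylinderModel k) 𝓘(ℝ, ℝ) ∞ u) (hx : x ≠ 0) :
    IsSmoothNear (coneDensity u) x := by
  filter_upwards [isOpen_ne.mem_nhds hx] with y hy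
  exact ((contDiffAt_norm ℝ hy).rpow_const_of_ne (norm_ne_zero_iff.2 hy)).mul
    (contDiffAt_coneExtension hu hy)

theorem isSmoothNear_coneExponent (hu : ContMDiff (cylinderModel k) 𝓘(ℝ, ℝ) ∞ u)
    (hpos : ∀ x, 0 < u x) (hx : x ≠ 0) : IsSmoothNear (coneExponent u) x := by
  filter_upwards [isSmoothNear_coneDensity hu hx, isOpen_ne.mem_nhds hx] with y hsmooth hy
  exact contDiffAt_const.mul (hsmooth.log (coneDensity_pos hpos hy).ne')

end Cone

/-- The metric `g` on `S¹(T) × S^k` is `u ^ (4 / (n - 2)) (dt² + dξ²)` with a smooth positive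
function `u`, where `n = k + 1 ≥ 3`. -/
structure IsConformalFactor {k : ℕ} {T : ℝ} [Fact (0 < T)] (u : AddCircle T × UnitSphere k → ℝ)
    (g : MetricTensor (cylinderModel k) (AddCircle T × UnitSphere k)) : Prop where
  two_le : 2 ≤ k
  contMDiff : ContMDiff (cylinderModel k) 𝓘(ℝ, ℝ) ∞ u
  pos : ∀ x, 0 < u x
  metric_eq : ∀ x, g x = u x ^ (4 / ((k : ℝ) - 1)) • cylinderMetric T k x

namespace IsConformalFactor

variable {k : ℕ} {T : ℝ} [Fact (0 < T)] {u : AddCircle T × UnitSphere k → ℝ}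
  {g : MetricTensor (cylinderModel k) (AddCircle T × UnitSphere k)} (h : IsConformalFactor u g)
  {x : EuclideanSpace ℝ (Fin (k + 1))}

include h

theorem sub_one_pos : 0 < (k : ℝ) - 1 := by
  have : (2 : ℝ) ≤ k := by exact_mod_cast h.two_le
  linarith

theorem isLocalIsometryNear_polar (p : AddCircle T × UnitSphere k) {τ : ℝ}
    (hτ : (τ : AddCircle T) = 0) :
    IsLocalIsometryNear (fun q => polar p.2 (q + (τ, 0))) (g.inChart p) (conf (coneExponent u))
      (extChartAt (cylinderModel k) p p) := by
  refine ⟨isLocalDiffeoNear_polar_add _ _ _,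
    (isSmoothNear_coneExponent h.contMDiff h.pos (polar_ne_zero _ _)).isMetricNear,
    inChart_eventuallyEq_pull p h.metric_eq (fun ξ q => ?_) hτ⟩
  rw [coneExponent_eq h.two_le h.pos (polar_ne_zero ξ q), norm_polar, Real.log_exp,
    coneExtension_polar, Real.rpow_def_of_pos (h.pos _), ← Real.exp_nat_mul, ← Real.exp_add]
  congr 1
  push_cast
  ring

theorem exists_isLocalIsometryNear (hx : x ≠ 0) :
    ∃ (p : AddCircle T × UnitSphere k)
      (Φ : ℝ × EuclideanSpace ℝ (Fin k) → EuclideanSpace ℝ (Fin (k + 1))),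
      Φ (extChartAt (cylinderModel k) p p) = x ∧
      IsLocalIsometryNear Φ (g.inChart p) (conf (coneExponent u))
        (extChartAt (cylinderModel k) p p) := by
  set p : AddCircle T × UnitSphere k := ((Real.log ‖x‖ : ℝ), toSphere x)
  set s : ℝ := extChartAt 𝓘(ℝ, ℝ) p.1 p.1 with hs
  have hp : extChartAt (cylinderModel k) p p =
      (s, extChartAt (𝓡 k) (toSphere x) (toSphere x)) := by
    rw [extChartAt_prod]
    rfl
  have hτ : ((Real.log ‖x‖ - s : ℝ) : AddCircle T) = 0 := by
    rw [AddCircle.coe_sub, hs, coe_extChartAt_addCircle, sub_self]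
  refine ⟨p, _, ?_, h.isLocalIsometryNear_polar p hτ⟩
  rw [hp, Prod.mk_add_mk, add_sub_cancel, add_zero]
  exact polar_toSphere hx

theorem covRicci_coneExponent (hRic : HasParallelRicci g) (hx : x ≠ 0)
    (a v w : EuclideanSpace ℝ (Fin (k + 1))) : covRicci (conf (coneExponent u)) x a v w = 0 := by
  obtain ⟨p, Φ, rfl, hΦ⟩ := h.exists_isLocalIsometryNear hx
  obtain ⟨a, rfl⟩ := hΦ.isLocalDiffeoNear.surjective a
  obtain ⟨v, rfl⟩ := hΦ.isLocalDiffeoNear.surjective v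
  obtain ⟨w, rfl⟩ := hΦ.isLocalDiffeoNear.surjective w
  rw [← hΦ.covRicci_eq, hRic]

variable {c : ℝ} (hc : ∀ x, scalarCurvature g x = c)

include hc

theorem scalar_coneExponent (hx : x ≠ 0) : scalar (conf (coneExponent u)) x = c := by
  obtain ⟨p, Φ, rfl, hΦ⟩ := h.exists_isLocalIsometryNear hx
  rw [← hΦ.scalar_eq]
  exact hc p

theorem hasHarmonicCurvature : HasHarmonicCurvature g := by
  intro p v w z
  have hne := polar_ne_zero p.2 (extChartAt (cylinderModel k) p p + ((0 : ℝ), 0))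
  rw [(h.isLocalIsometryNear_polar p (AddCircle.coe_zero T)).divRiemann_eq]
  refine divRiemann_conf_eq_zero (c := c) ?_ (isSmoothNear_coneExponent h.contMDiff h.pos hne) ?_
    _ _ _
  · rw [finrank_euclideanSpace_fin]
    exact h.two_le.trans k.le_succ
  · filter_upwards [isOpen_ne.mem_nhds hne] with y hy using h.scalar_coneExponent hc hy

theorem laplacian_coneDensity (hx : x ≠ 0) :
    Δ (coneDensity u) x = -(c * (k - 1) / (4 * k)) *
      coneDensity u x ^ ((((k : ℝ) - 1) / 2 + 2) / (((k : ℝ) - 1) / 2)) := by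
  have hk1 := h.sub_one_pos
  have hv := coneDensity_pos h.pos hx
  have hfin : 3 ≤ Module.finrank ℝ (EuclideanSpace ℝ (Fin (k + 1))) := by
    rw [finrank_euclideanSpace_fin]
    exact Nat.succ_le_succ h.two_le
  have hscalar := scalar_conf_log hfin (isSmoothNear_coneDensity h.contMDiff hx) hv
  have hdim : ((k + 1 : ℕ) : ℝ) - 2 = k - 1 := by
    push_cast
    ring
  have hexp : (((k + 1 : ℕ) : ℝ) + 2) / ((k : ℝ) - 1) =
      (((k : ℝ) - 1) / 2 + 2) / (((k : ℝ) - 1) / 2) := by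
    push_cast
    field_simp
    ring
  rw [finrank_euclideanSpace_fin, hdim, hexp, Real.rpow_neg hv.le] at hscalar
  have hk0 : 0 < (k : ℝ) := by linarith
  have hpow := Real.rpow_pos_of_pos hv ((((k : ℝ) - 1) / 2 + 2) / (((k : ℝ) - 1) / 2))
  rw [(h.scalar_coneExponent hc hx).symm.trans hscalar]
  generalize coneDensity u x ^ ((((k : ℝ) - 1) / 2 + 2) / (((k : ℝ) - 1) / 2)) = P at hpow ⊢
  push_cast
  field_simp
  ring

theorem const_pos : 0 < c := by
  obtain ⟨t, ξ, hmax⟩ := exists_forall_le_apply_coe h.contMDiff.continuous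
  set x : EuclideanSpace ℝ (Fin (k + 1)) := Real.exp t • (ξ : EuclideanSpace ℝ (Fin (k + 1)))
  have hx : x ≠ 0 := exp_smul_coe_ne_zero t ξ
  have hneg : Δ (coneDensity u) x < 0 := by
    refine laplacian_neg_of_le_norm_rpow (half_pos h.sub_one_pos) (h.pos (t, ξ)) ?_ hx
      (isSmoothNear_coneDensity h.contMDiff hx) (Eventually.of_forall fun y => ?_) ?_
    · rw [finrank_euclideanSpace_fin]
      push_cast
      ring
    · rw [coneDensity, mul_comm]
      exact mul_le_mul_of_nonneg_right (hmax _) (Real.rpow_nonneg (norm_nonneg _) _)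
    · rw [coneDensity, coneExtension_exp_smul, mul_comm]
  rw [h.laplacian_coneDensity hc hx, neg_mul, neg_lt_zero, mul_pos_iff_of_pos_right
    (Real.rpow_pos_of_pos (coneDensity_pos h.pos hx) _)] at hneg
  by_contra! hc0
  exact hneg.not_ge (div_nonpos_of_nonpos_of_nonneg
    (mul_nonpos_of_nonpos_of_nonneg hc0 h.sub_one_pos.le) (by positivity))

theorem exists_isSingularSolution :
    ∃ b, IsSingularSolution (coneDensity u) (((k : ℝ) - 1) / 2) (c * (k - 1) / (4 * k)) b := by
  obtain ⟨t, ξ, hmin⟩ := exists_forall_apply_coe_le h.contMDiff.continuous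
  refine ⟨u (t, ξ), ?_, ?_,
    fun x hx => (isSmoothNear_coneDensity h.contMDiff hx).contDiffAt.contDiffWithinAt,
    fun x => coneDensity_pos h.pos, fun x => h.laplacian_coneDensity hc, ?_, h.pos _,
    fun x _ => ?_⟩
  · rw [finrank_euclideanSpace_fin]
    exact Nat.succ_le_succ h.two_le
  · rw [finrank_euclideanSpace_fin]
    push_cast
    ring
  · have := h.const_pos hc
    have := h.sub_one_pos
    positivity
  · rw [coneDensity, mul_comm]
    exact mul_le_mul_of_nonneg_left (hmin _) (Real.rpow_nonneg (norm_nonneg _) _)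

theorem apply_eq_apply (t : ℝ) (ξ η : UnitSphere k) : u (t, ξ) = u (t, η) := by
  obtain ⟨b, hb⟩ := h.exists_isSingularSolution hc
  have heq := hb.eq_of_norm_eq ((norm_exp_smul_coe t ξ).trans (norm_exp_smul_coe t η).symm)
  rw [coneDensity, coneDensity, norm_exp_smul_coe, norm_exp_smul_coe, coneExtension_exp_smul,
    coneExtension_exp_smul] at heq
  exact mul_left_cancel₀ (Real.rpow_pos_of_pos (Real.exp_pos t) _).ne' heq

theorem deriv_deriv_slice (ξ : UnitSphere k) (t : ℝ) :
    deriv (deriv fun s : ℝ => u (s, ξ)) t = (((k : ℝ) - 1) / 2) ^ 2 * u (t, ξ) -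
      c * (k - 1) / (4 * k) * u (t, ξ) ^ ((((k : ℝ) - 1) / 2 + 2) / (((k : ℝ) - 1) / 2)) := by
  set a : ℝ := ((k : ℝ) - 1) / 2 with ha
  have ha0 : 0 < a := half_pos h.sub_one_pos
  set x : EuclideanSpace ℝ (Fin (k + 1)) := Real.exp t • (ξ : EuclideanSpace ℝ (Fin (k + 1)))
  have hx : x ≠ 0 := exp_smul_coe_ne_zero t ξ
  have hnorm : ‖x‖ = Real.exp t := norm_exp_smul_coe t ξ
  have hv : coneDensity u = fun y => ‖y - 0‖ ^ (-a) * (fun s : ℝ => u (s, ξ)) (Real.log ‖y - 0‖) :=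
    funext fun y => by rw [sub_zero, coneDensity, coneExtension, h.apply_eq_apply hc _ _ ξ]
  have hvx : coneDensity u x = Real.exp t ^ (-a) * u (t, ξ) := by
    rw [coneDensity, coneExtension_exp_smul, hnorm]
  have hdim : ((k + 1 : ℕ) : ℝ) = 2 * a + 2 := by
    rw [ha]
    push_cast
    ring
  have hΔ := h.laplacian_coneDensity hc hx
  rw [← ha, hvx, hv, laplacian_norm_rpow_mul_comp_log_norm hx _ (contDiff_slice h.contMDiff ξ),
    finrank_euclideanSpace_fin, hdim, sub_zero, hnorm, Real.log_exp] at hΔ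
  have hpow : (Real.exp t ^ (-a) * u (t, ξ)) ^ ((a + 2) / a) =
      Real.exp t ^ (-a) / Real.exp t ^ 2 * u (t, ξ) ^ ((a + 2) / a) := by
    rw [Real.mul_rpow (by positivity) (h.pos _).le, ← Real.rpow_mul (Real.exp_pos t).le,
      show -a * ((a + 2) / a) = -a - (2 : ℕ) by push_cast; field_simp; ring,
      Real.rpow_sub (Real.exp_pos t), Real.rpow_natCast]
  rw [hpow] at hΔ
  have hfactor : 0 < Real.exp t ^ (-a) / Real.exp t ^ 2 := by positivity
  refine mul_left_cancel₀ hfactor.ne' ?_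
  linear_combination hΔ

end IsConformalFactor

/-! ### Parallel Ricci tensor -/

section OrdinaryDifferentialEquation

variable {p : ℝ → ℝ}

theorem exists_deriv_deriv_eq_mul_exp (hp : ContDiff ℝ 3 p)
    (h3 : ∀ t, deriv (deriv (deriv p)) t = 2 * deriv p t * deriv (deriv p) t) :
    ∃ A, ∀ t, deriv (deriv p) t = A * Real.exp (2 * p t) := by
  have hd : ∀ t, HasDerivAt (fun t => deriv (deriv p) t * Real.exp (-2 * p t)) 0 t := fun t => by
    have hp' := (hp.differentiable (by simp) t).hasDerivAt
    have hp'' := ((hp.iterate_deriv' 1 2).differentiable (by simp) t).hasDerivAt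
    refine (hp''.mul (hp'.const_mul (-2)).exp).congr_deriv ?_
    simp only [Function.iterate_succ, Function.iterate_zero, Function.comp_apply, id_eq, h3]
    ring
  refine ⟨deriv (deriv p) 0 * Real.exp (-2 * p 0), fun t => ?_⟩
  rw [is_const_of_deriv_eq_zero (fun t => (hd t).differentiableAt) (fun t => (hd t).deriv) 0 t,
    mul_assoc, ← Real.exp_add]
  simp

theorem eq_of_deriv_deriv_deriv_eq (hp : ContDiff ℝ 3 p) {b κ s t : ℝ} (hb : b ≠ 0)
    (h3 : ∀ t, deriv (deriv (deriv p)) t = 2 * deriv p t * deriv (deriv p) t)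
    (h2 : ∀ t, deriv (deriv p) t + b * (deriv p t ^ 2 - 1) = κ * Real.exp (2 * p t))
    (hs : deriv p s = 0) (ht : deriv p t = 0) : p s = p t := by
  obtain ⟨A, hA⟩ := exists_deriv_deriv_eq_mul_exp hp h3
  have hcrit : ∀ r, deriv p r = 0 → (A - κ) * Real.exp (2 * p r) = b := fun r hr => by
    have h2r := h2 r
    rw [hA, hr] at h2r
    linear_combination h2r
  have hAκ : A - κ ≠ 0 := fun h0 => hb (by rw [← hcrit s hs, h0, zero_mul])
  have hexp := mul_left_cancel₀ hAκ ((hcrit s hs).trans (hcrit t ht).symm)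
  linarith [Real.exp_injective hexp]

end OrdinaryDifferentialEquation

namespace Coord

section Radial

variable {F : Type*} [NormedAddCommGroup F] {f : F → ℝ} {q : ℝ → ℝ} {x : F}

theorem eventuallyEq_comp_log_norm (hf : ∀ x, x ≠ 0 → f x = q (Real.log ‖x‖)) (hx : x ≠ 0) :
    f =ᶠ[𝓝 x] fun y => q (Real.log ‖y - 0‖) := by
  filter_upwards [isOpen_ne.mem_nhds hx] with y hy
  rw [sub_zero, hf y hy]

variable [InnerProductSpace ℝ F] (hq : ContDiff ℝ ∞ q)
  (hf : ∀ x, x ≠ 0 → f x = q (Real.log ‖x‖)) (hx : x ≠ 0)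

include hq hf hx

theorem isSmoothNear_of_radial : IsSmoothNear f x := by
  have hsmooth : IsSmoothNear (fun y => q (Real.log ‖y - 0‖)) x :=
    (isSmoothNear_log_norm hx).comp (Eventually.of_forall fun _ => hq.contDiffAt)
  filter_upwards [hsmooth, (eventuallyEq_comp_log_norm hf hx).eventuallyEq_nhds] with y hy heq
  exact hy.congr_of_eventuallyEq heq

variable [FiniteDimensional ℝ F]

theorem gradient_radial : gradient f x = (deriv q (Real.log ‖x‖) / ‖x‖ ^ 2) • x := by
  rw [(eventuallyEq_comp_log_norm hf hx).gradient_eq,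
    gradient_comp ((isSmoothNear_log_norm hx).self_of_nhds.differentiableAt (by simp))
      (hq.differentiable (by simp) _), gradient_log_norm hx, smul_smul, sub_zero, div_eq_mul_inv]

theorem inner_gradient_radial : ⟪gradient f x, x⟫ = deriv q (Real.log ‖x‖) := by
  have h0 := norm_ne_zero_iff.2 hx
  rw [gradient_radial hq hf hx, real_inner_smul_left, real_inner_self_eq_norm_sq]
  field_simp

theorem inner_gradient_self_radial :
    ⟪gradient f x, gradient f x⟫ * ‖x‖ ^ 2 = deriv q (Real.log ‖x‖) ^ 2 := by
  have h0 := norm_ne_zero_iff.2 hx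
  rw [gradient_radial hq hf hx, real_inner_smul_left, real_inner_smul_right,
    real_inner_self_eq_norm_sq]
  field_simp

theorem inner_fderiv_gradient_radial :
    ⟪fderiv ℝ (gradient f) x x, x⟫ =
      deriv (deriv q) (Real.log ‖x‖) - deriv q (Real.log ‖x‖) := by
  have h0 := norm_ne_zero_iff.2 hx
  rw [(eventuallyEq_comp_log_norm hf hx).gradient.fderiv_eq,
    fderiv_gradient_comp (isSmoothNear_log_norm hx)
      (Eventually.of_forall fun _ => hq.contDiffAt), gradient_log_norm hx]
  simp only [_root_.add_apply, _root_.smul_apply, ContinuousLinearMap.smulRight_apply,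
    fderiv_gradient_log_norm hx]
  simp only [sub_zero, _root_.sub_apply, _root_.smul_apply, ContinuousLinearMap.smulRight_apply,
    ContinuousLinearMap.id_apply, innerSL_apply_apply, inner_add_left, inner_sub_left,
    real_inner_smul_left, real_inner_self_eq_norm_sq, smul_eq_mul]
  field_simp
  ring

theorem traceL_schouten_radial :
    traceL F (schouten f x) * ‖x‖ ^ 2 =
      deriv (deriv q) (Real.log ‖x‖) + ((Module.finrank ℝ F : ℝ) - 2) *
        (deriv q (Real.log ‖x‖) + deriv q (Real.log ‖x‖) ^ 2 / 2) := by
  have h0 := norm_ne_zero_iff.2 hx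
  rw [traceL_schouten (isSmoothNear_of_radial hq hf hx), add_mul, mul_assoc,
    inner_gradient_self_radial hq hf hx,
    (InnerProductSpace.laplacian_congr_nhds (eventuallyEq_comp_log_norm hf hx)).self_of_nhds,
    laplacian_comp_log_norm hx hq, sub_zero]
  field_simp
  ring

theorem ricci_radial :
    ricci (conf f) x x x = -((Module.finrank ℝ F : ℝ) - 1) * deriv (deriv q) (Real.log ‖x‖) := by
  rw [ricci_conf (isSmoothNear_of_radial hq hf hx), real_inner_self_eq_norm_sq,
    traceL_schouten_radial hq hf hx, schouten_apply, inner_add_left, inner_sub_left,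
    real_inner_smul_left, real_inner_smul_left, inner_fderiv_gradient_radial hq hf hx,
    inner_gradient_radial hq hf hx, real_inner_self_eq_norm_sq x, mul_assoc 2⁻¹,
    inner_gradient_self_radial hq hf hx]
  ring

theorem christoffel_radial :
    christoffel (conf f) x x x = deriv q (Real.log ‖x‖) • x := by
  have := norm_ne_zero_iff.2 hx
  rw [christoffel_conf (isSmoothNear_of_radial hq hf hx), inner_gradient_radial hq hf hx,
    gradient_radial hq hf hx, real_inner_self_eq_norm_sq, smul_smul,
    mul_div_cancel₀ _ (by positivity)]
  module

theorem fderiv_ricci_radial :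
    fderiv ℝ (ricci (conf f)) x x x x = -((Module.finrank ℝ F : ℝ) - 1) *
      (deriv (deriv (deriv q)) (Real.log ‖x‖) - 2 * deriv (deriv q) (Real.log ‖x‖)) := by
  have hγ : HasDerivAt (fun s => Real.exp s • x) x 0 := by
    simpa using (Real.hasDerivAt_exp 0).smul_const x
  have hγ0 : Real.exp 0 • x = x := by rw [Real.exp_zero, one_smul]
  have hlog : ∀ s, Real.log ‖Real.exp s • x‖ = s + Real.log ‖x‖ := fun s => by
    rw [norm_smul, Real.norm_of_nonneg (Real.exp_pos s).le,
      Real.log_mul (Real.exp_ne_zero s) (norm_ne_zero_iff.2 hx), Real.log_exp]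
  have hric : HasFDerivAt (ricci (conf f)) (fderiv ℝ (ricci (conf f)) x) (Real.exp 0 • x) := by
    rw [hγ0]
    exact ((isSmoothNear_of_radial hq hf hx).isMetricNear.contDiffAt_ricci.differentiableAt
      (by simp)).hasFDerivAt
  have hric' : HasDerivAt (ricci (conf f) ∘ fun s => Real.exp s • x)
      (fderiv ℝ (ricci (conf f)) x x) 0 := hric.comp_hasDerivAt 0 hγ
  have hq'' : HasDerivAt (deriv (deriv q)) (deriv (deriv (deriv q)) (0 + Real.log ‖x‖))
      (0 + Real.log ‖x‖) :=
    ((contDiff_infty_iff_deriv.1 (contDiff_infty_iff_deriv.1 hq).2).2.differentiable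
      (by simp) _).hasDerivAt
  have hradial : (fun s => ricci (conf f) (Real.exp s • x) (Real.exp s • x) (Real.exp s • x)) =
      fun s => -((Module.finrank ℝ F : ℝ) - 1) * deriv (deriv q) (s + Real.log ‖x‖) :=
    funext fun s => by rw [ricci_radial hq hf (smul_ne_zero (Real.exp_ne_zero s) hx), hlog]
  have hunique := ((hric'.clm_apply hγ).clm_apply hγ).unique
    (hradial ▸ (hq''.comp_add_const 0 _).const_mul _)
  simp only [Function.comp_apply, hγ0, zero_add, _root_.add_apply] at hunique
  linear_combination hunique - 2 * ricci_radial hq hf hx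

theorem covRicci_radial :
    covRicci (conf f) x x x x = -((Module.finrank ℝ F : ℝ) - 1) *
      (deriv (deriv (deriv q)) (Real.log ‖x‖) -
        2 * (deriv q (Real.log ‖x‖) + 1) * deriv (deriv q) (Real.log ‖x‖)) := by
  rw [covRicci, fderiv_ricci_radial hq hf hx, christoffel_radial hq hf hx, map_smul, map_smul,
    _root_.smul_apply, smul_eq_mul, ricci_radial hq hf hx]
  ring

end Radial

end Coord

/-- The exponent `p` of a conformally cylindric metric `e^{2p} (dt² + dξ²)` along the line through
`ξ`, for the conformal factor `u ^ (4 / (n - 2))` in dimension `n = k + 1`. -/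
def sliceExponent {k : ℕ} {T : ℝ} (u : AddCircle T × UnitSphere k → ℝ) (ξ : UnitSphere k) (t : ℝ) :
    ℝ :=
  2 / ((k : ℝ) - 1) * Real.log (u (t, ξ))

namespace IsConformalFactor

variable {k : ℕ} {T : ℝ} [Fact (0 < T)] {u : AddCircle T × UnitSphere k → ℝ}
  {g : MetricTensor (cylinderModel k) (AddCircle T × UnitSphere k)} (h : IsConformalFactor u g)
  {c : ℝ} (hc : ∀ x, scalarCurvature g x = c)

include h

theorem contDiff_sliceExponent (ξ : UnitSphere k) : ContDiff ℝ ∞ (sliceExponent u ξ) :=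
  contDiff_const.mul ((contDiff_slice h.contMDiff ξ).log fun _ => (h.pos _).ne')

theorem sliceExponent_le_sliceExponent {ξ : UnitSphere k} {s t : ℝ} (hst : u (s, ξ) ≤ u (t, ξ)) :
    sliceExponent u ξ s ≤ sliceExponent u ξ t :=
  mul_le_mul_of_nonneg_left (Real.log_le_log (h.pos _) hst)
    (div_nonneg zero_le_two h.sub_one_pos.le)

theorem apply_eq_apply_of_sliceExponent_eq {ξ : UnitSphere k} {s t : ℝ}
    (hst : sliceExponent u ξ s = sliceExponent u ξ t) : u (s, ξ) = u (t, ξ) :=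
  Real.log_injOn_pos (h.pos _) (h.pos _)
    (mul_left_cancel₀ (div_pos two_pos h.sub_one_pos).ne' hst)

theorem deriv_sliceExponent_sub (ξ : UnitSphere k) :
    deriv (fun t => sliceExponent u ξ t - t) = fun t => deriv (sliceExponent u ξ) t - 1 :=
  funext fun t => (((h.contDiff_sliceExponent ξ).differentiable (by simp) t).hasDerivAt.sub
    (hasDerivAt_id t)).deriv

theorem deriv_deriv_sliceExponent_sub (ξ : UnitSphere k) :
    deriv (deriv fun t => sliceExponent u ξ t - t) = deriv (deriv (sliceExponent u ξ)) := by
  rw [h.deriv_sliceExponent_sub]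
  exact funext fun t => deriv_sub_const _

include hc

theorem coneExponent_eq_sliceExponent (ξ : UnitSphere k) (x : EuclideanSpace ℝ (Fin (k + 1)))
    (hx : x ≠ 0) :
    coneExponent u x = sliceExponent u ξ (Real.log ‖x‖) - Real.log ‖x‖ := by
  rw [coneExponent_eq h.two_le h.pos hx, coneExtension, h.apply_eq_apply hc _ _ ξ, sliceExponent]

theorem deriv_deriv_deriv_sliceExponent (hRic : HasParallelRicci g) (ξ : UnitSphere k) (t : ℝ) :
    deriv (deriv (deriv (sliceExponent u ξ))) t =
      2 * deriv (sliceExponent u ξ) t * deriv (deriv (sliceExponent u ξ)) t := by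
  have hcov := covRicci_radial ((h.contDiff_sliceExponent ξ).sub contDiff_id)
    (h.coneExponent_eq_sliceExponent hc ξ) (exp_smul_coe_ne_zero t ξ)
  simp only [id_eq] at hcov
  rw [h.covRicci_coneExponent hRic (exp_smul_coe_ne_zero t ξ), norm_exp_smul_coe, Real.log_exp,
    h.deriv_deriv_sliceExponent_sub, h.deriv_sliceExponent_sub, sub_add_cancel, eq_comm,
    mul_eq_zero, finrank_euclideanSpace_fin, Nat.cast_add_one, add_sub_cancel_right,
    neg_eq_zero, sub_eq_zero] at hcov
  exact hcov.resolve_left (by linarith [h.sub_one_pos])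

theorem deriv_deriv_sliceExponent (ξ : UnitSphere k) (t : ℝ) :
    deriv (deriv (sliceExponent u ξ)) t +
        ((k : ℝ) - 1) / 2 * (deriv (sliceExponent u ξ) t ^ 2 - 1) =
      -(c / (2 * k)) * Real.exp (2 * sliceExponent u ξ t) := by
  have hx := exp_smul_coe_ne_zero t ξ
  have hcone := h.coneExponent_eq_sliceExponent hc ξ
  have htrace := traceL_schouten_radial ((h.contDiff_sliceExponent ξ).sub contDiff_id) hcone hx
  have hscalar := scalar_conf (isSmoothNear_coneExponent h.contMDiff h.pos hx)
  simp only [id_eq] at htrace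
  rw [norm_exp_smul_coe, Real.log_exp, ← Real.exp_nat_mul, h.deriv_deriv_sliceExponent_sub,
    h.deriv_sliceExponent_sub, finrank_euclideanSpace_fin] at htrace
  rw [h.scalar_coneExponent hc hx, hcone _ hx, norm_exp_smul_coe, Real.log_exp,
    finrank_euclideanSpace_fin] at hscalar
  have hk0 : (k : ℝ) ≠ 0 := by linarith [h.sub_one_pos]
  have hexp : Real.exp (-2 * (sliceExponent u ξ t - t)) * Real.exp (2 * sliceExponent u ξ t) =
      Real.exp (((2 : ℕ) : ℝ) * t) := by
    rw [← Real.exp_add]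
    push_cast
    ring_nf
  have hck : c / (2 * k) = -(Real.exp (-2 * (sliceExponent u ξ t - t)) *
      traceL (EuclideanSpace ℝ (Fin (k + 1))) (schouten (coneExponent u)
        (Real.exp t • (ξ : EuclideanSpace ℝ (Fin (k + 1)))))) := by
    rw [hscalar]
    push_cast
    field_simp
    ring
  rw [← hexp] at htrace
  push_cast at htrace
  rw [hck]
  linear_combination -htrace

theorem not_hasParallelRicci (hne : ¬ ∃ b, ∀ x, u x = b) : ¬ HasParallelRicci g := by
  intro hRic
  obtain ⟨t₁, ξ, hmax⟩ := exists_forall_le_apply_coe h.contMDiff.continuous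
  obtain ⟨t₂, η, hmin⟩ := exists_forall_apply_coe_le h.contMDiff.continuous
  rw [h.apply_eq_apply hc t₂ η ξ] at hmin
  have hcrit₁ : deriv (sliceExponent u ξ) t₁ = 0 := IsLocalMax.deriv_eq_zero
    (Eventually.of_forall fun t => h.sliceExponent_le_sliceExponent (hmax _))
  have hcrit₂ : deriv (sliceExponent u ξ) t₂ = 0 := IsLocalMin.deriv_eq_zero
    (Eventually.of_forall fun t => h.sliceExponent_le_sliceExponent (hmin _))
  have heq : u (t₁, ξ) = u (t₂, ξ) := h.apply_eq_apply_of_sliceExponent_eq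
    (eq_of_deriv_deriv_deriv_eq (contDiff_infty.1 (h.contDiff_sliceExponent ξ) 3)
      (half_pos h.sub_one_pos).ne' (h.deriv_deriv_deriv_sliceExponent hc hRic ξ)
      (h.deriv_deriv_sliceExponent hc ξ) hcrit₁ hcrit₂)
  exact hne ⟨u (t₁, ξ), fun x => le_antisymm (hmax x) (heq.trans_le (hmin x))⟩

end IsConformalFactor

/-! ### Reparametrization by arc length -/

/-- `τ` and `σ` are mutually inverse diffeomorphisms of the line, and `τ` induces a diffeomorphism
from the circle of length `L` to the circle of length `T`. -/
structure IsCircleLift (L T : ℝ) (τ σ : ℝ → ℝ) : Prop where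
  contDiff : ContDiff ℝ ∞ τ
  contDiff_inv : ContDiff ℝ ∞ σ
  left_inv : Function.LeftInverse σ τ
  right_inv : Function.RightInverse σ τ
  apply_add : ∀ s, τ (s + L) = τ s + T

namespace IsCircleLift

variable {L T : ℝ} {τ σ : ℝ → ℝ} (hτ : IsCircleLift L T τ σ)

include hτ

theorem symm : IsCircleLift T L σ τ :=
  ⟨hτ.contDiff_inv, hτ.contDiff, hτ.right_inv, hτ.left_inv, fun t =>
    hτ.left_inv.injective.eq_iff.1 (by rw [hτ.right_inv, hτ.apply_add, hτ.right_inv])⟩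

theorem periodic_coe_comp : Function.Periodic (fun s => (τ s : AddCircle T)) L := fun s => by
  beta_reduce
  rw [hτ.apply_add, AddCircle.coe_add, AddCircle.coe_period, add_zero]

end IsCircleLift

theorem exists_isCircleLift_hasDerivAt {T : ℝ} (hT : 0 < T) {φ : ℝ → ℝ} (hφ : ContDiff ℝ ∞ φ)
    (hpos : ∀ t, 0 < φ t) (hper : Function.Periodic φ T) :
    ∃ (L : ℝ) (τ σ : ℝ → ℝ), 0 < L ∧ IsCircleLift L T τ σ ∧ ∀ s, HasDerivAt τ (φ (τ s))⁻¹ s := by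
  have hφ_int : ∀ a b, IntervalIntegrable φ MeasureTheory.volume a b :=
    hφ.continuous.intervalIntegrable
  set σ : ℝ → ℝ := fun t => ∫ r in (0 : ℝ)..t, φ r
  have hderiv : ∀ t, HasDerivAt σ (φ t) t := fun t =>
    (hφ.continuous.integral_hasStrictDerivAt 0 t).hasDerivAt
  have hσ : ContDiff ℝ ∞ σ := contDiff_infty_iff_deriv.2
    ⟨fun t => (hderiv t).differentiableAt, (funext fun t => (hderiv t).deriv : deriv σ = φ) ▸ hφ⟩
  have hmono : StrictMono σ := strictMono_of_hasDerivAt_pos hderiv hpos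
  have hsurj : Function.Surjective σ := hσ.continuous.surjective
    (hper.tendsto_atTop_intervalIntegral_of_pos' (hφ_int 0 T) hpos hT)
    (hper.tendsto_atBot_intervalIntegral_of_pos' (hφ_int 0 T) hpos hT)
  set e : ℝ ≃ₜ ℝ := (hmono.orderIsoOfSurjective σ hsurj).toHomeomorph
  have hτ : ContDiff ℝ ∞ e.symm := contDiff_iff_contDiffAt.2 fun s =>
    e.toOpenPartialHomeomorph.contDiffAt_symm_deriv (hpos (e.symm s)).ne' (mem_univ s)
      (hderiv (e.symm s)) hσ.contDiffAt
  have hlift : IsCircleLift T (σ T) σ e.symm := ⟨hσ, hτ, e.symm_apply_apply, e.apply_symm_apply,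
    fun t => by simpa using hper.intervalIntegral_add_eq_add 0 t hφ_int⟩
  exact ⟨σ T, e.symm, σ, intervalIntegral.intervalIntegral_pos_of_pos (hφ_int 0 T) hpos hT,
    hlift.symm, fun s => (hderiv (e.symm s)).of_local_left_inverse
      e.symm.continuous.continuousAt (hpos _).ne' (Eventually.of_forall e.apply_symm_apply)⟩

section CircleDiffeomorphism

variable {T L : ℝ} [Fact (0 < L)]

theorem contMDiff_of_comp_coe_addCircle {E : Type*} [NormedAddCommGroup E] [NormedSpace ℝ E]
    {H : Type*} [TopologicalSpace H] {I : ModelWithCorners ℝ E H} {M : Type*} [TopologicalSpace M]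
    [ChartedSpace H M] {f : AddCircle L → M}
    (hf : ContMDiff 𝓘(ℝ, ℝ) I ∞ fun s : ℝ => f (s : AddCircle L)) :
    ContMDiff 𝓘(ℝ, ℝ) I ∞ f := by
  intro p
  refine ((hf _).comp p (contMDiffAt_extChartAt (I := 𝓘(ℝ, ℝ)))).congr_of_eventuallyEq ?_
  filter_upwards [extChartAt_source_mem_nhds (I := 𝓘(ℝ, ℝ)) p] with q hq
  have hinv := (extChartAt 𝓘(ℝ, ℝ) p).left_inv hq
  rw [extChartAt_addCircle_symm_apply] at hinv
  exact (congrArg f hinv).symm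

variable [Fact (0 < T)]

/-- The diffeomorphism of circles induced by a diffeomorphism of the line. -/
def IsCircleLift.diffeomorph {τ σ : ℝ → ℝ} (hτ : IsCircleLift L T τ σ) :
    Diffeomorph 𝓘(ℝ, ℝ) 𝓘(ℝ, ℝ) (AddCircle L) (AddCircle T) ∞ where
  toFun := hτ.periodic_coe_comp.lift
  invFun := hτ.symm.periodic_coe_comp.lift
  left_inv b := by
    obtain ⟨s, rfl⟩ := QuotientAddGroup.mk_surjective b
    exact congrArg _ (hτ.left_inv s)
  right_inv b := by
    obtain ⟨t, rfl⟩ := QuotientAddGroup.mk_surjective b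
    exact congrArg _ (hτ.right_inv t)
  contMDiff_toFun :=
    contMDiff_of_comp_coe_addCircle (contMDiff_coe_addCircle.comp hτ.contDiff.contMDiff)
  contMDiff_invFun :=
    contMDiff_of_comp_coe_addCircle (contMDiff_coe_addCircle.comp hτ.contDiff_inv.contMDiff)

theorem mfderiv_apply_of_comp_coe_addCircle {f : AddCircle L → AddCircle T} {τ : ℝ → ℝ} {s d : ℝ}
    (hf : MDifferentiableAt 𝓘(ℝ, ℝ) 𝓘(ℝ, ℝ) f (s : AddCircle L)) (hfτ : ∀ s : ℝ, f s = τ s)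
    (hτ : HasDerivAt τ d s) (v : ℝ) :
    mfderiv 𝓘(ℝ, ℝ) 𝓘(ℝ, ℝ) f (s : AddCircle L) v = v * d := by
  have hleft : HasMFDerivAt 𝓘(ℝ, ℝ) 𝓘(ℝ, ℝ) (f ∘ fun s : ℝ => (s : AddCircle L)) s
      ((mfderiv 𝓘(ℝ, ℝ) 𝓘(ℝ, ℝ) f (s : AddCircle L)).comp (ContinuousLinearMap.id ℝ ℝ)) :=
    hf.hasMFDerivAt.comp s (hasMFDerivAt_coe_addCircle s)
  have hright := (hasMFDerivAt_coe_addCircle (T := T) (τ s)).comp s hτ.hasFDerivAt.hasMFDerivAt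
  have hcomp : (f ∘ fun s : ℝ => (s : AddCircle L)) = (fun s : ℝ => (s : AddCircle T)) ∘ τ :=
    funext hfτ
  rw [hcomp] at hleft
  exact congrArg (fun A => A v) (hasMFDerivAt_unique hleft hright)

end CircleDiffeomorphism

section Derdzinski

variable {k : ℝ} {w τ : ℝ → ℝ}

theorem deriv_rpow_comp_of_hasDerivAt (hk : k ≠ -1) (hk' : k ≠ 1) (hw : Differentiable ℝ w)
    (hpos : ∀ t, 0 < w t) (hτ : ∀ s, HasDerivAt τ (w (τ s) ^ (2 / (k - 1)))⁻¹ s) :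
    deriv (fun s => w (τ s) ^ ((k + 1) / (k - 1))) =
      fun s => (k + 1) / (k - 1) * deriv w (τ s) := by
  funext s
  have hadd : k + 1 ≠ 0 := fun h => hk (eq_neg_of_add_eq_zero_left h)
  have hsub : k - 1 ≠ 0 := sub_ne_zero.2 hk'
  have hcomp : HasDerivAt (fun s => w (τ s)) _ s := (hw (τ s)).hasDerivAt.comp s (hτ s)
  have hexp : (k + 1) / (k - 1) - 1 = 2 / (k - 1) := by
    field_simp
    ring
  rw [(hcomp.rpow_const (Or.inl (hpos _).ne')).deriv, hexp]
  have := (Real.rpow_pos_of_pos (hpos (τ s)) (2 / (k - 1))).ne'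
  field_simp

theorem iteratedDeriv_two_rpow_comp_of_hasDerivAt (hk : k ≠ -1) (hk' : k ≠ 1)
    (hw : ContDiff ℝ 2 w) (hpos : ∀ t, 0 < w t)
    (hτ : ∀ s, HasDerivAt τ (w (τ s) ^ (2 / (k - 1)))⁻¹ s) (s : ℝ) :
    iteratedDeriv 2 (fun s => w (τ s) ^ ((k + 1) / (k - 1))) s =
      (k + 1) / (k - 1) * (deriv (deriv w) (τ s) * (w (τ s) ^ (2 / (k - 1)))⁻¹) := by
  have hw' : Differentiable ℝ (deriv w) := (hw.iterate_deriv' 1 1).differentiable (by simp)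
  have hcomp : HasDerivAt (fun s => deriv w (τ s)) _ s := (hw' (τ s)).hasDerivAt.comp s (hτ s)
  rw [iteratedDeriv_succ, iteratedDeriv_one,
    deriv_rpow_comp_of_hasDerivAt hk hk' (hw.differentiable (by simp)) hpos hτ,
    (hcomp.const_mul _).deriv]

theorem derdzinski_equation_of_yamabe_equation {K : ℝ} (hk : 1 < k) (hw : ContDiff ℝ 2 w)
    (hpos : ∀ t, 0 < w t)
    (hode : ∀ t, deriv (deriv w) t = ((k - 1) / 2) ^ 2 * w t - K *
      w t ^ (((k - 1) / 2 + 2) / ((k - 1) / 2)))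
    (hτ : ∀ s, HasDerivAt τ (w (τ s) ^ (2 / (k - 1)))⁻¹ s) (s : ℝ) :
    iteratedDeriv 2 (fun s => w (τ s) ^ ((k + 1) / (k - 1))) s -
        (k + 1) * (k * (k - 1)) / (4 * k) * (w (τ s) ^ ((k + 1) / (k - 1))) ^ (1 - 4 / (k + 1)) =
      -((k + 1) / 4 * (4 * K / (k - 1)) * w (τ s) ^ ((k + 1) / (k - 1))) := by
  have hk0 : k ≠ 0 := by linarith
  have hadd : k + 1 ≠ 0 := by linarith
  have hsub : k - 1 ≠ 0 := by linarith
  rw [iteratedDeriv_two_rpow_comp_of_hasDerivAt (by linarith) hk.ne' hw hpos hτ, hode,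
    ← Real.rpow_mul (hpos _).le, ← Real.rpow_neg (hpos _).le]
  generalize w (τ s) = y, hpos (τ s) = hy
  have hexp : (k + 1) / (k - 1) * (1 - 4 / (k + 1)) = 1 + -(2 / (k - 1)) := by
    field_simp
    ring
  have hlinear : y ^ ((k + 1) / (k - 1) * (1 - 4 / (k + 1))) = y * y ^ (-(2 / (k - 1))) := by
    rw [hexp, Real.rpow_add hy, Real.rpow_one]
  have hpower : y ^ ((k + 1) / (k - 1)) =
      y ^ (((k - 1) / 2 + 2) / ((k - 1) / 2)) * y ^ (-(2 / (k - 1))) := by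
    rw [← Real.rpow_add hy]
    congr 1
    field_simp
    ring
  rw [hlinear, hpower]
  field_simp
  ring

end Derdzinski

/-! ### Derdzinski metrics -/

section Pullback

variable {E : Type*} [NormedAddCommGroup E] [NormedSpace ℝ E]
  {H : Type*} [TopologicalSpace H] {I : ModelWithCorners ℝ E H}
  {N : Type*} [TopologicalSpace N] [ChartedSpace H N]

theorem MetricTensor.pullback_eq_smul {E' : Type*} [NormedAddCommGroup E'] [NormedSpace ℝ E']
    {H' : Type*} [TopologicalSpace H'] {J : ModelWithCorners ℝ E' H'}
    {M : Type*} [TopologicalSpace M] [ChartedSpace H' M] {f : M → N} {ρ : N → ℝ}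
    {g g' : MetricTensor I N} (hg : ∀ x, g x = ρ x • g' x) (x : M) :
    MetricTensor.pullback J f g x = ρ (f x) • MetricTensor.pullback J f g' x :=
  ContinuousLinearMap.ext fun v => ContinuousLinearMap.ext fun w => by
    rw [MetricTensor.pullback_apply, hg]
    rfl

theorem warpedMetric_apply {L : ℝ} [Fact (0 < L)] (φ : AddCircle L → ℝ) (gN : MetricTensor I N)
    (p : AddCircle L × N) (v w : ℝ × E) :
    warpedMetric L φ gN p v w = v.1 * w.1 + φ p.1 * gN p.2 v.2 w.2 := by
  have hfst : ∀ v : ℝ × E, mfderiv (𝓘(ℝ, ℝ).prod I) 𝓘(ℝ, ℝ)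
      (Prod.fst : AddCircle L × N → AddCircle L) p v = v.1 := fun v => by
    rw [mfderiv_fst]
    rfl
  have hsnd : ∀ v : ℝ × E, mfderiv (𝓘(ℝ, ℝ).prod I) I
      (Prod.snd : AddCircle L × N → N) p v = v.2 := fun v => by
    rw [mfderiv_snd]
    rfl
  exact congrArg₂ (fun s t : ℝ => s + φ p.1 * t)
    (congrArg₂ (fun s t : ℝ => s * t) (hfst v) (hfst w))
    (congrArg₂ (fun s t => gN p.2 s t) (hsnd v) (hsnd w))

end Pullback

variable {k : ℕ} {T L : ℝ} [Fact (0 < T)] [Fact (0 < L)]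

theorem cylinderMetric_eq_warpedMetric :
    cylinderMetric T k = warpedMetric T (fun _ => 1) (roundMetric k) := by
  funext p
  rw [cylinderMetric, warpedMetric, one_smul]

theorem cylinderMetric_apply (p : AddCircle T × UnitSphere k)
    (v w : ℝ × EuclideanSpace ℝ (Fin k)) :
    cylinderMetric T k p v w = v.1 * w.1 + roundMetric k p.2 v.2 w.2 := by
  rw [cylinderMetric_eq_warpedMetric]
  exact (warpedMetric_apply _ _ p v w).trans (by rw [one_mul])

namespace IsCircleLift

variable {τ σ : ℝ → ℝ} (hτ : IsCircleLift L T τ σ)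

/-- The diffeomorphism of cylinders which reparametrizes the circle and fixes the sphere. -/
def cylinderDiffeomorph (k : ℕ) : Diffeomorph (cylinderModel k) (cylinderModel k)
    (AddCircle L × UnitSphere k) (AddCircle T × UnitSphere k) ∞ :=
  hτ.diffeomorph.prodCongr (Diffeomorph.refl (𝓡 k) (UnitSphere k) ∞)

theorem mfderiv_cylinderDiffeomorph_apply {s d : ℝ} (hd : HasDerivAt τ d s) (ξ : UnitSphere k)
    (v : ℝ × EuclideanSpace ℝ (Fin k)) :
    mfderiv (cylinderModel k) (cylinderModel k) (hτ.cylinderDiffeomorph k)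
      ((s : AddCircle L), ξ) v = ((v.1 * d, v.2) : ℝ × EuclideanSpace ℝ (Fin k)) := by
  have hcircle : MDifferentiableAt 𝓘(ℝ, ℝ) 𝓘(ℝ, ℝ) hτ.diffeomorph (s : AddCircle L) :=
    hτ.diffeomorph.contMDiff.mdifferentiable (by simp) _
  have hprod : HasMFDerivAt (cylinderModel k) (cylinderModel k)
      (Prod.map hτ.diffeomorph (id : UnitSphere k → UnitSphere k)) ((s : AddCircle L), ξ) _ :=
    HasMFDerivAt.prodMap hcircle.hasMFDerivAt (hasMFDerivAt_id ξ)
  change mfderiv (cylinderModel k) (cylinderModel k)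
    (Prod.map hτ.diffeomorph (id : UnitSphere k → UnitSphere k)) ((s : AddCircle L), ξ) v = _
  rw [hprod.mfderiv]
  refine Prod.ext (mfderiv_apply_of_comp_coe_addCircle hcircle (fun _ => rfl) hd v.1) ?_
  change mfderiv (𝓡 k) (𝓡 k) (id : UnitSphere k → UnitSphere k) ξ v.2 = v.2
  rw [mfderiv_id]
  rfl

theorem pullback_cylinderMetric_apply {s d : ℝ} (hd : HasDerivAt τ d s) (ξ : UnitSphere k)
    (v w : ℝ × EuclideanSpace ℝ (Fin k)) :
    MetricTensor.pullback (cylinderModel k) (hτ.cylinderDiffeomorph k) (cylinderMetric T k)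
      ((s : AddCircle L), ξ) v w = v.1 * d * (w.1 * d) + roundMetric k ξ v.2 w.2 :=
  (congrArg₂ (fun v w : ℝ × EuclideanSpace ℝ (Fin k) =>
    cylinderMetric T k (hτ.diffeomorph (s : AddCircle L), ξ) v w)
    (hτ.mfderiv_cylinderDiffeomorph_apply hd ξ v)
    (hτ.mfderiv_cylinderDiffeomorph_apply hd ξ w)).trans (cylinderMetric_apply _ _ _)

end IsCircleLift

/-- The solution `h = u ^ (n / (n - 2))`, `n = k + 1`, of Derdzinski's equation: a radial conformal
factor `u`, read along the meridian through `ξ` in the arc length parameter of the circle of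
length `L`. -/
def derdzinskiSolution {τ σ : ℝ → ℝ} (hτ : IsCircleLift L T τ σ)
    (u : AddCircle T × UnitSphere k → ℝ) (ξ : UnitSphere k) (b : AddCircle L) : ℝ :=
  u (hτ.diffeomorph b, ξ) ^ (((k : ℝ) + 1) / (k - 1))

namespace IsConformalFactor

variable {u : AddCircle T × UnitSphere k → ℝ}
  {g : MetricTensor (cylinderModel k) (AddCircle T × UnitSphere k)} (h : IsConformalFactor u g)
  {c : ℝ} (hc : ∀ x, scalarCurvature g x = c)

include h

theorem exists_isCircleLift (ξ : UnitSphere k) :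
    ∃ (L : ℝ) (τ σ : ℝ → ℝ), 0 < L ∧ IsCircleLift L T τ σ ∧
      ∀ s, HasDerivAt τ (u (τ s, ξ) ^ (2 / ((k : ℝ) - 1)))⁻¹ s :=
  exists_isCircleLift_hasDerivAt Fact.out
    ((contDiff_slice h.contMDiff ξ).rpow_const_of_ne fun _ => (h.pos _).ne')
    (fun _ => Real.rpow_pos_of_pos (h.pos _) _) fun t => by
      beta_reduce
      rw [AddCircle.coe_add, AddCircle.coe_period, add_zero]

theorem contMDiff_rpow (e : ℝ) : ContMDiff (cylinderModel k) 𝓘(ℝ, ℝ) ∞ fun x => u x ^ e := fun x =>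
  (Real.contDiffAt_rpow_const_of_ne (h.pos x).ne').contMDiffAt.comp x (h.contMDiff x)

theorem cylinderMetric_eq_smul (x : AddCircle T × UnitSphere k) :
    cylinderMetric T k x = u x ^ (-(4 / ((k : ℝ) - 1))) • g x := by
  rw [h.metric_eq, Real.rpow_neg (h.pos x).le,
    inv_smul_smul₀ (Real.rpow_pos_of_pos (h.pos x) _).ne']

variable {τ σ : ℝ → ℝ} {hτ : IsCircleLift L T τ σ} {ξ : UnitSphere k}

theorem derdzinskiSolution_rpow {e : ℝ} (b : AddCircle L) :
    derdzinskiSolution hτ u ξ b ^ (e / ((k : ℝ) + 1)) =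
      u (hτ.diffeomorph b, ξ) ^ (e / ((k : ℝ) - 1)) := by
  have := h.sub_one_pos.ne'
  have : (k : ℝ) + 1 ≠ 0 := by positivity
  rw [derdzinskiSolution, ← Real.rpow_mul (h.pos _).le]
  congr 1
  field_simp

theorem contDiff_derdzinskiSolution :
    ContDiff ℝ ∞ fun s : ℝ => derdzinskiSolution hτ u ξ s :=
  ((contDiff_slice h.contMDiff ξ).comp hτ.contDiff).rpow_const_of_ne fun _ => (h.pos _).ne'

include hc

theorem not_derdzinskiSolution_eq_const (hne : ¬ ∃ b, ∀ x, u x = b) :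
    ¬ ∃ b, ∀ x, derdzinskiSolution hτ u ξ x = b := by
  rintro ⟨b, hb⟩
  refine hne ⟨b ^ (((k : ℝ) - 1) / (k + 1)), ?_⟩
  rintro ⟨q, η⟩
  obtain ⟨t, rfl⟩ := QuotientAddGroup.mk_surjective q
  obtain ⟨q, hq : hτ.diffeomorph q = t⟩ := hτ.diffeomorph.surjective t
  have hroot := h.derdzinskiSolution_rpow (e := (k : ℝ) - 1) (hτ := hτ) (ξ := ξ) q
  rw [hb, hq, div_self h.sub_one_pos.ne', Real.rpow_one] at hroot
  exact (h.apply_eq_apply hc t η ξ).trans hroot.symm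

theorem derdzinskiSolution_equation
    (hder : ∀ s, HasDerivAt τ (u (τ s, ξ) ^ (2 / ((k : ℝ) - 1)))⁻¹ s) (s : ℝ) :
    iteratedDeriv 2 (fun s : ℝ => derdzinskiSolution hτ u ξ s) s -
        ((k : ℝ) + 1) * (k * (k - 1)) / (4 * k) *
          derdzinskiSolution hτ u ξ s ^ (1 - 4 / ((k : ℝ) + 1)) =
      -(((k : ℝ) + 1) / 4 * (4 * (c * (k - 1) / (4 * k)) / (k - 1)) *
        derdzinskiSolution hτ u ξ s) :=
  derdzinski_equation_of_yamabe_equation (sub_pos.1 h.sub_one_pos)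
    ((contDiff_slice h.contMDiff ξ).of_le (by norm_cast)) (fun _ => h.pos _)
    (h.deriv_deriv_slice hc ξ) hder s

theorem pullback_eq_warpedMetric
    (hder : ∀ s, HasDerivAt τ (u (τ s, ξ) ^ (2 / ((k : ℝ) - 1)))⁻¹ s) :
    MetricTensor.pullback (cylinderModel k) (hτ.cylinderDiffeomorph k) g =
      warpedMetric L (fun b => derdzinskiSolution hτ u ξ b ^ (4 / ((k : ℝ) + 1)))
        (roundMetric k) := by
  funext ⟨b, η⟩
  obtain ⟨s, rfl⟩ := QuotientAddGroup.mk_surjective b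
  have huτ : u (τ s, η) = u (τ s, ξ) := h.apply_eq_apply hc (τ s) η ξ
  have hsq : u (τ s, ξ) ^ (4 / ((k : ℝ) - 1)) =
      u (τ s, ξ) ^ (2 / ((k : ℝ) - 1)) * u (τ s, ξ) ^ (2 / ((k : ℝ) - 1)) := by
    rw [← Real.rpow_add (h.pos _)]
    congr 1
    ring
  have hsol := h.derdzinskiSolution_rpow (hτ := hτ) (ξ := ξ) (e := 4) (s : AddCircle L)
  change _ = u (τ s, ξ) ^ _ at hsol
  refine ContinuousLinearMap.ext fun v => ContinuousLinearMap.ext fun w => ?_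
  rw [MetricTensor.pullback_eq_smul h.metric_eq]
  calc u (τ s, η) ^ (4 / ((k : ℝ) - 1)) * MetricTensor.pullback (cylinderModel k)
        (hτ.cylinderDiffeomorph k) (cylinderMetric T k) (s, η) v w
      = u (τ s, ξ) ^ (2 / ((k : ℝ) - 1)) * u (τ s, ξ) ^ (2 / ((k : ℝ) - 1)) *
          (v.1 * (u (τ s, ξ) ^ (2 / ((k : ℝ) - 1)))⁻¹ * (w.1 *
            (u (τ s, ξ) ^ (2 / ((k : ℝ) - 1)))⁻¹) + roundMetric k η v.2 w.2) := by
        rw [huτ, hsq]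
        exact congrArg _ (hτ.pullback_cylinderMetric_apply (hder s) η v w)
    _ = v.1 * w.1 + derdzinskiSolution hτ u ξ s ^ (4 / ((k : ℝ) + 1)) *
          roundMetric k η v.2 w.2 := by
        rw [hsol, hsq]
        have := (Real.rpow_pos_of_pos (h.pos (τ s, ξ)) (2 / ((k : ℝ) - 1))).ne'
        field_simp
    _ = _ := (warpedMetric_apply (fun b => derdzinskiSolution hτ u ξ b ^ (4 / ((k : ℝ) + 1)))
        (roundMetric k) (s, η) v w).symm

theorem isDerdzinskiMetric_pullback (hne : ¬ ∃ b, ∀ x, u x = b)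
    (hder : ∀ s, HasDerivAt τ (u (τ s, ξ) ^ (2 / ((k : ℝ) - 1)))⁻¹ s) :
    IsDerdzinskiMetric (k + 1) L (roundMetric k)
      (MetricTensor.pullback (cylinderModel k) (hτ.cylinderDiffeomorph k) g) := by
  have hk := h.sub_one_pos
  have hk0 : 0 < (k : ℝ) := by linarith
  have hcpos := h.const_pos hc
  refine ⟨by simp, k * (k - 1), by positivity, isEinstein_roundMetric (by exact_mod_cast hk0.ne'),
    derdzinskiSolution hτ u ξ, fun b => Real.rpow_pos_of_pos (h.pos _) _,
    h.not_derdzinskiSolution_eq_const hc hne, h.contDiff_derdzinskiSolution,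
    ⟨4 * (c * (k - 1) / (4 * k)) / (k - 1), by positivity, fun s => ?_⟩, ?_⟩
  · rw [Nat.cast_add_one, add_sub_cancel_right]
    exact h.derdzinskiSolution_equation hc hder s
  · rw [Nat.cast_add_one]
    exact h.pullback_eq_warpedMetric hc hder

theorem exists_isDerdzinskiMetric (hne : ¬ ∃ b, ∀ x, u x = b) :
    ∃ (L : ℝ) (_ : Fact (0 < L))
      (gD : MetricTensor (cylinderModel k) (AddCircle L × UnitSphere k))
      (F : Diffeomorph (cylinderModel k) (cylinderModel k)
        (AddCircle L × UnitSphere k) (AddCircle T × UnitSphere k) ∞)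
      (ψ : AddCircle L × UnitSphere k → ℝ),
      IsDerdzinskiMetric (k + 1) L (roundMetric k) gD ∧
      gD = MetricTensor.pullback (cylinderModel k) F g ∧
      ContMDiff (cylinderModel k) 𝓘(ℝ, ℝ) ∞ ψ ∧ (∀ x, 0 < ψ x) ∧
      ∀ x, MetricTensor.pullback (cylinderModel k) F (cylinderMetric T k) x = ψ x • gD x := by
  obtain ⟨L, τ, σ, hL, hτ, hder⟩ := h.exists_isCircleLift (toSphere 0)
  have : Fact (0 < L) := ⟨hL⟩
  refine ⟨L, this, _, hτ.cylinderDiffeomorph k, _, h.isDerdzinskiMetric_pullback hc hne hder, rfl,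
    (h.contMDiff_rpow _).comp (hτ.cylinderDiffeomorph k).contMDiff,
    fun x => Real.rpow_pos_of_pos (h.pos _) _,
    MetricTensor.pullback_eq_smul h.cylinderMetric_eq_smul⟩

end IsConformalFactor

end

theorem theorem1 (n : ℕ) (hn : 3 ≤ n) (T : ℝ) [Fact (0 < T)]
    (hT : T > 2 * Real.pi / √((n : ℝ) - 2))
    (g : MetricTensor (cylinderModel (n - 1)) (AddCircle T × UnitSphere (n - 1)))
    (hg : IsPseudoCylindric n T g) :
    HasHarmonicCurvature g ∧ ¬ HasParallelRicci g ∧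
    ∃ (L : ℝ) (_ : Fact (0 < L))
      (gD : MetricTensor (cylinderModel (n - 1)) (AddCircle L × UnitSphere (n - 1)))
      (F : Diffeomorph (cylinderModel (n - 1)) (cylinderModel (n - 1))
        (AddCircle L × UnitSphere (n - 1)) (AddCircle T × UnitSphere (n - 1)) ∞)
      (ψ : AddCircle L × UnitSphere (n - 1) → ℝ),
      IsDerdzinskiMetric n L (roundMetric (n - 1)) gD ∧
      gD = MetricTensor.pullback (cylinderModel (n - 1)) F g ∧
      ContMDiff (cylinderModel (n - 1)) 𝓘(ℝ, ℝ) ∞ ψ ∧ (∀ x, 0 < ψ x) ∧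
      ∀ x, MetricTensor.pullback (cylinderModel (n - 1)) F (cylinderMetric T (n - 1)) x
        = ψ x • gD x := by
  obtain ⟨k, rfl⟩ : ∃ k, n = k + 1 := ⟨n - 1, by omega⟩
  obtain ⟨u, hu, hpos, hne, hgu, c, hc⟩ := hg
  have hcast : ((k + 1 : ℕ) : ℝ) - 2 = k - 1 := by
    push_cast
    ring
  have h : IsConformalFactor u g := ⟨by omega, hu, hpos, fun x => by rw [hgu, hcast]; rfl⟩
  exact ⟨h.hasHarmonicCurvature hc, h.not_hasParallelRicci hc hne,
    h.exists_isDerdzinskiMetric hc hne⟩
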